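/- **Theorem 1.4.** Let $d\ge 1$ and let $|\cdot|$ be the Euclidean norm (or the maximum norm) on $\mathbb R^d$. Let $\nu$ be a probability measure on a measurable space $M$ of vertex marks, and let $\mathbf p:(\mathbb R^d\times M)^2\to[0,1]$ be measurable and symmetric. Consider one of the following two cases. - *Poisson case:* $I=(0,\infty)$; $\mathbf p$ is invariant under simultaneous shifts of both locations by any $s\in\mathbb R^d$; for $\lambda\in I$, the marked vertex set $\mathscr V$ is a Poisson process on $\mathbb R^d\times M$ with intensity measure $\lambda\,\mathrm{Leb}\otimes\nu$. - *Bernoulli case:* $I=(0,1]$; $\mathbf p$ is invariant under simultaneous shifts by any $s\in\mathbb Z^d$; for $\lambda\in I$, every site of $\mathbb Z^d$ is a vertex independently with probability $\lambda$, and the vertices carry i.i.d. marks of law $\nu$. For $\lambda\in I$ let $\mathbb P_\lambda$ be the law of the random simple graph on $\mathscr V$ in which, given $\mathscr V$, the edges between different unordered pairs of vertices occur independently, with probability $\mathbf p(\boldsymbol x,\boldsymbol y)$ for the pair $\{\boldsymbol x,\boldsymbol y\}$ (the functions $\mathbf p$ and the law $\nu$ do not depend on $\lambda$). For $r,c>0$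 let $\mathcal L(r,c)$ be the event that there is an edge $\boldsymbol x\sim\boldsymbol y$ whose end vertices have locations $x,y$ with $|x|<r$ and $|x-y|>cr$. Say that Property $\mathscr L_\lambda$ holds if $\limsup_{r\to\infty}\mathbb P_\lambda(\mathcal L(r,c))=0$ for all $c>0$. Let $B(r)$ be the open ball of radius $r$ around the origin, and let $$\widehat\lambda_{\mathsf c}=\inf\Big\{\lambda\in I:\ \limsup_{r\to\infty}\mathbb P_\lambda\big(\text{some vertex in }B(r)\text{ is connected by a path to some vertex in }B(2r)^{\mathsf c}\big)>0\Big\}\in[0,\infty],\qquad \inf\emptyset=\infty .$$ Then: 1. for every $\lambda\in I$, $\mathbb P_1(\mathcal L(r,1))\asymp\mathbb P_\lambda(\mathcal L(r,1))$ as $r\to\infty$, that is, each side is bounded by a constant (which may depend on $\lambda$) times the other for all large $r$; 2. Property $\mathscr L_\lambda$ does not depend on $\lambda$: for all $\lambda,\lambda'\in I$, $\mathscr L_\lambda$ holds if and only if $\mathscr L_{\lambda'}$ holds; 3. $\mathscr L_1$ holds if and only if $\widehat\lambda_{\mathsf c}>0$. -/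

import Mathlib

open Set Filter Topology MeasureTheory ProbabilityTheory Asymptotics
open scoped ENNReal NNReal

noncomputable section

/-- Locations live in `ℝ^d`; the norm used to measure distances is kept explicit below. -/
abbrev Pos (d : ℕ) : Type := Fin d → ℝ

/-- The Euclidean norm on `ℝ^d`. -/
def euclideanNorm (d : ℕ) (x : Pos d) : ℝ := Real.sqrt (∑ k, (x k) ^ 2)

/-- The maximum norm on `ℝ^d` (this is the norm Mathlib puts on `Fin d → ℝ`). -/
def maxNorm (d : ℕ) (x : Pos d) : ℝ := ‖x‖

/-- The point of `ℝ^d` given by a lattice site of `ℤ^d`. -/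
def latticePoint {d : ℕ} (z : Fin d → ℤ) : Pos d := fun k => (z k : ℝ)

/-- The two kinds of vertex sets with independent increments: a homogeneous Poisson point
process on `ℝ^d`, or Bernoulli site percolation on `ℤ^d`. -/
inductive VertexKind : Type
  | poisson
  | bernoulli

/-- The admissible intensities: `(0,∞)` for Poisson, retention probabilities in `(0,1]` for
Bernoulli. -/
def VertexKind.intensities : VertexKind → Set ℝ
  | .poisson => Ioi 0
  | .bernoulli => Ioc 0 1

/-- The shifts under which the model is translation invariant: all of `ℝ^d` for Poisson, only
`ℤ^d` for Bernoulli. -/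
def VertexKind.shifts (d : ℕ) : VertexKind → Set (Pos d)
  | .poisson => univ
  | .bernoulli => range latticePoint

/-- A connection function: a measurable, symmetric, translation invariant function of the two
marked end vertices (location, mark), with values in `[0,1]`. -/
structure IsConnectionFunction (kind : VertexKind) {d : ℕ} {M : Type*} [MeasurableSpace M]
    (p : Pos d × M → Pos d × M → ℝ) : Prop where
  measurable : Measurable (Function.uncurry p)
  mem_unit : ∀ x y, p x y ∈ Icc (0 : ℝ) 1
  symm : ∀ x y, p x y = p y x
  shift : ∀ s ∈ kind.shifts d, ∀ x y : Pos d × M,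
    p (x.1 + s, x.2) (y.1 + s, y.2) = p x y

/-- A graph depending on `ω : Ω` whose (marked) vertices are enumerated by indices: the vertex
set at `ω` is `{vertex i ω | i ∈ occ ω}`, a vertex being a pair (location, mark). Edges are
recorded between the indices, and only occupied indices carry edges. -/
structure RandomGraph (Ω : Type*) (d : ℕ) (M : Type*) where
  occ : Ω → Set ℕ
  vertex : ℕ → Ω → Pos d × M
  graph : Ω → SimpleGraph ℕ
  occ_of_adj : ∀ ω i j, (graph ω).Adj i j → i ∈ occ ω

namespace RandomGraph

variable {Ω : Type*} {d : ℕ} {M : Type*} (G : RandomGraph Ω d M)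

/-- The location of the vertex with index `i`. -/
def loc (i : ℕ) (ω : Ω) : Pos d := (G.vertex i ω).1

/-- The number of vertices in `B ⊆ ℝ^d × M`. -/
def count (B : Set (Pos d × M)) (ω : Ω) : ℕ∞ :=
  {i : ℕ | i ∈ G.occ ω ∧ G.vertex i ω ∈ B}.encard

/-- The σ-algebra generated by the marked vertex set (with its enumeration). -/
@[reducible] def vertexSigma [MeasurableSpace M] : MeasurableSpace Ω :=
  ⨆ i : ℕ, (MeasurableSpace.comap (G.vertex i) inferInstance ⊔
    MeasurableSpace.generateFrom {{ω | i ∈ G.occ ω}})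

/-- The event that there is an edge longer than `c * r` with an end vertex in the ball of
radius `r` around the origin; `nrm` is the norm in use. -/
def longEdge (nrm : Pos d → ℝ) (r c : ℝ) : Set Ω :=
  {ω | ∃ i j, (G.graph ω).Adj i j ∧ nrm (G.loc i ω) < r ∧
    c * r < nrm (G.loc i ω - G.loc j ω)}

/-- The event that some vertex in the ball `B(r)` is connected by a path of the graph to some
vertex outside of `B(2r)`. -/
def annulusCrossing (nrm : Pos d → ℝ) (r : ℝ) : Set Ω :=
  {ω | ∃ i ∈ G.occ ω, ∃ j ∈ G.occ ω, nrm (G.loc i ω) < r ∧ 2 * r ≤ nrm (G.loc j ω) ∧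
    (G.graph ω).Reachable i j}

/-- The no-long-edges property: `limsup_{r → ∞} P(longEdge r c) = 0` for all `c > 0`. -/
def NoLongEdges [MeasurableSpace Ω] (nrm : Pos d → ℝ) (P : Measure Ω) : Prop :=
  ∀ c : ℝ, 0 < c → limsup (fun r : ℝ => P (G.longEdge nrm r c)) atTop = 0

end RandomGraph

/-- The vertices form a Poisson process on `ℝ^d × M` with intensity measure
`l • (Lebesgue ⊗ ν)`, i.e. a homogeneous Poisson process of intensity `l` on `ℝ^d` with
i.i.d. marks of law `ν`. -/
structure IsMarkedPoisson {Ω : Type*} [MeasurableSpace Ω] {d : ℕ} {M : Type*} [MeasurableSpace M]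
    (l : ℝ) (ν : Measure M) (P : Measure Ω) (G : RandomGraph Ω d M) : Prop where
  count_law : ∀ B : Set (Pos d × M), MeasurableSet B →
    (ENNReal.ofReal l • (volume : Measure (Pos d)).prod ν) B ≠ ∞ → ∀ k : ℕ,
      P {ω | G.count B ω = k} =
        poissonMeasure ((ENNReal.ofReal l • (volume : Measure (Pos d)).prod ν) B).toNNReal {k}
  count_indep : ∀ (n : ℕ) (B : Fin n → Set (Pos d × M)), (∀ a, MeasurableSet (B a)) →
    Pairwise (fun a b => Disjoint (B a) (B b)) → iIndepFun (fun a => G.count (B a)) P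

/-- The vertices form a Bernoulli site-percolated lattice with i.i.d. marks: independently for
different sites, `z ∈ ℤ^d` carries a vertex with probability `l`, whose mark then has law `ν`. -/
structure IsMarkedBernoulli {Ω : Type*} [MeasurableSpace Ω] {d : ℕ} {M : Type*}
    [MeasurableSpace M] (l : ℝ) (ν : Measure M) (P : Measure Ω) (G : RandomGraph Ω d M) :
    Prop where
  mem_lattice : ∀ᵐ ω ∂P, ∀ i ∈ G.occ ω, G.loc i ω ∈ range (latticePoint (d := d))
  site_law : ∀ (z : Fin d → ℤ) (A : Set M), MeasurableSet A →
    P {ω | G.count ({latticePoint z} ×ˢ A) ω = 1} = ENNReal.ofReal l * ν A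
  site_indep : ∀ A : (Fin d → ℤ) → Set M, (∀ z, MeasurableSet (A z)) →
    iIndepFun (fun z => G.count ({latticePoint z} ×ˢ A z)) P

/-- The law of the vertex set, for either kind. -/
def HasVertexLaw (kind : VertexKind) {Ω : Type*} [MeasurableSpace Ω] {d : ℕ} {M : Type*}
    [MeasurableSpace M] (l : ℝ) (ν : Measure M) (P : Measure Ω) (G : RandomGraph Ω d M) : Prop :=
  match kind with
  | .poisson => IsMarkedPoisson l ν P G
  | .bernoulli => IsMarkedBernoulli l ν P G

open Classical in
/-- The independent setting at intensity `l`: the marked vertex set is (simple and) a marked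
Poisson process or a marked Bernoulli percolated lattice of intensity `l`, and, given the vertex
set, the edges between different unordered pairs of vertices occur independently, the pair
`{x, y}` being an edge with probability `p x y`. -/
structure IndependentSetting (kind : VertexKind) {Ω : Type*} [MeasurableSpace Ω] {d : ℕ}
    {M : Type*} [MeasurableSpace M] (l : ℝ) (ν : Measure M) (p : Pos d × M → Pos d × M → ℝ)
    (P : Measure Ω) (G : RandomGraph Ω d M) : Prop where
  prob : IsProbabilityMeasure P
  measurable_occ : ∀ i, MeasurableSet {ω | i ∈ G.occ ω}
  measurable_vertex : ∀ i, Measurable (G.vertex i)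
  measurable_adj : ∀ i j, MeasurableSet {ω | (G.graph ω).Adj i j}
  simple : ∀ᵐ ω ∂P, ∀ i ∈ G.occ ω, ∀ j ∈ G.occ ω, G.loc i ω = G.loc j ω → i = j
  vertex_law : HasVertexLaw kind l ν P G
  edge_law : ∀ F : Finset (ℕ × ℕ), (∀ e ∈ F, e.1 < e.2) →
    P[(⋂ e ∈ F, {ω | (G.graph ω).Adj e.1 e.2}).indicator (fun _ => (1 : ℝ)) | G.vertexSigma]
      =ᵐ[P] fun ω => ∏ e ∈ F,
        if e.1 ∈ G.occ ω ∧ e.2 ∈ G.occ ω then p (G.vertex e.1 ω) (G.vertex e.2 ω) else 0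

/-- The critical annulus-crossing intensity, as an element of `[0,∞]` (so `inf ∅ = ∞`), of a
family of random graphs `G l` on probability spaces `(Ω l, P l)`, `l ∈ I`. -/
def criticalAnnulus {d : ℕ} {M : Type*} (I : Set ℝ) (nrm : Pos d → ℝ) {Ω : ℝ → Type*}
    [∀ l, MeasurableSpace (Ω l)] (P : ∀ l, Measure (Ω l)) (G : ∀ l, RandomGraph (Ω l) d M) :
    ℝ≥0∞ :=
  sInf (ENNReal.ofReal ''
    {l ∈ I | 0 < limsup (fun r : ℝ => P l ((G l).annulusCrossing nrm r)) atTop})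

end

noncomputable section

open RandomGraph

theorem countable_embedding_nat (ι : Type*) [Finite ι] : Countable (ι ↪ ℕ) :=
  Function.Injective.countable (f := fun t : ι ↪ ℕ => (t : ι → ℕ)) DFunLike.coe_injective

/-! ### Separating points of different locations by small cells -/

/-- Tuples of marked points with pairwise different locations. -/
def distinctLoc (ι : Type*) (d : ℕ) (M : Type*) : Set (ι → Pos d × M) :=
  {x | Function.Injective fun i => (x i).1}

theorem measurableSet_distinctLoc (ι : Type*) [Finite ι] (d : ℕ) (M : Type*) [MeasurableSpace M] :
    MeasurableSet (distinctLoc ι d M) := by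
  have : distinctLoc ι d M = ⋂ i : ι, ⋂ j : ι, ⋂ _ : i ≠ j, {x | (x i).1 = (x j).1}ᶜ := by
    ext x
    simp only [distinctLoc, mem_ofPred_eq, mem_iInter, mem_compl_iff]
    exact ⟨fun h i j hij he => hij (h he), fun h i j he => by_contra fun hij => h i j hij he⟩
  rw [this]
  have := Finite.to_countable (α := ι)
  refine MeasurableSet.iInter fun i => MeasurableSet.iInter fun j => MeasurableSet.iInter fun _ => ?_
  exact (measurableSet_eq_fun (by fun_prop) (by fun_prop)).compl

/-- Families of sets of marked points whose location sets are small and pairwise disjoint. -/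
structure SmallSeparated {ι : Type*} {d : ℕ} {M : Type*} (B : ι → Set (Pos d × M)) : Prop where
  loc_ne : ∀ i j, i ≠ j → ∀ x ∈ B i, ∀ y ∈ B j, x.1 ≠ y.1
  dist_lt : ∀ i, ∀ x ∈ B i, ∀ y ∈ B i, dist x.1 y.1 < 1

theorem SmallSeparated.mono {ι : Type*} {d : ℕ} {M : Type*} {B C : ι → Set (Pos d × M)}
    (h : SmallSeparated B) (hC : ∀ i, C i ⊆ B i) : SmallSeparated C :=
  ⟨fun i j hij x hx y hy => h.loc_ne i j hij x (hC i hx) y (hC j hy),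
    fun i x hx y hy => h.dist_lt i x (hC i hx) y (hC i hy)⟩

/-- The half-open cube of side `1 / k` with corner `z / k`. -/
def gridCell {d : ℕ} (M : Type*) (k : ℕ) (z : Fin d → ℤ) : Set (Pos d × M) :=
  {x | ∀ j, ⌊(k : ℝ) * x.1 j⌋ = z j}

theorem measurableSet_gridCell {d : ℕ} (M : Type*) [MeasurableSpace M] (k : ℕ) (z : Fin d → ℤ) :
    MeasurableSet (gridCell M k z) := by
  have : gridCell M k z = ⋂ j, {x : Pos d × M | ⌊(k : ℝ) * x.1 j⌋ = z j} := by
    ext; simp [gridCell]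
  rw [this]
  refine MeasurableSet.iInter fun j => ?_
  exact (Int.measurable_floor.comp (by fun_prop : Measurable fun x : Pos d × M => (k : ℝ) * x.1 j))
    (measurableSet_singleton (z j))

theorem smallSeparated_gridCell {ι : Type*} {d : ℕ} (M : Type*) {k : ℕ} (hk : 0 < k)
    {z : ι → Fin d → ℤ} (hz : Function.Injective z) :
    SmallSeparated fun i => gridCell M k (z i) := by
  refine ⟨fun i j hij x hx y hy he => hij (hz ?_), fun i x hx y hy => ?_⟩
  · ext l
    rw [← hx l, ← hy l, he]
  · rw [dist_pi_lt_iff one_pos]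
    intro l
    have h := Int.abs_sub_lt_one_of_floor_eq_floor ((hx l).trans (hy l).symm)
    rw [← mul_sub, abs_mul, Nat.abs_cast] at h
    have hk' : (1 : ℝ) ≤ k := by exact_mod_cast hk
    rw [Real.dist_eq]
    nlinarith [abs_nonneg (x.1 l - y.1 l)]

/-- Finitely many different locations fall into different cells once the mesh is fine enough. The
union is countable and its members are products, so equality of measures need only be checked on
rectangles with separated sides. -/
theorem distinctLoc_eq_iUnion (ι : Type*) [Finite ι] (d : ℕ) (M : Type*) :
    distinctLoc ι d M =
      ⋃ q : {q : ℕ × (ι → Fin d → ℤ) // 0 < q.1 ∧ Function.Injective q.2},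
        univ.pi fun i => gridCell M q.1.1 (q.1.2 i) := by
  ext x
  simp only [mem_iUnion, Set.mem_pi, mem_univ, true_imp_iff]
  constructor
  · intro hx
    have key : ∀ᶠ k : ℕ in atTop, ∀ i j : ι, i ≠ j →
        (fun l => ⌊(k : ℝ) * (x i).1 l⌋) ≠ fun l => ⌊(k : ℝ) * (x j).1 l⌋ := by
      rw [eventually_all]; intro i
      rw [eventually_all]; intro j
      by_cases hij : i = j
      · simp [hij]
      have hne : (x i).1 ≠ (x j).1 := fun h => hij (hx h)
      obtain ⟨l, hl⟩ := Function.ne_iff.1 hne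
      have hpos : 0 < |(x i).1 l - (x j).1 l| := abs_pos.2 (sub_ne_zero.2 hl)
      have ht : Tendsto (fun k : ℕ => (k : ℝ) * |(x i).1 l - (x j).1 l|) atTop atTop :=
        tendsto_natCast_atTop_atTop.atTop_mul_const hpos
      filter_upwards [ht.eventually_ge_atTop 1] with k hk _ he
      have h := Int.abs_sub_lt_one_of_floor_eq_floor (congrFun he l)
      rw [← mul_sub, abs_mul, Nat.abs_cast] at h
      linarith
    obtain ⟨k, hk, hk0⟩ := (key.and (eventually_gt_atTop 0)).exists
    refine ⟨⟨(k, fun i l => ⌊(k : ℝ) * (x i).1 l⌋), hk0, fun i j hij => ?_⟩, fun i l => rfl⟩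
    by_contra hne
    exact hk i j hne hij
  · rintro ⟨⟨⟨k, z⟩, hk, hz⟩, h⟩ i j hij
    by_contra hne
    exact (smallSeparated_gridCell M hk hz).loc_ne i j hne _ (h i) _ (h j) hij

/-! ### The law of the labelled points of a window -/

namespace RandomGraph

variable {Ω : Type*} {d : ℕ} {M : Type*} (G : RandomGraph Ω d M)

/-- The indices of the vertices in `B`. -/
def idx (B : Set (Pos d × M)) (ω : Ω) : Set ℕ := {i | i ∈ G.occ ω ∧ G.vertex i ω ∈ B}

theorem count_eq_encard (B : Set (Pos d × M)) (ω : Ω) : G.count B ω = (G.idx B ω).encard := rfl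

theorem idx_mono {B C : Set (Pos d × M)} (h : B ⊆ C) (ω : Ω) : G.idx B ω ⊆ G.idx C ω :=
  fun _ hi => ⟨hi.1, h hi.2⟩

/-- The marked points with the given indices. -/
def points {ι : Type*} (t : ι → ℕ) (ω : Ω) : ι → Pos d × M := fun k => G.vertex (t k) ω

/-- Measurability of the vertices and edges. -/
structure MeasurableVertices [MeasurableSpace Ω] [MeasurableSpace M] : Prop where
  occ : ∀ i, MeasurableSet {ω | i ∈ G.occ ω}
  vertex : ∀ i, Measurable (G.vertex i)

variable {G}

theorem measurable_points [MeasurableSpace Ω] [MeasurableSpace M] (hG : G.MeasurableVertices)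
    {ι : Type*} (t : ι → ℕ) : Measurable (G.points t) :=
  measurable_pi_lambda _ fun k => hG.vertex (t k)

theorem measurableSet_mem_idx [MeasurableSpace Ω] [MeasurableSpace M] (hG : G.MeasurableVertices)
    {B : Set (Pos d × M)} (hB : MeasurableSet B) (i : ℕ) : MeasurableSet {ω | i ∈ G.idx B ω} :=
  (hG.occ i).inter (hG.vertex i hB)

theorem measurableSet_idx_eq [MeasurableSpace Ω] [MeasurableSpace M] (hG : G.MeasurableVertices)
    {B : Set (Pos d × M)} (hB : MeasurableSet B) (s : Set ℕ) :
    MeasurableSet {ω | G.idx B ω = s} := by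
  have : {ω | G.idx B ω = s} = ⋂ i : ℕ, {ω | i ∈ G.idx B ω ↔ i ∈ s} := by
    ext ω; simp [Set.ext_iff]
  rw [this]
  refine MeasurableSet.iInter fun i => ?_
  by_cases hi : i ∈ s
  · simpa [hi] using measurableSet_mem_idx hG hB i
  · simp only [hi, iff_false]
    exact (measurableSet_mem_idx hG hB i).compl

/-- The location sets being disjoint, the label of the single vertex in each `B i` is forced, so an
enumeration of all vertices of `V` with the k-th in `B k` exists exactly when the counts are as
stated. -/
theorem iUnion_labelled_eq {ι : Type*} {V : Set (Pos d × M)} {B : ι → Set (Pos d × M)}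
    (hB : SmallSeparated B) (hBV : ∀ i, B i ⊆ V) :
    ⋃ t : ι ↪ ℕ, {ω | G.idx V ω = range t ∧ ∀ k, G.vertex (t k) ω ∈ B k} =
      {ω | G.count (V \ ⋃ i, B i) ω = 0 ∧ ∀ i, G.count (B i) ω = 1} := by
  ext ω
  simp only [mem_iUnion, mem_ofPred_eq, count_eq_encard, encard_eq_zero, encard_eq_one]
  constructor
  · rintro ⟨t, ht, hx⟩
    refine ⟨?_, fun i => ⟨t i, ?_⟩⟩
    · rw [eq_empty_iff_forall_notMem]
      rintro j ⟨hj, hjV, hjB⟩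
      have : j ∈ range t := ht ▸ ⟨hj, hjV⟩
      obtain ⟨k, rfl⟩ := this
      exact hjB (mem_iUnion.2 ⟨k, hx k⟩)
    · ext j
      constructor
      · rintro ⟨hj, hjB⟩
        have : j ∈ range t := ht ▸ ⟨hj, hBV i hjB⟩
        obtain ⟨k, rfl⟩ := this
        by_contra hne
        have hki : k ≠ i := fun h => hne (by simp [h])
        exact hB.loc_ne k i hki _ (hx k) _ hjB rfl
      · rintro rfl
        have : t i ∈ G.idx V ω := ht ▸ mem_range_self i
        exact ⟨this.1, hx i⟩
  · rintro ⟨h0, h1⟩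
    choose t ht using h1
    have htm : ∀ i, t i ∈ G.idx (B i) ω := fun i => by rw [ht i]; rfl
    refine ⟨⟨t, fun i j hij => ?_⟩, ?_, fun k => (htm k).2⟩
    · by_contra hne
      have h2 := htm j
      rw [← hij] at h2
      exact hB.loc_ne i j hne _ (htm i).2 _ h2.2 rfl
    · ext j
      constructor
      · intro hj
        by_cases hjB : ∃ i, G.vertex j ω ∈ B i
        · obtain ⟨i, hi⟩ := hjB
          have : j ∈ G.idx (B i) ω := ⟨hj.1, hi⟩
          rw [ht i] at this
          exact ⟨i, this.symm⟩
        · exfalso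
          have : j ∈ G.idx (V \ ⋃ i, B i) ω := ⟨hj.1, hj.2, by simpa using hjB⟩
          rw [h0] at this
          exact this
      · rintro ⟨i, rfl⟩
        exact G.idx_mono (hBV i) ω (htm i)

/-- At most one labelling works for each ω, because a vertex cannot lie in two of the separated
sets. The union over labellings is therefore disjoint. -/
theorem tsum_labelled [MeasurableSpace Ω] [MeasurableSpace M] (hG : G.MeasurableVertices)
    (P : Measure Ω) {ι : Type*} [Finite ι] {V : Set (Pos d × M)} (hV : MeasurableSet V)
    {B : ι → Set (Pos d × M)} (hBm : ∀ i, MeasurableSet (B i)) (hB : SmallSeparated B)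
    (hBV : ∀ i, B i ⊆ V) :
    ∑' t : ι ↪ ℕ, P {ω | G.idx V ω = range t ∧ ∀ k, G.vertex (t k) ω ∈ B k} =
      P {ω | G.count (V \ ⋃ i, B i) ω = 0 ∧ ∀ i, G.count (B i) ω = 1} := by
  have := countable_embedding_nat ι
  have hc := Finite.to_countable (α := ι)
  rw [← iUnion_labelled_eq hB hBV, measure_iUnion]
  · intro t t' htt'
    refine disjoint_left.2 ?_
    rintro ω ⟨h1, h2⟩ ⟨h3, h4⟩
    apply htt'
    ext i
    have : t i ∈ range t' := h3 ▸ h1 ▸ mem_range_self i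
    obtain ⟨j, hj⟩ := this
    by_cases hij : i = j
    · rw [← hj, hij]
    · have := h2 i
      rw [← hj] at this
      exact absurd rfl (hB.loc_ne i j hij _ this _ (h4 j))
  · intro t
    refine (measurableSet_idx_eq hG hV _).inter ?_
    have : {ω | ∀ k, G.vertex (t k) ω ∈ B k} = ⋂ k, G.vertex (t k) ⁻¹' B k := by ext; simp
    change MeasurableSet {ω | ∀ k, G.vertex (t k) ω ∈ B k}
    rw [this]
    exact MeasurableSet.iInter fun k => hG.vertex _ (hBm k)

/-- The law of the labelled points of a window is determined by the probabilities that there is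
exactly one point in each of finitely many small separated sets, and no further point. -/
theorem lintegral_labelled [MeasurableSpace Ω] [MeasurableSpace M] (hG : G.MeasurableVertices)
    (P : Measure Ω)
    (hsimple : ∀ᵐ ω ∂P, ∀ i ∈ G.occ ω, ∀ j ∈ G.occ ω, G.loc i ω = G.loc j ω → i = j)
    {V : Set (Pos d × M)} (hV : MeasurableSet V) (m : Measure (Pos d × M)) [IsFiniteMeasure m]
    (hmV : m Vᶜ = 0) {ι : Type*} [Fintype ι] {a : ℝ≥0∞} (ha : a ≠ ∞)
    (h : ∀ B : ι → Set (Pos d × M), (∀ i, MeasurableSet (B i)) → SmallSeparated B →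
      (∀ i, B i ⊆ V) →
      P {ω | G.count (V \ ⋃ i, B i) ω = 0 ∧ ∀ i, G.count (B i) ω = 1} = a * ∏ i, m (B i))
    {f : (ι → Pos d × M) → ℝ≥0∞} (hf : Measurable f) :
    ∑' t : ι ↪ ℕ, ∫⁻ ω in {ω | G.idx V ω = range t}, f (G.points t ω) ∂P =
      a * ∫⁻ x in distinctLoc ι d M, f x ∂(Measure.pi fun _ => m) := by
  classical
  have := countable_embedding_nat ι
  -- All injective labellings are summed, so `μ₁` counts every ordering of the points of the window,
  -- on the event that there are as many points as elements of `ι`.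
  set μ₁ : Measure (ι → Pos d × M) := Measure.sum fun t : ι ↪ ℕ =>
    (P.restrict {ω | G.idx V ω = range t}).map (G.points t) with hμ₁
  set μ₂ : Measure (ι → Pos d × M) :=
    a • (Measure.pi fun _ => m).restrict (distinctLoc ι d M) with hμ₂
  have hoff := measurableSet_distinctLoc ι d M
  -- By simplicity of the vertex set both measures live on tuples of different locations, where the
  -- countable cover by products of cells is available.
  have hoff₁ : μ₁.restrict (distinctLoc ι d M) = μ₁ := by
    refine Measure.restrict_eq_self_of_ae_mem ?_
    rw [hμ₁, Measure.ae_sum_iff]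
    intro t
    refine (ae_map_iff (measurable_points hG t).aemeasurable hoff).2 ?_
    rw [ae_restrict_iff' (measurableSet_idx_eq hG hV _)]
    filter_upwards [hsimple] with ω hω ht i j hij
    have hmem : ∀ i, t i ∈ G.occ ω := fun i => (show t i ∈ G.idx V ω from ht ▸ mem_range_self i).1
    exact t.injective (hω _ (hmem i) _ (hmem j) hij)
  have hoff₂ : μ₂.restrict (distinctLoc ι d M) = μ₂ := by
    rw [hμ₂, Measure.restrict_smul, Measure.restrict_restrict hoff, inter_self]
  have hrect : ∀ (C s : ι → Set (Pos d × M)), (∀ i, MeasurableSet (C i)) → SmallSeparated C →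
      (∀ i, MeasurableSet (s i)) →
      μ₁ (univ.pi s ∩ univ.pi C) = μ₂ (univ.pi s ∩ univ.pi C) := by
    intro C s hC hCs hs
    set B : ι → Set (Pos d × M) := fun i => s i ∩ C i ∩ V with hBdef
    have hBm : ∀ i, MeasurableSet (B i) := fun i => ((hs i).inter (hC i)).inter hV
    have hBs : SmallSeparated B := hCs.mono fun i x hx => hx.1.2
    have hBV : ∀ i, B i ⊆ V := fun i x hx => hx.2
    have hsC : MeasurableSet (univ.pi s ∩ univ.pi C) :=
      (MeasurableSet.univ_pi hs).inter (MeasurableSet.univ_pi hC)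
    have e1 : μ₁ (univ.pi s ∩ univ.pi C) = a * ∏ i, m (B i) := by
      rw [← h B hBm hBs hBV, ← tsum_labelled hG P hV hBm hBs hBV, hμ₁, Measure.sum_apply _ hsC]
      congr 1 with t
      rw [Measure.map_apply (measurable_points hG t) hsC,
        Measure.restrict_apply (measurable_points hG t hsC)]
      congr 1 with ω
      simp only [mem_inter_iff, mem_preimage, Set.mem_pi, mem_univ, true_imp_iff, mem_ofPred_eq,
        RandomGraph.points, hBdef]
      constructor
      · rintro ⟨⟨h1, h2⟩, h3⟩
        exact ⟨h3, fun k => ⟨⟨h1 k, h2 k⟩,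
          (show t k ∈ G.idx V ω from h3 ▸ mem_range_self k).2⟩⟩
      · rintro ⟨h3, h1⟩
        exact ⟨⟨fun k => (h1 k).1.1, fun k => (h1 k).1.2⟩, h3⟩
    rw [e1, hμ₂, Measure.smul_apply, Measure.restrict_apply hsC, smul_eq_mul]
    congr 1
    have hsub : univ.pi s ∩ univ.pi C ∩ distinctLoc ι d M = univ.pi fun i => s i ∩ C i := by
      ext x
      simp only [mem_inter_iff, Set.mem_pi, mem_univ, true_imp_iff]
      constructor
      · rintro ⟨⟨h1, h2⟩, -⟩ i
        exact ⟨h1 i, h2 i⟩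
      · intro h1
        refine ⟨⟨fun i => (h1 i).1, fun i => (h1 i).2⟩, fun i j hij => ?_⟩
        by_contra hne
        exact hCs.loc_ne i j hne _ (h1 i).2 _ (h1 j).2 hij
    rw [hsub, Measure.pi_pi]
    refine Finset.prod_congr rfl fun i _ => ?_
    exact measure_inter_conull hmV
  have key : μ₁ = μ₂ := by
    rw [← hoff₁, ← hoff₂, distinctLoc_eq_iUnion, Measure.restrict_iUnion_congr]
    rintro ⟨⟨k, z⟩, hk, hz⟩
    have hsep := smallSeparated_gridCell M hk hz
    have hms : ∀ i, MeasurableSet (gridCell M k (z i)) := fun i => measurableSet_gridCell M k (z i)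
    have hR : MeasurableSet (univ.pi fun i => gridCell M k (z i)) := MeasurableSet.univ_pi hms
    have huniv : μ₁ (univ.pi fun i => gridCell M k (z i)) =
        μ₂ (univ.pi fun i => gridCell M k (z i)) := by
      simpa using hrect _ (fun _ => univ) hms hsep fun _ => MeasurableSet.univ
    have hfin : μ₂ univ < ∞ := by
      rw [hμ₂, Measure.smul_apply, smul_eq_mul]
      exact ENNReal.mul_lt_top ha.lt_top (measure_lt_top _ _)
    -- Uniqueness on a π-system needs finiteness. For `μ₁` it is read off from the agreement with
    -- the finite measure `μ₂` on the whole product of cells.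
    have : IsFiniteMeasure (μ₁.restrict (univ.pi fun i => gridCell M k (z i))) := by
      refine ⟨?_⟩
      rw [Measure.restrict_apply_univ, huniv]
      exact (measure_mono (subset_univ _)).trans_lt hfin
    refine ext_of_generate_finite _ generateFrom_pi.symm isPiSystem_pi ?_ ?_
    · rintro _ ⟨s, hs, rfl⟩
      have hs' : ∀ i, MeasurableSet (s i) := fun i => hs i (mem_univ i)
      rw [Measure.restrict_apply (MeasurableSet.univ_pi hs'),
        Measure.restrict_apply (MeasurableSet.univ_pi hs')]
      exact hrect _ s hms hsep hs'
    · rw [Measure.restrict_apply_univ, Measure.restrict_apply_univ, huniv]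
  have e : ∫⁻ x, f x ∂μ₁ = ∫⁻ x, f x ∂μ₂ := by rw [key]
  rw [hμ₁, lintegral_sum_measure, hμ₂, lintegral_smul_measure] at e
  rw [← smul_eq_mul, ← e]
  congr 1 with t
  rw [lintegral_map hf (measurable_points hG t)]

end RandomGraph

/-! ### Edges given the vertices -/

namespace RandomGraph

variable {Ω : Type*} {d : ℕ} {M : Type*} {G : RandomGraph Ω d M}

open Classical in
/-- The conditional probability of the edge between two indices, given the vertices. -/
def edgeProb (G : RandomGraph Ω d M) (p : Pos d × M → Pos d × M → ℝ) (i j : ℕ) (ω : Ω) : ℝ :=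
  if i ∈ G.occ ω ∧ j ∈ G.occ ω then p (G.vertex i ω) (G.vertex j ω) else 0

variable {p : Pos d × M → Pos d × M → ℝ}

theorem edgeProb_comm (hp : ∀ x y, p x y = p y x) (i j : ℕ) (ω : Ω) :
    G.edgeProb p i j ω = G.edgeProb p j i ω := by
  unfold edgeProb
  rw [hp (G.vertex i ω)]
  by_cases hi : i ∈ G.occ ω <;> by_cases hj : j ∈ G.occ ω <;> simp [hi, hj]

theorem edgeProb_mem (hp : ∀ x y, p x y ∈ Icc (0 : ℝ) 1) (i j : ℕ) (ω : Ω) :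
    G.edgeProb p i j ω ∈ Icc (0 : ℝ) 1 := by
  unfold edgeProb
  split_ifs
  · exact hp _ _
  · simp

theorem measurable_edgeProb [MeasurableSpace Ω] [MeasurableSpace M] (hG : G.MeasurableVertices)
    (hp : Measurable (Function.uncurry p)) (i j : ℕ) : Measurable (G.edgeProb p i j) := by
  unfold edgeProb
  refine Measurable.ite ((hG.occ i).inter (hG.occ j)) ?_ measurable_const
  exact hp.comp ((hG.vertex i).prodMk (hG.vertex j))

theorem vertexSigma_le [m : MeasurableSpace Ω] [MeasurableSpace M] (hG : G.MeasurableVertices) :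
    G.vertexSigma ≤ m := by
  refine iSup_le fun i => sup_le ?_ ?_
  · exact (hG.vertex i).comap_le
  · refine MeasurableSpace.generateFrom_le ?_
    rintro _ rfl
    exact hG.occ i

end RandomGraph

namespace IndependentSetting

variable {kind : VertexKind} {Ω : Type*} [mΩ : MeasurableSpace Ω] {d : ℕ}
    {M : Type*} [MeasurableSpace M] {l : ℝ} {ν : Measure M} {p : Pos d × M → Pos d × M → ℝ}
    {P : Measure Ω} {G : RandomGraph Ω d M}

theorem measurableVertices (h : IndependentSetting kind l ν p P G) : G.MeasurableVertices :=
  ⟨h.measurable_occ, h.measurable_vertex⟩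

/-- The integrated form of the conditional edge law, freed from the ordering of indices: any family
of different unordered pairs may be used. -/
theorem measureReal_forall_adj (h : IndependentSetting kind l ν p P G)
    (hp : IsConnectionFunction kind p) {A : Set Ω} (hA : MeasurableSet[G.vertexSigma] A)
    {κ : Type*} (S : Finset κ) (u v : κ → ℕ) (hne : ∀ k ∈ S, u k ≠ v k)
    (hinj : ∀ k ∈ S, ∀ k' ∈ S, s(u k, v k) = s(u k', v k') → k = k') :
    P.real (A ∩ {ω | ∀ k ∈ S, (G.graph ω).Adj (u k) (v k)}) =
      ∫ ω in A, ∏ k ∈ S, G.edgeProb p (u k) (v k) ω ∂P := by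
  classical
  have := h.prob
  have hm := vertexSigma_le h.measurableVertices
  -- The conditional law is stated for pairs with the smaller index first, so each pair is sorted.
  -- Symmetry of p undoes the sorting at the end.
  set e : κ → ℕ × ℕ := fun k => (min (u k) (v k), max (u k) (v k)) with he
  have heinj : ∀ k ∈ S, ∀ k' ∈ S, e k = e k' → k = k' := by
    intro k hk k' hk' hkk
    refine hinj k hk k' hk' ?_
    have h1 : min (u k) (v k) = min (u k') (v k') := congrArg Prod.fst hkk
    have h2 : max (u k) (v k) = max (u k') (v k') := congrArg Prod.snd hkk
    rw [Sym2.eq_iff]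
    omega
  have hlt : ∀ f ∈ S.image e, f.1 < f.2 := by
    intro f hf
    obtain ⟨k, hk, rfl⟩ := Finset.mem_image.1 hf
    have := hne k hk
    simp only [he]
    omega
  have hset : (⋂ f ∈ S.image e, {ω | (G.graph ω).Adj f.1 f.2}) =
      {ω | ∀ k ∈ S, (G.graph ω).Adj (u k) (v k)} := by
    ext ω
    simp only [mem_iInter, Finset.mem_image, forall_exists_index, and_imp,
      forall_apply_eq_imp_iff₂, mem_ofPred_eq, he]
    refine forall₂_congr fun k _ => ?_
    rcases le_total (u k) (v k) with hle | hle
    · simp [hle]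
    · simp [hle, SimpleGraph.adj_comm]
  have hSm : MeasurableSet {ω | ∀ k ∈ S, (G.graph ω).Adj (u k) (v k)} := by
    rw [← hset]
    exact Finset.measurableSet_biInter _ fun f _ => h.measurable_adj _ _
  have hce := h.edge_law (S.image e) hlt
  rw [hset] at hce
  have hint : Integrable
      ({ω | ∀ k ∈ S, (G.graph ω).Adj (u k) (v k)}.indicator fun _ => (1 : ℝ)) P :=
    (integrable_const 1).indicator hSm
  have h1 := setIntegral_condExp hm hint hA
  have h2 : ∫ ω in A, ({ω | ∀ k ∈ S, (G.graph ω).Adj (u k) (v k)}.indicator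
      fun _ => (1 : ℝ)) ω ∂P = P.real (A ∩ {ω | ∀ k ∈ S, (G.graph ω).Adj (u k) (v k)}) := by
    rw [integral_indicator_const _ hSm, measureReal_restrict_apply hSm, smul_eq_mul, mul_one,
      inter_comm]
  rw [← h2, ← h1]
  refine integral_congr_ae (ae_restrict_of_ae ?_)
  filter_upwards [hce] with ω hω
  rw [hω, Finset.prod_image heinj]
  refine Finset.prod_congr rfl fun k _ => ?_
  change G.edgeProb p (min (u k) (v k)) (max (u k) (v k)) ω = _
  rcases le_total (u k) (v k) with hle | hle
  · simp [hle]
  · simp [hle, edgeProb_comm hp.symm (v k)]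

theorem integrable_prod_edgeProb (h : IndependentSetting kind l ν p P G)
    (hp : IsConnectionFunction kind p) {κ : Type*} (S T : Finset κ) (u v : κ → ℕ) (A : Set Ω) :
    Integrable (fun ω => (∏ k ∈ S, G.edgeProb p (u k) (v k) ω) *
      ∏ k ∈ T, (1 - G.edgeProb p (u k) (v k) ω)) (P.restrict A) := by
  have := h.prob
  have hmeas := fun i j => measurable_edgeProb h.measurableVertices hp.measurable (p := p) i j
  have hmem := fun i j ω => edgeProb_mem (G := G) hp.mem_unit i j ω
  refine Integrable.of_bound (C := 1) ?_ (ae_of_all _ fun ω => ?_)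
  · exact ((Finset.measurable_prod _ fun k _ => hmeas _ _).mul
      (Finset.measurable_prod _ fun k _ => (hmeas _ _).const_sub 1)).aestronglyMeasurable
  · rw [Real.norm_of_nonneg]
    · refine mul_le_one₀ (Finset.prod_le_one (fun k _ => (hmem _ _ _).1) fun k _ => (hmem _ _ _).2)
        (Finset.prod_nonneg fun k _ => sub_nonneg.2 (hmem _ _ _).2)
        (Finset.prod_le_one (fun k _ => sub_nonneg.2 (hmem _ _ _).2) fun k _ => ?_)
      linarith [(hmem (u k) (v k) ω).1]
    · exact mul_nonneg (Finset.prod_nonneg fun k _ => (hmem _ _ _).1)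
        (Finset.prod_nonneg fun k _ => sub_nonneg.2 (hmem _ _ _).2)

/-- Absent edges are added one at a time: the probability without an edge is the difference of the
probabilities with that edge unconstrained and with it present, and the integrand splits in the same
way. -/
theorem measureReal_adj_not_adj (h : IndependentSetting kind l ν p P G)
    (hp : IsConnectionFunction kind p) {A : Set Ω} (hA : MeasurableSet[G.vertexSigma] A)
    {κ : Type*} [DecidableEq κ] (T S : Finset κ) (u v : κ → ℕ) (hST : Disjoint S T)
    (hne : ∀ k ∈ S ∪ T, u k ≠ v k)
    (hinj : ∀ k ∈ S ∪ T, ∀ k' ∈ S ∪ T, s(u k, v k) = s(u k', v k') → k = k') :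
    P.real (A ∩ {ω | (∀ k ∈ S, (G.graph ω).Adj (u k) (v k)) ∧
        ∀ k ∈ T, ¬ (G.graph ω).Adj (u k) (v k)}) =
      ∫ ω in A, (∏ k ∈ S, G.edgeProb p (u k) (v k) ω) *
        ∏ k ∈ T, (1 - G.edgeProb p (u k) (v k) ω) ∂P := by
  have := h.prob
  induction T using Finset.induction generalizing S with
  | empty =>
    simpa using measureReal_forall_adj h hp hA S u v (by simpa using hne) (by simpa using hinj)
  | insert a T haT ih =>
    have hunion : S ∪ insert a T = insert a S ∪ T := by
      rw [Finset.union_insert, Finset.insert_union]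
    have haS : a ∉ S := fun ha => Finset.disjoint_left.1 hST ha (Finset.mem_insert_self a T)
    have hsub : S ∪ T ⊆ S ∪ insert a T :=
      Finset.union_subset_union_right (Finset.subset_insert a T)
    have i1 := ih S (hST.mono_right (Finset.subset_insert a T)) (fun k hk => hne k (hsub hk))
      fun k hk k' hk' => hinj k (hsub hk) k' (hsub hk')
    have i2 := ih (insert a S) (by
        rw [Finset.disjoint_insert_left]
        exact ⟨haT, hST.mono_right (Finset.subset_insert a T)⟩)
      (hunion ▸ hne) (hunion ▸ hinj)
    have hset : A ∩ {ω | (∀ k ∈ S, (G.graph ω).Adj (u k) (v k)) ∧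
          ∀ k ∈ insert a T, ¬ (G.graph ω).Adj (u k) (v k)} =
        (A ∩ {ω | (∀ k ∈ S, (G.graph ω).Adj (u k) (v k)) ∧
          ∀ k ∈ T, ¬ (G.graph ω).Adj (u k) (v k)}) \ {ω | (G.graph ω).Adj (u a) (v a)} := by
      ext ω
      simp only [mem_inter_iff, mem_ofPred_eq, Finset.forall_mem_insert, Set.mem_sdiff]
      tauto
    have hset' : A ∩ {ω | (∀ k ∈ insert a S, (G.graph ω).Adj (u k) (v k)) ∧
          ∀ k ∈ T, ¬ (G.graph ω).Adj (u k) (v k)} =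
        (A ∩ {ω | (∀ k ∈ S, (G.graph ω).Adj (u k) (v k)) ∧
          ∀ k ∈ T, ¬ (G.graph ω).Adj (u k) (v k)}) ∩ {ω | (G.graph ω).Adj (u a) (v a)} := by
      ext ω
      simp only [mem_inter_iff, mem_ofPred_eq, Finset.forall_mem_insert]
      tauto
    rw [hset'] at i2
    rw [hset]
    have hadd := measureReal_inter_add_sdiff (μ := P) (s := A ∩ {ω | (∀ k ∈ S, (G.graph ω).Adj (u k) (v k)) ∧
          ∀ k ∈ T, ¬ (G.graph ω).Adj (u k) (v k)}) (h.measurable_adj (u a) (v a))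
    rw [eq_sub_of_add_eq' hadd, i1, i2, ← integral_sub (integrable_prod_edgeProb h hp _ _ _ _ _)
      (integrable_prod_edgeProb h hp _ _ _ _ _)]
    refine integral_congr_ae (ae_of_all _ fun ω => ?_)
    simp only [Finset.prod_insert haS, Finset.prod_insert haT]
    ring

/-- Given the vertices, the edges are independent. -/
theorem measure_adj_iff (h : IndependentSetting kind l ν p P G)
    (hp : IsConnectionFunction kind p) {A : Set Ω} (hA : MeasurableSet[G.vertexSigma] A)
    {κ : Type*} [DecidableEq κ] {T S : Finset κ} (hTS : T ⊆ S) (u v : κ → ℕ)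
    (hne : ∀ k ∈ S, u k ≠ v k)
    (hinj : ∀ k ∈ S, ∀ k' ∈ S, s(u k, v k) = s(u k', v k') → k = k') :
    P (A ∩ {ω | ∀ k ∈ S, (G.graph ω).Adj (u k) (v k) ↔ k ∈ T}) =
      ∫⁻ ω in A, ENNReal.ofReal (∏ k ∈ S, if k ∈ T then G.edgeProb p (u k) (v k) ω
        else 1 - G.edgeProb p (u k) (v k) ω) ∂P := by
  have := h.prob
  have hmem := fun i j ω => edgeProb_mem (G := G) hp.mem_unit i j ω
  have hu : T ∪ S \ T = S := Finset.union_sdiff_of_subset hTS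
  have key := measureReal_adj_not_adj h hp hA (S \ T) T u v Finset.disjoint_sdiff
    (by rwa [hu]) (by rwa [hu])
  have hprod : ∀ ω, (∏ k ∈ S, if k ∈ T then G.edgeProb p (u k) (v k) ω
        else 1 - G.edgeProb p (u k) (v k) ω) = (∏ k ∈ T, G.edgeProb p (u k) (v k) ω) *
        ∏ k ∈ S \ T, (1 - G.edgeProb p (u k) (v k) ω) := by
    intro ω
    rw [← Finset.prod_sdiff hTS, mul_comm]
    congr 1
    · exact Finset.prod_congr rfl fun k hk => if_pos hk
    · exact Finset.prod_congr rfl fun k hk => if_neg (Finset.mem_sdiff.1 hk).2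
  have hset : {ω | ∀ k ∈ S, (G.graph ω).Adj (u k) (v k) ↔ k ∈ T} =
      {ω | (∀ k ∈ T, (G.graph ω).Adj (u k) (v k)) ∧
        ∀ k ∈ S \ T, ¬ (G.graph ω).Adj (u k) (v k)} := by
    ext ω
    simp only [mem_ofPred_eq, Finset.mem_sdiff]
    constructor
    · exact fun H => ⟨fun k hk => (H k (hTS hk)).2 hk, fun k hk hk' => hk.2 ((H k hk.1).1 hk')⟩
    · exact fun H k hk => ⟨fun hk' => by_contra fun hT => H.2 k ⟨hk, hT⟩ hk', fun hT => H.1 k hT⟩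
  simp only [hprod]
  rw [hset, ← ofReal_integral_eq_lintegral_ofReal (integrable_prod_edgeProb h hp _ _ _ _ _)
    (ae_of_all _ fun ω => ?_), ← key, ofReal_measureReal]
  exact mul_nonneg (Finset.prod_nonneg fun k _ => (hmem _ _ _).1)
    (Finset.prod_nonneg fun k _ => sub_nonneg.2 (hmem _ _ _).2)

end IndependentSetting

/-! ### Mean measures and configuration weights -/

/-- The mean measure of the vertex locations at intensity one. -/
def VertexKind.locMeasure (d : ℕ) : VertexKind → Measure (Pos d)
  | .poisson => volume
  | .bernoulli => Measure.sum fun z : Fin d → ℤ => Measure.dirac (latticePoint z)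

/-- The mass of the atoms of the mean measure. -/
def VertexKind.atomMass : VertexKind → ℝ≥0∞
  | .poisson => 0
  | .bernoulli => 1

/-- The marked points with location in `W`. -/
def window {d : ℕ} (M : Type*) (W : Set (Pos d)) : Set (Pos d × M) := Prod.fst ⁻¹' W

/-- The mean measure of the marked points in a window at intensity one. -/
def windowMeasure (kind : VertexKind) {d : ℕ} {M : Type*} [MeasurableSpace M] (ν : Measure M)
    (W : Set (Pos d)) : Measure (Pos d × M) :=
  ((kind.locMeasure d).restrict W).prod ν

/-- The factor in the density of the labelled configurations of `n` points in a window of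
mass `v`. -/
def janossyWeight (kind : VertexKind) (l : ℝ) (v : ℝ≥0∞) (n : ℕ) : ℝ≥0∞ :=
  match kind with
  | .poisson => ENNReal.ofReal (Real.exp (-(l * v.toReal)) * l ^ n)
  | .bernoulli => ENNReal.ofReal (l ^ n * (1 - l) ^ (⌊v.toReal⌋₊ - n))

theorem janossyWeight_ne_top (kind : VertexKind) (l : ℝ) (v : ℝ≥0∞) (n : ℕ) :
    janossyWeight kind l v n ≠ ∞ := by
  cases kind <;> exact ENNReal.ofReal_ne_top

theorem latticePoint_injective {d : ℕ} : Function.Injective (latticePoint (d := d)) :=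
  fun _ _ h => funext fun k => Int.cast_injective (α := ℝ) (congrFun h k)

theorem eq_of_dist_latticePoint_lt_one {d : ℕ} {z w : Fin d → ℤ}
    (h : dist (latticePoint z) (latticePoint w) < 1) : z = w := by
  rw [dist_pi_lt_iff one_pos] at h
  ext k
  have hk := h k
  rw [Real.dist_eq] at hk
  simp only [latticePoint] at hk
  have h2 : |z k - w k| < 1 := by exact_mod_cast hk
  rw [Int.abs_lt_one_iff] at h2
  omega

theorem finite_latticePoint_mem {d : ℕ} {W : Set (Pos d)} (hW : Bornology.IsBounded W) :
    {z : Fin d → ℤ | latticePoint z ∈ W}.Finite := by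
  obtain ⟨C, hC⟩ := hW.exists_norm_le
  have hsub : {z : Fin d → ℤ | latticePoint z ∈ W} ⊆
      univ.pi fun _ => Icc (-⌈C⌉) ⌈C⌉ := by
    intro z hz k _
    have h1 := (norm_le_pi_norm (latticePoint z) k).trans (hC _ hz)
    simp only [latticePoint, Real.norm_eq_abs] at h1
    have h2 := abs_le.1 (h1.trans (Int.le_ceil C))
    exact ⟨by exact_mod_cast h2.1, by exact_mod_cast h2.2⟩
  exact (Finite.pi' fun _ => finite_Icc _ _).subset fun z hz k => hsub hz k (mem_univ k)

theorem measurableSet_window {d : ℕ} (M : Type*) [MeasurableSpace M] {W : Set (Pos d)}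
    (hW : MeasurableSet W) : MeasurableSet (window M W) := measurable_fst hW

theorem setLIntegral_locMeasure_bernoulli {d : ℕ} {W : Set (Pos d)} (hW : MeasurableSet W)
    (g : Pos d → ℝ≥0∞) :
    ∫⁻ x in W, g x ∂(VertexKind.bernoulli.locMeasure d) =
      ∑' z : Fin d → ℤ, W.indicator g (latticePoint z) := by
  rw [← lintegral_indicator hW, VertexKind.locMeasure, lintegral_sum_measure]
  simp_rw [lintegral_dirac]

theorem locMeasure_bernoulli_apply {d : ℕ} {W : Set (Pos d)} (hW : MeasurableSet W)
    (hb : Bornology.IsBounded W) :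
    VertexKind.bernoulli.locMeasure d W = ((finite_latticePoint_mem hb).toFinset.card : ℝ≥0∞) := by
  have h := setLIntegral_locMeasure_bernoulli hW fun _ => 1
  rw [setLIntegral_one] at h
  rw [h, tsum_eq_sum (s := (finite_latticePoint_mem hb).toFinset)]
  · rw [Finset.sum_congr rfl fun z hz => indicator_of_mem (by simpa using hz) _]
    simp
  · intro z hz
    exact indicator_of_notMem (by simpa using hz) _

theorem locMeasure_lt_top (kind : VertexKind) {d : ℕ} {W : Set (Pos d)} (hW : MeasurableSet W)
    (hb : Bornology.IsBounded W) : kind.locMeasure d W < ∞ := by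
  cases kind with
  | poisson => exact hb.measure_lt_top (μ := volume)
  | bernoulli =>
    rw [locMeasure_bernoulli_apply hW hb]
    exact ENNReal.natCast_lt_top _

theorem windowMeasure_univ (kind : VertexKind) {d : ℕ} {M : Type*} [MeasurableSpace M]
    (ν : Measure M) [IsProbabilityMeasure ν] (W : Set (Pos d)) :
    windowMeasure kind ν W univ = kind.locMeasure d W := by
  rw [windowMeasure, ← univ_prod_univ, Measure.prod_prod, measure_univ (μ := ν),
    mul_one, Measure.restrict_apply_univ]

theorem windowMeasure_compl (kind : VertexKind) {d : ℕ} {M : Type*} [MeasurableSpace M]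
    (ν : Measure M) [IsProbabilityMeasure ν] {W : Set (Pos d)} (hW : MeasurableSet W) :
    windowMeasure kind ν W (window M W)ᶜ = 0 := by
  have : (window M W)ᶜ = Wᶜ ×ˢ (univ : Set M) := by ext; simp [window]
  rw [windowMeasure, this, Measure.prod_prod, Measure.restrict_apply hW.compl]
  simp

theorem isFiniteMeasure_windowMeasure (kind : VertexKind) {d : ℕ} {M : Type*} [MeasurableSpace M]
    (ν : Measure M) [IsProbabilityMeasure ν] {W : Set (Pos d)} (hW : MeasurableSet W)
    (hb : Bornology.IsBounded W) : IsFiniteMeasure (windowMeasure kind ν W) :=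
  ⟨by rw [windowMeasure_univ]; exact locMeasure_lt_top kind hW hb⟩

namespace RandomGraph

variable {Ω : Type*} [MeasurableSpace Ω] {d : ℕ} {M : Type*} [MeasurableSpace M]
  {G : RandomGraph Ω d M}

theorem measurableSet_count_zero (hG : G.MeasurableVertices) {B : Set (Pos d × M)}
    (hB : MeasurableSet B) : MeasurableSet {ω | G.count B ω = 0} := by
  simp only [count_eq_encard, encard_eq_zero]
  exact measurableSet_idx_eq hG hB ∅

theorem measurableSet_count_one (hG : G.MeasurableVertices) {B : Set (Pos d × M)}
    (hB : MeasurableSet B) : MeasurableSet {ω | G.count B ω = 1} := by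
  simp only [count_eq_encard, encard_eq_one, ofPred_exists]
  exact MeasurableSet.iUnion fun i => measurableSet_idx_eq hG hB {i}

end RandomGraph

/-! ### Poisson vertices: exact occupation probabilities -/

section Poisson

variable {Ω : Type*} [MeasurableSpace Ω] {d : ℕ} {M : Type*} [MeasurableSpace M]
  {G : RandomGraph Ω d M} {l : ℝ} {ν : Measure M} [IsProbabilityMeasure ν] {P : Measure Ω}

theorem intensity_eq_windowMeasure {W : Set (Pos d)} {B : Set (Pos d × M)}
    (hBW : B ⊆ window M W) (hB : MeasurableSet B) :
    (ENNReal.ofReal l • (volume : Measure (Pos d)).prod ν) B =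
      ENNReal.ofReal l * windowMeasure .poisson ν W B := by
  have h := Measure.prod_restrict (μ := (volume : Measure (Pos d))) (ν := ν) W univ
  rw [Measure.restrict_univ, prod_univ] at h
  rw [Measure.smul_apply, smul_eq_mul, windowMeasure, VertexKind.locMeasure, h,
    Measure.restrict_apply hB]
  congr 2
  exact (inter_eq_left.2 hBW).symm

theorem IsMarkedPoisson.measure_count (h : IsMarkedPoisson l ν P G) (hl : 0 < l) {W : Set (Pos d)}
    (hW : MeasurableSet W) (hb : Bornology.IsBounded W) {B : Set (Pos d × M)}
    (hBW : B ⊆ window M W) (hB : MeasurableSet B) (k : ℕ) :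
    P {ω | G.count B ω = k} = ENNReal.ofReal
      (Real.exp (-(l * (windowMeasure .poisson ν W).real B)) *
        (l * (windowMeasure .poisson ν W).real B) ^ k / k.factorial) := by
  have := isFiniteMeasure_windowMeasure .poisson ν hW hb
  have he := intensity_eq_windowMeasure (l := l) (ν := ν) hBW hB
  have hfin : ENNReal.ofReal l * windowMeasure .poisson ν W B ≠ ∞ :=
    ENNReal.mul_ne_top ENNReal.ofReal_ne_top (measure_ne_top _ _)
  rw [h.count_law B hB (he ▸ hfin) k, poissonMeasure_singleton, he]
  have : ((ENNReal.ofReal l * windowMeasure .poisson ν W B).toNNReal : ℝ) =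
      l * (windowMeasure .poisson ν W).real B := by
    rw [ENNReal.coe_toNNReal_eq_toReal, ENNReal.toReal_mul, ENNReal.toReal_ofReal hl.le,
      measureReal_def]
  rw [this]

/-- The sets and the rest of the window are disjoint, so the counts are independent. One-point
probabilities give l · m(B) times an exponential, and additivity of the mass merges the exponentials
into the one of the whole window. -/
theorem IsMarkedPoisson.atom_law (h : IsMarkedPoisson l ν P G) (hl : 0 < l) {W : Set (Pos d)}
    (hW : MeasurableSet W) (hb : Bornology.IsBounded W) {ι : Type*} [Fintype ι]
    {B : ι → Set (Pos d × M)} (hBm : ∀ i, MeasurableSet (B i)) (hB : SmallSeparated B)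
    (hBW : ∀ i, B i ⊆ window M W) :
    P {ω | G.count (window M W \ ⋃ i, B i) ω = 0 ∧ ∀ i, G.count (B i) ω = 1} =
      janossyWeight .poisson l (VertexKind.poisson.locMeasure d W) (Fintype.card ι) *
        ∏ i, windowMeasure .poisson ν W (B i) := by
  classical
  have hfin := isFiniteMeasure_windowMeasure .poisson ν hW hb
  set m := windowMeasure .poisson ν W with hm
  have hc := Finite.to_countable (α := ι)
  have hUm : MeasurableSet (⋃ i, B i) := MeasurableSet.iUnion hBm
  have hVm : MeasurableSet (window M W \ ⋃ i, B i) := (measurableSet_window M hW).diff hUm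
  have hdisj : Pairwise fun i j => Disjoint (B i) (B j) := fun i j hij =>
    disjoint_left.2 fun x hx hy => hB.loc_ne i j hij x hx x hy rfl
  -- The index `none` stands for the remainder of the window, which must be empty, and `some i` for
  -- `B i`, which must hold one vertex.
  set D : Option ι → Set (Pos d × M) := fun o => o.elim (window M W \ ⋃ i, B i) B with hD
  have hDm : ∀ o, MeasurableSet (D o) := by rintro (_ | i); exacts [hVm, hBm i]
  have hDW : ∀ o, D o ⊆ window M W := by rintro (_ | i); exacts [sdiff_subset, hBW i]
  have hDd : Pairwise fun o o' => Disjoint (D o) (D o') := by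
    rintro (_ | i) (_ | j) hij
    · exact absurd rfl hij
    · exact disjoint_left.2 fun x hx hy => hx.2 (mem_iUnion.2 ⟨j, hy⟩)
    · exact disjoint_left.2 fun x hx hy => hy.2 (mem_iUnion.2 ⟨i, hx⟩)
    · exact hdisj fun hh => hij (by rw [hh])
  set e := Fintype.equivFin (Option ι) with he
  have hind := h.count_indep _ (fun a => D (e.symm a)) (fun a => hDm _)
    fun a b hab => hDd fun hh => hab (e.symm.injective hh)
  set T : Option ι → Set ℕ∞ := fun o => o.elim {0} fun _ => {1} with hT
  have hTm : ∀ o, MeasurableSet (T o) := by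
    rintro (_ | i)
    exacts [measurableSet_singleton _, measurableSet_singleton _]
  have hprod := hind.measure_inter_preimage_eq_mul Finset.univ (sets := fun a => T (e.symm a))
    fun a _ => hTm _
  have hset : (⋂ a ∈ (Finset.univ : Finset (Fin (Fintype.card (Option ι)))),
      G.count (D (e.symm a)) ⁻¹' T (e.symm a)) =
      {ω | G.count (window M W \ ⋃ i, B i) ω = 0 ∧ ∀ i, G.count (B i) ω = 1} := by
    ext ω
    simp only [Finset.mem_univ, iInter_true, mem_iInter, mem_preimage, mem_ofPred_eq]
    rw [e.symm.forall_congr_left (p := fun o => G.count (D (e.symm o)) ω ∈ T (e.symm o))]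
    simp [Option.forall, hD, hT]
  have hprod2 : ∏ a, P (G.count (D (e.symm a)) ⁻¹' T (e.symm a)) =
      ∏ o, P (G.count (D o) ⁻¹' T o) :=
    e.symm.prod_comp fun o => P (G.count (D o) ⁻¹' T o)
  rw [← hset, hprod, hprod2, Fintype.prod_option]
  have h0 : P (G.count (D none) ⁻¹' T none) =
      ENNReal.ofReal (Real.exp (-(l * m.real (window M W \ ⋃ i, B i)))) := by
    have := h.measure_count hl hW hb (hDW none) (hDm none) 0
    simp only [Nat.cast_zero, pow_zero, Nat.factorial_zero, Nat.cast_one, div_one, mul_one] at this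
    exact this
  have h1 : ∀ i, P (G.count (D (some i)) ⁻¹' T (some i)) =
      ENNReal.ofReal (Real.exp (-(l * m.real (B i))) * (l * m.real (B i))) := by
    intro i
    have := h.measure_count hl hW hb (hDW (some i)) (hDm (some i)) 1
    simp only [Nat.cast_one, pow_one, Nat.factorial_one, div_one] at this
    exact this
  have hv : (VertexKind.poisson.locMeasure d W).toReal =
      m.real (window M W \ ⋃ i, B i) + ∑ i, m.real (B i) := by
    have e1 : (VertexKind.poisson.locMeasure d W).toReal = m.real (window M W) := by
      rw [← windowMeasure_univ .poisson ν W, measureReal_def, ← hm,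
        ← measure_add_measure_compl (measurableSet_window M hW), hm,
        windowMeasure_compl .poisson ν hW, add_zero]
    have e2 : m.real (⋃ i, B i) = ∑ i, m.real (B i) :=
      measureReal_iUnion_fintype hdisj hBm
    have e3 : window M W ∩ ⋃ i, B i = ⋃ i, B i := inter_eq_right.2 (iUnion_subset hBW)
    rw [e1, ← e2, ← measureReal_sdiff_add_inter (s := window M W) hUm, e3]
  have hmB : ∀ i, m (B i) = ENNReal.ofReal (m.real (B i)) := fun i => by
    rw [ofReal_measureReal]
  simp only [h0, h1, hmB, janossyWeight]
  rw [← ENNReal.ofReal_prod_of_nonneg fun i _ => by positivity,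
    ← ENNReal.ofReal_prod_of_nonneg fun i _ => by positivity,
    ← ENNReal.ofReal_mul (by positivity), ← ENNReal.ofReal_mul (by positivity), hv]
  congr 1
  rw [Finset.prod_mul_distrib, Finset.prod_mul_distrib, ← Real.exp_sum, Finset.prod_const,
    Finset.card_univ, mul_add, neg_add, Real.exp_add, Finset.mul_sum, Finset.sum_neg_distrib]
  ring

/-- The Poisson law with finite mean has total mass one on ℕ, which leaves no probability for an
infinite count. -/
theorem IsMarkedPoisson.ae_finite (h : IsMarkedPoisson l ν P G)
    [IsProbabilityMeasure P] (hG : G.MeasurableVertices) {W : Set (Pos d)}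
    (hW : MeasurableSet W) (hb : Bornology.IsBounded W) :
    ∀ᵐ ω ∂P, (G.idx (window M W) ω).Finite := by
  have hfin := isFiniteMeasure_windowMeasure .poisson ν hW hb
  have he := intensity_eq_windowMeasure (l := l) (ν := ν) (subset_refl (window M W))
    (measurableSet_window M hW)
  have hne : ENNReal.ofReal l * windowMeasure .poisson ν W (window M W) ≠ ∞ :=
    ENNReal.mul_ne_top ENNReal.ofReal_ne_top (measure_ne_top _ _)
  have hset : {ω | (G.idx (window M W) ω).Finite} =
      ⋃ k : ℕ, {ω | G.count (window M W) ω = k} := by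
    ext ω
    simp only [mem_ofPred_eq, mem_iUnion, count_eq_encard]
    exact ⟨fun hf => ⟨_, hf.encard_eq_coe⟩, fun ⟨k, hk⟩ => finite_of_encard_eq_coe hk⟩
  have hmeas : ∀ k : ℕ, MeasurableSet {ω | G.count (window M W) ω = k} := by
    intro k
    have : {ω | G.count (window M W) ω = k} = ⋃ s : {s : Finset ℕ // s.card = k},
        {ω | G.idx (window M W) ω = (s : Finset ℕ)} := by
      ext ω
      simp only [mem_ofPred_eq, mem_iUnion, count_eq_encard]
      constructor
      · intro hk
        have hf : (G.idx (window M W) ω).Finite := finite_of_encard_eq_coe hk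
        refine ⟨⟨hf.toFinset, ?_⟩, by simp⟩
        rw [hf.encard_eq_coe_toFinset_card] at hk
        exact_mod_cast hk
      · rintro ⟨⟨s, hs⟩, he⟩
        rw [he, encard_coe_eq_coe_finsetCard, hs]
    rw [this]
    exact MeasurableSet.iUnion fun s => measurableSet_idx_eq hG (measurableSet_window M hW) _
  have hM : MeasurableSet {ω | (G.idx (window M W) ω).Finite} := by
    rw [hset]
    exact MeasurableSet.iUnion hmeas
  refine (mem_ae_iff_prob_eq_one hM).2 ?_
  rw [hset, measure_iUnion _ hmeas]
  · simp_rw [h.count_law _ (measurableSet_window M hW) (he ▸ hne)]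
    rw [← measure_iUnion (fun i j hij => by simpa using hij)
      fun k => measurableSet_singleton k]
    rw [iUnion_of_singleton]
    exact measure_univ
  · intro i j hij
    refine disjoint_left.2 fun ω h1 h2 => hij ?_
    exact_mod_cast (show G.count _ ω = i from h1).symm.trans h2

end Poisson

/-! ### Bernoulli vertices: exact occupation probabilities -/

section Bernoulli

variable {Ω : Type*} [MeasurableSpace Ω] {d : ℕ} {M : Type*} [MeasurableSpace M]
  {G : RandomGraph Ω d M} {l : ℝ} {ν : Measure M} [IsProbabilityMeasure ν] {P : Measure Ω}

theorem windowMeasure_bernoulli_apply {W : Set (Pos d)} (hW : MeasurableSet W)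
    {B : Set (Pos d × M)} (hB : MeasurableSet B) (hBW : B ⊆ window M W) :
    windowMeasure .bernoulli ν W B =
      ∑' z : Fin d → ℤ, ν (Prod.mk (latticePoint z) ⁻¹' B) := by
  rw [windowMeasure, Measure.prod_apply hB, setLIntegral_locMeasure_bernoulli hW]
  congr 1 with z
  by_cases hz : latticePoint z ∈ W
  · rw [indicator_of_mem hz]
  · rw [indicator_of_notMem hz]
    have : Prod.mk (latticePoint z) ⁻¹' B = ∅ := by
      rw [eq_empty_iff_forall_notMem]
      exact fun y hy => hz (hBW hy)
    rw [this, measure_empty]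

/-- Simplicity makes the count at a site 0 or 1 almost surely, so the vacancy probability is the
complement of the occupation probability. -/
theorem IsMarkedBernoulli.measure_count_zero (h : IsMarkedBernoulli l ν P G) (hl : l ∈ Ioc 0 1)
    [IsProbabilityMeasure P] (hG : G.MeasurableVertices)
    (hsimple : ∀ᵐ ω ∂P, ∀ i ∈ G.occ ω, ∀ j ∈ G.occ ω, G.loc i ω = G.loc j ω → i = j)
    (z : Fin d → ℤ) :
    P {ω | G.count ({latticePoint z} ×ˢ univ) ω = 0} = ENNReal.ofReal (1 - l) := by
  have h1 := h.site_law z univ MeasurableSet.univ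
  rw [measure_univ, mul_one] at h1
  have hm : MeasurableSet ({latticePoint z} ×ˢ univ : Set (Pos d × M)) :=
    (measurableSet_singleton _).prod MeasurableSet.univ
  have hae : {ω | G.count ({latticePoint z} ×ˢ univ) ω = 0} =ᵐ[P]
      {ω | G.count ({latticePoint z} ×ˢ univ) ω = 1}ᶜ := by
    filter_upwards [hsimple] with ω hω
    refine propext ⟨fun h0 h1 => zero_ne_one ((show G.count _ ω = 0 from h0).symm.trans h1),
      fun hne => ?_⟩
    by_contra h0
    obtain ⟨i, hi⟩ := nonempty_iff_ne_empty.2 fun he => h0 (encard_eq_zero.2 he)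
    refine hne (encard_eq_one.2 ⟨i, ?_⟩)
    ext j
    refine ⟨fun hj => hω j hj.1 i hi.1 ?_, fun hj => hj ▸ hi⟩
    exact (show G.loc j ω = latticePoint z from hj.2.1).trans
      (show G.loc i ω = latticePoint z from hi.2.1).symm
  refine (measure_congr hae).trans
    ((prob_compl_eq_one_sub (measurableSet_count_one hG hm)).trans ?_)
  rw [h1, ENNReal.ofReal_sub _ hl.1.le, ENNReal.ofReal_one]

/-- A set of diameter below 1 contains locations of at most one site. The event thus prescribes,
independently over the sites of the window, a vertex with restricted mark at the selected sites and
vacancy at the others. -/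
theorem IsMarkedBernoulli.atom_law (h : IsMarkedBernoulli l ν P G) (hl : l ∈ Ioc 0 1)
    [IsProbabilityMeasure P] (hG : G.MeasurableVertices)
    (hsimple : ∀ᵐ ω ∂P, ∀ i ∈ G.occ ω, ∀ j ∈ G.occ ω, G.loc i ω = G.loc j ω → i = j)
    {W : Set (Pos d)} (hW : MeasurableSet W) (hb : Bornology.IsBounded W)
    {ι : Type*} [Fintype ι]
    {B : ι → Set (Pos d × M)} (hBm : ∀ i, MeasurableSet (B i)) (hB : SmallSeparated B)
    (hBW : ∀ i, B i ⊆ window M W) :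
    P {ω | G.count (window M W \ ⋃ i, B i) ω = 0 ∧ ∀ i, G.count (B i) ω = 1} =
      janossyWeight .bernoulli l (VertexKind.bernoulli.locMeasure d W) (Fintype.card ι) *
        ∏ i, windowMeasure .bernoulli ν W (B i) := by
  classical
  have hc := Finite.to_countable (α := ι)
  -- If some `B i` meets no lattice location, then its mass and the probability both vanish.
  by_cases hlat : ∀ i, ∃ z : Fin d → ℤ, ∃ y, (latticePoint z, y) ∈ B i
  swap
  · push Not at hlat
    obtain ⟨i, hi⟩ := hlat
    have h0 : windowMeasure .bernoulli ν W (B i) = 0 := by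
      rw [windowMeasure_bernoulli_apply hW (hBm i) (hBW i), ENNReal.tsum_eq_zero]
      intro z
      have : Prod.mk (latticePoint z) ⁻¹' B i = ∅ := by
        rw [eq_empty_iff_forall_notMem]
        exact fun y hy => hi z y hy
      rw [this, measure_empty]
    rw [Finset.prod_eq_zero (Finset.mem_univ i) h0, mul_zero]
    refine measure_eq_zero_iff_ae_notMem.2 ?_
    filter_upwards [h.mem_lattice] with ω hω hmem
    obtain ⟨j, hj⟩ := encard_eq_one.1 (hmem.2 i)
    have hjB : j ∈ G.idx (B i) ω := by
      change j ∈ {i_1 | i_1 ∈ G.occ ω ∧ G.vertex i_1 ω ∈ B i}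
      rw [hj]; rfl
    obtain ⟨z, hz⟩ := hω j hjB.1
    refine hi z (G.vertex j ω).2 ?_
    rw [hz]
    exact hjB.2
  choose z hz using hlat
  choose y hy using hz
  have huniq : ∀ i w x, (latticePoint w, x) ∈ B i → w = z i := fun i w x hx =>
    eq_of_dist_latticePoint_lt_one (hB.dist_lt i _ hx _ (hy i))
  have hzinj : Function.Injective z := by
    intro i j hij
    by_contra hne
    exact hB.loc_ne i j hne _ (hy i) _ (hy j) (by simp [hij])
  set Z : Finset (Fin d → ℤ) := (finite_latticePoint_mem hb).toFinset with hZ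
  have hzZ : ∀ i, z i ∈ Z := fun i => by
    rw [hZ, Finite.mem_toFinset]
    exact hBW i (hy i)
  -- At the site selected by `B i` only the marks in the slice of `B i` are admitted. At every other
  -- site all marks count, since vacancy is required there.
  set A : (Fin d → ℤ) → Set M := fun w => if w ∈ range z then
    Prod.mk (latticePoint w) ⁻¹' ⋃ i, B i else univ with hA
  have hAm : ∀ w, MeasurableSet (A w) := by
    intro w
    simp only [hA]
    split_ifs
    · exact measurable_prodMk_left (MeasurableSet.iUnion hBm)
    · exact MeasurableSet.univ
  have hAz : ∀ i, A (z i) = Prod.mk (latticePoint (z i)) ⁻¹' B i := by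
    intro i
    simp only [hA, mem_range_self, if_true]
    ext x
    simp only [mem_preimage, mem_iUnion]
    refine ⟨fun ⟨j, hj⟩ => ?_, fun hx => ⟨i, hx⟩⟩
    obtain rfl := hzinj (huniq j _ _ hj)
    exact hj
  have hAu : ∀ w ∉ range z, A w = univ := fun w hw => if_neg hw
  set T : (Fin d → ℤ) → Set ℕ∞ := fun w => if w ∈ range z then {1} else {0} with hT
  have hind := (h.site_indep A hAm).measure_inter_preimage_eq_mul Z (sets := T) fun w _ => by
    simp only [hT]
    split_ifs <;> exact measurableSet_singleton _
  have hae : {ω | G.count (window M W \ ⋃ i, B i) ω = 0 ∧ ∀ i, G.count (B i) ω = 1} =ᵐ[P]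
      (⋂ w ∈ Z, G.count ({latticePoint w} ×ˢ A w) ⁻¹' T w : Set Ω) := by
    filter_upwards [h.mem_lattice, hsimple] with ω hω hs
    have hidx : ∀ i, G.idx ({latticePoint (z i)} ×ˢ A (z i)) ω = G.idx (B i) ω := by
      intro i
      ext j
      constructor
      · rintro ⟨hj, hj1, hj2⟩
        rw [hAz] at hj2
        refine ⟨hj, ?_⟩
        rw [← show (G.vertex j ω).1 = latticePoint (z i) from hj1] at hj2
        exact hj2
      · rintro ⟨hj, hjB⟩
        obtain ⟨w, hw⟩ := hω j hj
        have hw' : (latticePoint w, (G.vertex j ω).2) ∈ B i := by rw [hw]; exact hjB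
        obtain rfl := huniq i w _ hw'
        refine ⟨hj, hw.symm, ?_⟩
        rw [hAz]
        exact hw'
    have hcnt : ∀ i, G.count ({latticePoint (z i)} ×ˢ A (z i)) ω = G.count (B i) ω := fun i => by
      rw [count_eq_encard, hidx, count_eq_encard]
    refine propext ?_
    change (_ ∧ _) ↔ ω ∈ (⋂ w ∈ Z, G.count ({latticePoint w} ×ˢ A w) ⁻¹' T w : Set Ω)
    simp only [mem_iInter, mem_preimage]
    constructor
    · rintro ⟨h0, h1⟩ w hw
      by_cases hwz : w ∈ range z
      · obtain ⟨i, rfl⟩ := hwz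
        simp only [hT, mem_range_self, if_true, mem_singleton_iff]
        rw [hcnt, h1]
      · simp only [hT, hwz, if_false, mem_singleton_iff]
        rw [count_eq_encard, encard_eq_zero, eq_empty_iff_forall_notMem]
        rintro j ⟨hj, hj1, -⟩
        rw [count_eq_encard, encard_eq_zero] at h0
        have hj1' : (G.vertex j ω).1 = latticePoint w := hj1
        have : j ∈ G.idx (window M W \ ⋃ i, B i) ω := by
          refine ⟨hj, ?_, ?_⟩
          · change (G.vertex j ω).1 ∈ W
            rw [hj1']
            simpa [hZ] using hw
          · intro hjB
            obtain ⟨i, hi⟩ := mem_iUnion.1 hjB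
            refine hwz ⟨i, (huniq i w (G.vertex j ω).2 ?_).symm⟩
            rw [← hj1']
            exact hi
        rw [h0] at this
        exact this
    · intro H
      have h1 : ∀ i, G.count (B i) ω = 1 := by
        intro i
        have := H (z i) (hzZ i)
        simp only [hT, mem_range_self, if_true, mem_singleton_iff] at this
        rw [← hcnt, this]
      refine ⟨?_, h1⟩
      rw [count_eq_encard, encard_eq_zero, eq_empty_iff_forall_notMem]
      rintro j ⟨hj, hjW, hjB⟩
      obtain ⟨w, hw⟩ := hω j hj
      have hwZ : w ∈ Z := by
        simp only [hZ, Finite.mem_toFinset, mem_ofPred_eq]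
        rw [hw]
        exact hjW
      by_cases hwz : w ∈ range z
      · obtain ⟨i, rfl⟩ := hwz
        obtain ⟨j', hj'⟩ := encard_eq_one.1 (h1 i)
        have hjm : j' ∈ G.idx (B i) ω := by
          change j' ∈ {i_1 | i_1 ∈ G.occ ω ∧ G.vertex i_1 ω ∈ B i}
          rw [hj']; rfl
        obtain ⟨w', hw'⟩ := hω j' hjm.1
        have : w' = z i := by
          refine huniq i w' (G.vertex j' ω).2 ?_
          rw [hw']
          exact hjm.2
        have hjj : j = j' := hs j hj j' hjm.1 (by rw [← hw, ← hw', this])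
        subst hjj
        exact hjB (mem_iUnion.2 ⟨i, hjm.2⟩)
      · have := H w hwZ
        simp only [hT, hwz, if_false, mem_singleton_iff] at this
        rw [count_eq_encard, encard_eq_zero, eq_empty_iff_forall_notMem] at this
        exact this j ⟨hj, hw.symm, by rw [hAu w hwz]; trivial⟩
  have himg : Finset.univ.image z ⊆ Z := fun w hw => by
    obtain ⟨i, -, rfl⟩ := Finset.mem_image.1 hw
    exact hzZ i
  have hcard : (Finset.univ.image z).card = Fintype.card ι := by
    rw [Finset.card_image_of_injective _ hzinj, Finset.card_univ]
  have hmB : ∀ i, windowMeasure .bernoulli ν W (B i) = ν (A (z i)) := by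
    intro i
    rw [windowMeasure_bernoulli_apply hW (hBm i) (hBW i), hAz, tsum_eq_single (z i)]
    intro w hw
    have : Prod.mk (latticePoint w) ⁻¹' B i = ∅ := by
      rw [eq_empty_iff_forall_notMem]
      exact fun x hx => hw (huniq i w x hx)
    rw [this, measure_empty]
  have hin : ∀ i, P (G.count ({latticePoint (z i)} ×ˢ A (z i)) ⁻¹' T (z i)) =
      ENNReal.ofReal l * ν (A (z i)) := by
    intro i
    have := h.site_law (z i) (A (z i)) (hAm _)
    simp only [hT, mem_range_self, if_true]
    exact this
  have hout : ∀ w ∈ Z \ Finset.univ.image z,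
      P (G.count ({latticePoint w} ×ˢ A w) ⁻¹' T w) = ENNReal.ofReal (1 - l) := by
    intro w hw
    have hwz : w ∉ range z := by simpa using (Finset.mem_sdiff.1 hw).2
    have := h.measure_count_zero hl hG hsimple w
    simp only [hT, hwz, if_false]
    rw [hAu w hwz]
    exact this
  rw [measure_congr hae, hind, ← Finset.prod_sdiff himg, Finset.prod_congr rfl hout,
    Finset.prod_const, Finset.card_sdiff_of_subset himg, hcard,
    Finset.prod_image hzinj.injOn]
  simp only [hin, hmB, janossyWeight]
  rw [Finset.prod_mul_distrib, Finset.prod_const, Finset.card_univ,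
    locMeasure_bernoulli_apply hW hb, ENNReal.toReal_natCast, Nat.floor_natCast,
    ENNReal.ofReal_mul (pow_nonneg hl.1.le _), ENNReal.ofReal_pow hl.1.le,
    ENNReal.ofReal_pow (sub_nonneg.2 hl.2)]
  ring

end Bernoulli

theorem IsMarkedBernoulli.ae_finite {Ω : Type*} [MeasurableSpace Ω] {d : ℕ} {M : Type*}
    [MeasurableSpace M] {G : RandomGraph Ω d M} {l : ℝ} {ν : Measure M} {P : Measure Ω}
    (h : IsMarkedBernoulli l ν P G)
    (hsimple : ∀ᵐ ω ∂P, ∀ i ∈ G.occ ω, ∀ j ∈ G.occ ω, G.loc i ω = G.loc j ω → i = j)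
    {W : Set (Pos d)} (hb : Bornology.IsBounded W) :
    ∀ᵐ ω ∂P, (G.idx (window M W) ω).Finite := by
  filter_upwards [h.mem_lattice, hsimple] with ω hω hs
  refine Finite.of_finite_image (f := fun j => G.loc j ω) ?_
    fun i hi j hj hij => hs i hi.1 j hj.1 hij
  refine ((finite_latticePoint_mem hb).image latticePoint).subset ?_
  rintro _ ⟨j, hj, rfl⟩
  obtain ⟨z, hz⟩ := hω j hj.1
  refine ⟨z, ?_, hz⟩
  change latticePoint z ∈ W
  rw [hz]
  exact hj.2

/-! ### Factorisation over disjoint windows -/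

namespace IndependentSetting

variable {kind : VertexKind} {Ω : Type*} [MeasurableSpace Ω] {d : ℕ}
    {M : Type*} [MeasurableSpace M] {l : ℝ} {ν : Measure M} [IsProbabilityMeasure ν]
    {p : Pos d × M → Pos d × M → ℝ} {P : Measure Ω} {G : RandomGraph Ω d M}

theorem atom_law (h : IndependentSetting kind l ν p P G) (hl : l ∈ kind.intensities)
    {W : Set (Pos d)} (hW : MeasurableSet W) (hb : Bornology.IsBounded W)
    {ι : Type*} [Fintype ι]
    {B : ι → Set (Pos d × M)} (hBm : ∀ i, MeasurableSet (B i)) (hB : SmallSeparated B)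
    (hBW : ∀ i, B i ⊆ window M W) :
    P {ω | G.count (window M W \ ⋃ i, B i) ω = 0 ∧ ∀ i, G.count (B i) ω = 1} =
      janossyWeight kind l (kind.locMeasure d W) (Fintype.card ι) *
        ∏ i, windowMeasure kind ν W (B i) := by
  have := h.prob
  cases kind with
  | poisson => exact IsMarkedPoisson.atom_law h.vertex_law hl hW hb hBm hB hBW
  | bernoulli =>
    exact IsMarkedBernoulli.atom_law h.vertex_law hl h.measurableVertices h.simple hW hb hBm
      hB hBW

theorem ae_finite (h : IndependentSetting kind l ν p P G) (hl : l ∈ kind.intensities)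
    {W : Set (Pos d)} (hW : MeasurableSet W) (hb : Bornology.IsBounded W) :
    ∀ᵐ ω ∂P, (G.idx (window M W) ω).Finite := by
  have := h.prob
  cases kind with
  | poisson => exact IsMarkedPoisson.ae_finite h.vertex_law h.measurableVertices hW hb
  | bernoulli => exact IsMarkedBernoulli.ae_finite h.vertex_law h.simple hb

end IndependentSetting

theorem windowMeasure_apply_of_subset (kind : VertexKind) {d : ℕ} {M : Type*} [MeasurableSpace M]
    (ν : Measure M) [IsProbabilityMeasure ν] {U W : Set (Pos d)} (hU : MeasurableSet U)
    (hW : MeasurableSet W) (hUW : U ⊆ W) {B : Set (Pos d × M)} (hB : MeasurableSet B)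
    (hBU : B ⊆ window M U) : windowMeasure kind ν U B = windowMeasure kind ν W B := by
  rw [windowMeasure, windowMeasure, Measure.prod_apply hB, Measure.prod_apply hB,
    ← lintegral_indicator hU, ← lintegral_indicator hW]
  congr 1 with x
  by_cases hx : x ∈ U
  · rw [indicator_of_mem hx, indicator_of_mem (hUW hx)]
  · have : Prod.mk x ⁻¹' B = ∅ := by
      rw [eq_empty_iff_forall_notMem]
      exact fun y hy => hx (hBU hy)
    rw [indicator_of_notMem hx]
    by_cases hxW : x ∈ W
    · rw [indicator_of_mem hxW, this, measure_empty]
    · rw [indicator_of_notMem hxW]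

/-- Separated sets of positive mass use different sites. This bounds the number of points by the
number of sites and makes the truncated subtraction in the Bernoulli exponent exact. -/
theorem card_le_of_windowMeasure_ne_zero {d : ℕ} {M : Type*} [MeasurableSpace M]
    (ν : Measure M) [IsProbabilityMeasure ν] {U : Set (Pos d)} (hU : MeasurableSet U)
    (hb : Bornology.IsBounded U) {ι : Type*} [Fintype ι] {B : ι → Set (Pos d × M)}
    (hBm : ∀ i, MeasurableSet (B i)) (hB : SmallSeparated B) (hBU : ∀ i, B i ⊆ window M U)
    (hne : ∀ i, windowMeasure .bernoulli ν U (B i) ≠ 0) :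
    Fintype.card ι ≤ (finite_latticePoint_mem hb).toFinset.card := by
  have hlat : ∀ i, ∃ z : Fin d → ℤ, ∃ y, (latticePoint z, y) ∈ B i := by
    intro i
    by_contra! hi
    refine hne i ?_
    rw [windowMeasure_bernoulli_apply hU (hBm i) (hBU i), ENNReal.tsum_eq_zero]
    intro z
    have : Prod.mk (latticePoint z) ⁻¹' B i = ∅ := by
      rw [eq_empty_iff_forall_notMem]
      exact fun y hy => hi z y hy
    rw [this, measure_empty]
  choose z hz using hlat
  choose y hy using hz
  rw [← Finset.card_univ]
  refine Finset.card_le_card_of_injOn z (fun i _ => ?_) fun i _ j _ hij => ?_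
  · rw [Finset.mem_coe, Finite.mem_toFinset]
    exact hBU i (hy i)
  · by_contra hne
    exact hB.loc_ne i j hne _ (hy i) _ (hy j) (by simp [hij])

/-- The weights are multiplicative because mass and number of points both add over disjoint windows.
-/
theorem janossyWeight_add_mul_prod (kind : VertexKind) (l : ℝ) (hl : l ∈ kind.intensities) {d : ℕ}
    {M : Type*} [MeasurableSpace M] (ν : Measure M) [IsProbabilityMeasure ν] {U U' : Set (Pos d)}
    (hU : MeasurableSet U) (hb : Bornology.IsBounded U) (hU' : MeasurableSet U')
    (hb' : Bornology.IsBounded U') (hd : Disjoint U U')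
    {ι ι' : Type*} [Fintype ι] [Fintype ι'] {B : ι → Set (Pos d × M)} {B' : ι' → Set (Pos d × M)}
    (hBm : ∀ i, MeasurableSet (B i)) (hB : SmallSeparated B) (hBU : ∀ i, B i ⊆ window M U)
    (hBm' : ∀ i, MeasurableSet (B' i)) (hB' : SmallSeparated B') (hBU' : ∀ i, B' i ⊆ window M U') :
    janossyWeight kind l (kind.locMeasure d (U ∪ U')) (Fintype.card ι + Fintype.card ι') *
      ((∏ i, windowMeasure kind ν U (B i)) * ∏ i, windowMeasure kind ν U' (B' i)) =
    (janossyWeight kind l (kind.locMeasure d U) (Fintype.card ι) *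
      ∏ i, windowMeasure kind ν U (B i)) *
    (janossyWeight kind l (kind.locMeasure d U') (Fintype.card ι') *
      ∏ i, windowMeasure kind ν U' (B' i)) := by
  have hv : kind.locMeasure d (U ∪ U') = kind.locMeasure d U + kind.locMeasure d U' :=
    measure_union hd hU'
  have hv1 := (locMeasure_lt_top kind hU hb).ne
  have hv2 := (locMeasure_lt_top kind hU' hb').ne
  rw [mul_mul_mul_comm]
  -- In the Bernoulli case the weights factor only if neither window has more points than sites.
  -- Otherwise the product of masses is zero and nothing is to be shown.
  by_cases h0 : (∏ i, windowMeasure kind ν U (B i)) * ∏ i, windowMeasure kind ν U' (B' i) = 0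
  · rw [h0, mul_zero, mul_zero]
  congr 1
  cases kind with
  | poisson =>
    have hl' : 0 < l := hl
    simp only [janossyWeight]
    rw [← ENNReal.ofReal_mul (by positivity), hv, ENNReal.toReal_add hv1 hv2, mul_add, neg_add,
      Real.exp_add, pow_add]
    ring_nf
  | bernoulli =>
    have hl' : 0 < l ∧ l ≤ 1 := hl
    rw [mul_eq_zero, not_or, Finset.prod_eq_zero_iff, Finset.prod_eq_zero_iff] at h0
    push Not at h0
    have c1 := card_le_of_windowMeasure_ne_zero ν hU hb hBm hB hBU fun i =>
      h0.1 i (Finset.mem_univ i)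
    have c2 := card_le_of_windowMeasure_ne_zero ν hU' hb' hBm' hB' hBU' fun i =>
      h0.2 i (Finset.mem_univ i)
    simp only [janossyWeight]
    rw [hv, locMeasure_bernoulli_apply hU hb, locMeasure_bernoulli_apply hU' hb',
      ← Nat.cast_add, ENNReal.toReal_natCast, ENNReal.toReal_natCast, ENNReal.toReal_natCast,
      Nat.floor_natCast, Nat.floor_natCast, Nat.floor_natCast,
      ← ENNReal.ofReal_mul (mul_nonneg (pow_nonneg hl'.1.le _)
        (pow_nonneg (sub_nonneg.2 hl'.2) _))]
    congr 1
    rw [show ∀ a b m n : ℕ, m ≤ a → n ≤ b → a + b - (m + n) = (a - m) + (b - n) by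
      intros; omega]
    · rw [pow_add, pow_add]; ring
    · exact c1
    · exact c2

/-- The expectation of a function of the labelled configurations in a window, one function for
each number of points. -/
def janossyIntegral (kind : VertexKind) (l : ℝ) {d : ℕ} {M : Type*} [MeasurableSpace M]
    (ν : Measure M) (W : Set (Pos d)) (n : ℕ) (f : (Fin n → Pos d × M) → ℝ≥0∞) : ℝ≥0∞ :=
  janossyWeight kind l (kind.locMeasure d W) n *
    ∫⁻ x in distinctLoc (Fin n) d M, f x ∂(Measure.pi fun _ => windowMeasure kind ν W)

namespace IndependentSetting

variable {kind : VertexKind} {Ω : Type*} [MeasurableSpace Ω] {d : ℕ}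
    {M : Type*} [MeasurableSpace M] {l : ℝ} {ν : Measure M} [IsProbabilityMeasure ν]
    {p : Pos d × M → Pos d × M → ℝ} {P : Measure Ω} {G : RandomGraph Ω d M}

/-- The occupation law in the union of the windows, for the joined family of sets, factorises
because weights and masses do. -/
theorem atom_law_indep (h : IndependentSetting kind l ν p P G) (hl : l ∈ kind.intensities)
    {U U' : Set (Pos d)} (hU : MeasurableSet U) (hb : Bornology.IsBounded U)
    (hU' : MeasurableSet U') (hb' : Bornology.IsBounded U') (hd : Disjoint U U')
    {ι ι' : Type*} [Fintype ι] [Fintype ι'] {B : ι → Set (Pos d × M)} {B' : ι' → Set (Pos d × M)}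
    (hBm : ∀ i, MeasurableSet (B i)) (hB : SmallSeparated B) (hBU : ∀ i, B i ⊆ window M U)
    (hBm' : ∀ i, MeasurableSet (B' i)) (hB' : SmallSeparated B')
    (hBU' : ∀ i, B' i ⊆ window M U') :
    P ({ω | G.count (window M U \ ⋃ i, B i) ω = 0 ∧ ∀ i, G.count (B i) ω = 1} ∩
      {ω | G.count (window M U' \ ⋃ i, B' i) ω = 0 ∧ ∀ i, G.count (B' i) ω = 1}) =
    (janossyWeight kind l (kind.locMeasure d U) (Fintype.card ι) *
      ∏ i, windowMeasure kind ν U (B i)) *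
    (janossyWeight kind l (kind.locMeasure d U') (Fintype.card ι') *
      ∏ i, windowMeasure kind ν U' (B' i)) := by
  have hne : ∀ x y : Pos d × M, x ∈ window M U → y ∈ window M U' → x.1 ≠ y.1 :=
    fun x y hx hy he => disjoint_left.1 hd hx (by rw [he]; exact hy)
  set C : ι ⊕ ι' → Set (Pos d × M) := Sum.elim B B' with hC
  have hCm : ∀ i, MeasurableSet (C i) := by rintro (i | i); exacts [hBm i, hBm' i]
  have hCW : ∀ i, C i ⊆ window M (U ∪ U') := by
    rintro (i | i) x hx
    · exact Or.inl (hBU i hx)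
    · exact Or.inr (hBU' i hx)
  have hCs : SmallSeparated C := by
    constructor
    · rintro (i | i) (j | j) hij x hx y hy
      · exact hB.loc_ne i j (fun hh => hij (by rw [hh])) x hx y hy
      · exact hne x y (hBU i hx) (hBU' j hy)
      · exact (hne y x (hBU j hy) (hBU' i hx)).symm
      · exact hB'.loc_ne i j (fun hh => hij (by rw [hh])) x hx y hy
    · rintro (i | i)
      exacts [hB.dist_lt i, hB'.dist_lt i]
  have key := h.atom_law hl (hU.union hU') (hb.union hb') hCm hCs hCW
  rw [Fintype.card_sum, Fintype.prod_sum_type] at key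
  have e1 : ∀ i, windowMeasure kind ν (U ∪ U') (C (Sum.inl i)) = windowMeasure kind ν U (B i) :=
    fun i => (windowMeasure_apply_of_subset kind ν hU (hU.union hU') subset_union_left (hBm i)
      (hBU i)).symm
  have e2 : ∀ i, windowMeasure kind ν (U ∪ U') (C (Sum.inr i)) = windowMeasure kind ν U' (B' i) :=
    fun i => (windowMeasure_apply_of_subset kind ν hU' (hU.union hU') subset_union_right (hBm' i)
      (hBU' i)).symm
  simp only [e1, e2] at key
  rw [← janossyWeight_add_mul_prod kind l hl ν hU hb hU' hb' hd hBm hB hBU hBm' hB' hBU', ← key]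
  congr 1 with ω
  simp only [mem_inter_iff, mem_ofPred_eq, Sum.forall, count_eq_encard, encard_eq_zero]
  have hsplit : G.idx (window M (U ∪ U') \ ⋃ i, C i) ω = ∅ ↔
      G.idx (window M U \ ⋃ i, B i) ω = ∅ ∧ G.idx (window M U' \ ⋃ i, B' i) ω = ∅ := by
    have : window M (U ∪ U') \ ⋃ i, C i =
        (window M U \ ⋃ i, B i) ∪ (window M U' \ ⋃ i, B' i) := by
      ext x
      simp only [Set.mem_sdiff, mem_union, mem_iUnion, Sum.exists, hC, Sum.elim_inl, Sum.elim_inr]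
      have hw : x ∈ window M (U ∪ U') ↔ x ∈ window M U ∨ x ∈ window M U' := Iff.rfl
      have h1 : x ∈ window M U → ¬ ∃ i, x ∈ B' i :=
        fun hx ⟨i, hi⟩ => hne x x hx (hBU' i hi) rfl
      have h2 : x ∈ window M U' → ¬ ∃ i, x ∈ B i :=
        fun hx ⟨i, hi⟩ => hne x x (hBU i hi) hx rfl
      rw [hw]
      tauto
    rw [this, ← union_empty_iff]
    congr! 1
    ext j
    simp only [idx, mem_ofPred_eq, mem_union]
    tauto
  rw [hsplit]
  simp only [hC, Sum.elim_inl, Sum.elim_inr]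
  tauto

/-- The labelled configurations in disjoint windows are independent. -/
theorem tsum_lintegral_labelled_mul (h : IndependentSetting kind l ν p P G)
    (hl : l ∈ kind.intensities) {U U' : Set (Pos d)} (hU : MeasurableSet U)
    (hb : Bornology.IsBounded U) (hU' : MeasurableSet U') (hb' : Bornology.IsBounded U')
    (hd : Disjoint U U') (n n' : ℕ) {f : (Fin n → Pos d × M) → ℝ≥0∞}
    {f' : (Fin n' → Pos d × M) → ℝ≥0∞} (hf : Measurable f) (hf' : Measurable f')
    (hf1 : ∀ x, f x ≤ 1) :
    ∑' t : Fin n ↪ ℕ, ∑' t' : Fin n' ↪ ℕ, ∫⁻ ω in {ω | G.idx (window M U) ω = range t} ∩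
        {ω | G.idx (window M U') ω = range t'}, f (G.points t ω) * f' (G.points t' ω) ∂P =
      janossyIntegral kind l ν U n f * janossyIntegral kind l ν U' n' f' := by
  have := h.prob
  have hG := h.measurableVertices
  have := countable_embedding_nat (Fin n)
  have := countable_embedding_nat (Fin n')
  have := isFiniteMeasure_windowMeasure kind ν hU hb
  have := isFiniteMeasure_windowMeasure kind ν hU' hb'
  have hV := measurableSet_window M hU
  have hV' := measurableSet_window M hU'
  have hAm : ∀ t : Fin n ↪ ℕ, MeasurableSet {ω | G.idx (window M U) ω = range t} :=
    fun t => measurableSet_idx_eq hG hV _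
  have hAm' : ∀ t : Fin n' ↪ ℕ, MeasurableSet {ω | G.idx (window M U') ω = range t} :=
    fun t => measurableSet_idx_eq hG hV' _
  have hfm : ∀ t : Fin n ↪ ℕ, Measurable fun ω => f (G.points t ω) :=
    fun t => hf.comp (measurable_points hG t)
  have hfm' : ∀ t : Fin n' ↪ ℕ, Measurable fun ω => f' (G.points t ω) :=
    fun t => hf'.comp (measurable_points hG t)
  -- The bound on f makes the first factor finite, so that it may serve as the constant in the
  -- second application of `lintegral_labelled`.
  have hJfin : janossyIntegral kind l ν U n f ≠ ∞ := by
    refine ENNReal.mul_ne_top (janossyWeight_ne_top _ _ _ _) ?_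
    refine ((lintegral_mono hf1).trans_lt ?_).ne
    rw [lintegral_one]
    exact measure_lt_top _ _
  -- The description of labelled points is applied twice. For each occupation event `H` of the
  -- second window it is applied in the first window under P restricted to `H`. This computes `Q`,
  -- which carries the density f of the first window, and the description is then applied in the
  -- second window under `Q`.
  set Q : Measure Ω := Measure.sum fun t : Fin n ↪ ℕ =>
    (P.restrict {ω | G.idx (window M U) ω = range t}).withDensity
      fun ω => f (G.points t ω) with hQ
  -- Absolute continuity transfers the simplicity of the vertex set from P to `Q`.
  have hQP : Q ≪ P := by
    refine Measure.AbsolutelyContinuous.mk fun s hs h0 => ?_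
    rw [hQ, Measure.sum_apply _ hs, ENNReal.tsum_eq_zero]
    intro t
    exact (withDensity_absolutelyContinuous _ _).trans Measure.absolutelyContinuous_restrict h0
  have key : ∀ B' : Fin n' → Set (Pos d × M), (∀ i, MeasurableSet (B' i)) → SmallSeparated B' →
      (∀ i, B' i ⊆ window M U') →
      Q {ω | G.count (window M U' \ ⋃ i, B' i) ω = 0 ∧ ∀ i, G.count (B' i) ω = 1} =
        (janossyIntegral kind l ν U n f * janossyWeight kind l (kind.locMeasure d U') n') *
          ∏ i, windowMeasure kind ν U' (B' i) := by
    intro B' hBm' hB' hBU'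
    set H := {ω | G.count (window M U' \ ⋃ i, B' i) ω = 0 ∧ ∀ i, G.count (B' i) ω = 1} with hH
    have hHm : MeasurableSet H := by
      have : H = {ω | G.count (window M U' \ ⋃ i, B' i) ω = 0} ∩
          ⋂ i, {ω | G.count (B' i) ω = 1} := by
        ext; simp [hH]
      rw [this]
      exact (measurableSet_count_zero hG (hV'.diff (MeasurableSet.iUnion hBm'))).inter
        (MeasurableSet.iInter fun i => measurableSet_count_one hG (hBm' i))
    have hPH : P H = janossyWeight kind l (kind.locMeasure d U') n' *
        ∏ i, windowMeasure kind ν U' (B' i) := by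
      rw [hH, h.atom_law hl hU' hb' hBm' hB' hBU', Fintype.card_fin]
    have hstep := lintegral_labelled hG (P.restrict H) (ae_restrict_of_ae h.simple) hV
      (windowMeasure kind ν U) (windowMeasure_compl kind ν hU)
      (ι := Fin n) (a := janossyWeight kind l (kind.locMeasure d U) n * P H)
      (ENNReal.mul_ne_top (janossyWeight_ne_top _ _ _ _) (measure_ne_top _ _))
      (fun B hBm hB hBU => by
        rw [Measure.restrict_apply' hHm, hH,
          h.atom_law_indep hl hU hb hU' hb' hd hBm hB hBU hBm' hB' hBU', ← hH, hPH,
          Fintype.card_fin, Fintype.card_fin]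
        ring) hf
    rw [hQ, Measure.sum_apply _ hHm]
    have e : ∀ t : Fin n ↪ ℕ, ((P.restrict {ω | G.idx (window M U) ω = range t}).withDensity
        fun ω => f (G.points t ω)) H = ∫⁻ ω in {ω | G.idx (window M U) ω = range t},
          f (G.points t ω) ∂(P.restrict H) := by
      intro t
      rw [withDensity_apply _ hHm, Measure.restrict_restrict hHm,
        Measure.restrict_restrict (hAm t), inter_comm]
    simp only [e]
    rw [hstep, hPH, janossyIntegral]
    ring
  have hfinal := lintegral_labelled hG Q (hQP h.simple) hV' (windowMeasure kind ν U')
    (windowMeasure_compl kind ν hU') (ENNReal.mul_ne_top hJfin (janossyWeight_ne_top _ _ _ _))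
    key hf'
  rw [mul_assoc] at hfinal
  refine Eq.trans ?_ hfinal
  rw [ENNReal.tsum_comm]
  congr 1 with t'
  rw [hQ, Measure.restrict_sum _ (hAm' t'), lintegral_sum_measure]
  congr 1 with t
  rw [restrict_withDensity (hAm' t'), lintegral_withDensity_eq_lintegral_mul _ (hfm t) (hfm' t'),
    Measure.restrict_restrict (hAm' t'), inter_comm]
  rfl

end IndependentSetting

/-! ### Probabilities of events determined by the graph in a window -/

/-- The pairs `i < j` of elements of `Fin n`. -/
def pairs (n : ℕ) : Finset (Fin n × Fin n) := Finset.univ.filter fun e => e.1 < e.2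

theorem mem_pairs {n : ℕ} {e : Fin n × Fin n} : e ∈ pairs n ↔ e.1 < e.2 := by simp [pairs]

theorem Finset.prod_ite_mem_of_subset {κ : Type*} [DecidableEq κ] {T S : Finset κ} (h : T ⊆ S)
    (a b : κ → ℝ) :
    (∏ k ∈ S, if k ∈ T then a k else b k) = (∏ k ∈ T, a k) * ∏ k ∈ S \ T, b k := by
  rw [← Finset.prod_sdiff h, mul_comm]
  congr 1
  · exact Finset.prod_congr rfl fun k hk => if_pos hk
  · exact Finset.prod_congr rfl fun k hk => if_neg (Finset.mem_sdiff.1 hk).2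

theorem Finset.sum_powerset_prod_ite {κ : Type*} [DecidableEq κ] (S : Finset κ) (a b : κ → ℝ) :
    ∑ T ∈ S.powerset, (∏ k ∈ S, if k ∈ T then a k else b k) = ∏ k ∈ S, (a k + b k) := by
  rw [Finset.prod_add]
  exact Finset.sum_congr rfl fun T hT => Finset.prod_ite_mem_of_subset (Finset.mem_powerset.1 hT) _ _

section Config

variable {d : ℕ} {M : Type*}

/-- The conditional probability that the set of edges between the points `x` is `T`. -/
def patternWeight (p : Pos d × M → Pos d × M → ℝ) {n : ℕ} (x : Fin n → Pos d × M)
    (T : Finset (Fin n × Fin n)) : ℝ :=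
  ∏ e ∈ pairs n, if e ∈ T then p (x e.1) (x e.2) else 1 - p (x e.1) (x e.2)

/-- The conditional probability, given the points `x`, of the property `Q` of the graph. -/
def configProb (p : Pos d × M → Pos d × M → ℝ)
    (Q : ∀ n, (Fin n → Pos d × M) → Finset (Fin n × Fin n) → Prop) (n : ℕ)
    (x : Fin n → Pos d × M) : ℝ≥0∞ :=
  ∑ T ∈ (pairs n).powerset,
    {y | Q n y T}.indicator (fun y => ENNReal.ofReal (patternWeight p y T)) x

variable {p : Pos d × M → Pos d × M → ℝ}

theorem patternWeight_nonneg (hp : ∀ x y, p x y ∈ Icc (0 : ℝ) 1) {n : ℕ}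
    (x : Fin n → Pos d × M) (T : Finset (Fin n × Fin n)) : 0 ≤ patternWeight p x T := by
  refine Finset.prod_nonneg fun e _ => ?_
  split_ifs
  · exact (hp _ _).1
  · exact sub_nonneg.2 (hp _ _).2

theorem sum_patternWeight (p : Pos d × M → Pos d × M → ℝ) {n : ℕ} (x : Fin n → Pos d × M) :
    ∑ T ∈ (pairs n).powerset, patternWeight p x T = 1 := by
  unfold patternWeight
  rw [Finset.sum_powerset_prod_ite]
  exact Finset.prod_eq_one fun e _ => by ring

theorem configProb_le_one (hp : ∀ x y, p x y ∈ Icc (0 : ℝ) 1)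
    (Q : ∀ n, (Fin n → Pos d × M) → Finset (Fin n × Fin n) → Prop) (n : ℕ)
    (x : Fin n → Pos d × M) : configProb p Q n x ≤ 1 := by
  calc configProb p Q n x
      ≤ ∑ T ∈ (pairs n).powerset, ENNReal.ofReal (patternWeight p x T) :=
        Finset.sum_le_sum fun T _ => indicator_le_self' (fun _ _ => zero_le) x
    _ = 1 := by
        rw [← ENNReal.ofReal_sum_of_nonneg fun T _ => patternWeight_nonneg hp x T,
          sum_patternWeight, ENNReal.ofReal_one]

theorem measurable_patternWeight [MeasurableSpace M] (hp : Measurable (Function.uncurry p))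
    {n : ℕ} (T : Finset (Fin n × Fin n)) :
    Measurable fun x : Fin n → Pos d × M => patternWeight p x T := by
  have : ∀ e : Fin n × Fin n, Measurable fun x : Fin n → Pos d × M => p (x e.1) (x e.2) :=
    fun e => hp.comp (f := fun x : Fin n → Pos d × M => (x e.1, x e.2))
      ((measurable_pi_apply e.1).prodMk (measurable_pi_apply e.2))
  refine Finset.measurable_prod _ fun e _ => ?_
  split_ifs
  · exact this e
  · exact (this e).const_sub 1

theorem measurable_configProb [MeasurableSpace M] (hp : Measurable (Function.uncurry p))
    {Q : ∀ n, (Fin n → Pos d × M) → Finset (Fin n × Fin n) → Prop}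
    (hQ : ∀ n T, MeasurableSet {x | Q n x T}) (n : ℕ) : Measurable (configProb p Q n) :=
  Finset.measurable_sum _ fun T _ =>
    ((measurable_patternWeight hp T).ennreal_ofReal).indicator (hQ n T)

/-- The probability of an event described by the property `Q` of the graph in a window. -/
def eventProb (kind : VertexKind) (l : ℝ) [MeasurableSpace M] (ν : Measure M)
    (p : Pos d × M → Pos d × M → ℝ) (W : Set (Pos d))
    (Q : ∀ n, (Fin n → Pos d × M) → Finset (Fin n × Fin n) → Prop) : ℝ≥0∞ :=
  ∑' n : ℕ, (n.factorial : ℝ≥0∞)⁻¹ * janossyIntegral kind l ν W n (configProb p Q n)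

end Config

/-- A finite set with n elements has n! enumerations by `Fin n`, and none by another number of
labels. -/
theorem tsum_embedding_range_eq {s : Set ℕ} (hs : s.Finite) (n : ℕ) :
    ∑' t : Fin n ↪ ℕ, {t : Fin n ↪ ℕ | s = range t}.indicator (fun _ => (1 : ℝ≥0∞)) t =
      if n = hs.toFinset.card then (n.factorial : ℝ≥0∞) else 0 := by
  have hcard : ∀ t : Fin n ↪ ℕ, s = range t → n = hs.toFinset.card := by
    intro t ht
    have : hs.toFinset = Finset.univ.map t := by
      ext i
      simp [ht]
    rw [this, Finset.card_map, Finset.card_univ, Fintype.card_fin]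
  split_ifs with hn
  · rw [← tsum_subtype {t : Fin n ↪ ℕ | s = range t} fun _ => (1 : ℝ≥0∞), ENNReal.tsum_set_one]
    have : Fintype s := hs.fintype
    have hcs : Fintype.card s = n := by rw [hn, ← Set.toFinset_card, hs.toFinset_eq_toFinset]
    have e : {t : Fin n ↪ ℕ | s = range t} ≃ (Fin n ≃ s) :=
      { toFun := fun t => (Equiv.ofInjective t.1 t.1.injective).trans
          (Equiv.setCongr (show range t.1 = s from t.2.symm))
        invFun := fun f => ⟨f.toEmbedding.trans (Function.Embedding.subtype _), by
          change s = range (Subtype.val ∘ f)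
          rw [range_comp, f.surjective.range_eq, image_univ, Subtype.range_coe]⟩
        left_inv := fun t => by ext i; rfl
        right_inv := fun f => by ext i; rfl }
    have h2 : Nat.card {t : Fin n ↪ ℕ | s = range t} = n.factorial := by
      classical
      rw [Nat.card_congr e, Nat.card_eq_fintype_card, Fintype.card_equiv
        (Fintype.equivOfCardEq (by rw [Fintype.card_fin, hcs])), Fintype.card_fin]
    have : Finite {t : Fin n ↪ ℕ | s = range t} := Finite.of_equiv _ e.symm
    rw [Set.encard, ENat.card_eq_coe_natCard, h2]
    simp
  · rw [ENNReal.tsum_eq_zero]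
    intro t
    refine indicator_of_notMem (s := {t : Fin n ↪ ℕ | s = range t}) ?_ _
    exact fun ht => hn (hcard t ht)

/-- A partition of unity over the labellings: the factor 1 / n! compensates the arbitrary order of
the points. -/
theorem tsum_labelling_eq_one {s : Set ℕ} (hs : s.Finite) :
    ∑' n : ℕ, (n.factorial : ℝ≥0∞)⁻¹ *
      ∑' t : Fin n ↪ ℕ, {t : Fin n ↪ ℕ | s = range t}.indicator (fun _ => (1 : ℝ≥0∞)) t = 1 := by
  simp only [tsum_embedding_range_eq hs]
  rw [tsum_eq_single hs.toFinset.card]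
  · rw [if_pos rfl]
    refine ENNReal.inv_mul_cancel ?_ (ENNReal.natCast_ne_top _)
    exact_mod_cast Nat.factorial_ne_zero _
  · intro n hn
    rw [if_neg hn, mul_zero]

namespace RandomGraph

variable {Ω : Type*} {d : ℕ} {M : Type*} (G : RandomGraph Ω d M)

open Classical in
/-- The pairs of indices that are edges between the labelled vertices. -/
def edgePattern {n : ℕ} (t : Fin n → ℕ) (ω : Ω) : Finset (Fin n × Fin n) :=
  (pairs n).filter fun e => (G.graph ω).Adj (t e.1) (t e.2)

/-- The event `Ev` is the property `Q` of the graph in the window `W`. -/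
def Encodes (W : Set (Pos d)) (Ev : Set Ω)
    (Q : ∀ n, (Fin n → Pos d × M) → Finset (Fin n × Fin n) → Prop) : Prop :=
  ∀ ω n (t : Fin n ↪ ℕ), G.idx (window M W) ω = range t →
    (ω ∈ Ev ↔ Q n (G.points t ω) (G.edgePattern t ω))

/-- The conditional edge law applies to events measurable for the σ-algebra of the vertices. This
lets the measurability lemmas be reused for that smaller σ-algebra. -/
theorem measurableVertices_vertexSigma [MeasurableSpace M] :
    @MeasurableVertices Ω d M G G.vertexSigma _ := by
  refine @MeasurableVertices.mk Ω d M G G.vertexSigma _ (fun i => ?_) fun i => ?_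
  · have : MeasurableSpace.generateFrom {{ω | i ∈ G.occ ω}} ≤ G.vertexSigma :=
      le_sup_right.trans (le_iSup (fun i : ℕ => MeasurableSpace.comap (G.vertex i) inferInstance ⊔
        MeasurableSpace.generateFrom {{ω | i ∈ G.occ ω}}) i)
    exact this _ (MeasurableSpace.measurableSet_generateFrom rfl)
  · have : MeasurableSpace.comap (G.vertex i) inferInstance ≤ G.vertexSigma :=
      le_sup_left.trans (le_iSup (fun i : ℕ => MeasurableSpace.comap (G.vertex i) inferInstance ⊔
        MeasurableSpace.generateFrom {{ω | i ∈ G.occ ω}}) i)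
    exact measurable_iff_comap_le.2 this

end RandomGraph

theorem RandomGraph.labelled_inter_events_eq {Ω : Type*} {d : ℕ} {M : Type*}
    {G : RandomGraph Ω d M} {U U' : Set (Pos d)} {Ev Ev' : Set Ω}
    {Q Q' : ∀ n, (Fin n → Pos d × M) → Finset (Fin n × Fin n) → Prop}
    (hEv : G.Encodes U Ev Q) (hEv' : G.Encodes U' Ev' Q') {n n' : ℕ}
    (t : Fin n ↪ ℕ) (t' : Fin n' ↪ ℕ) :
    {ω | G.idx (window M U) ω = range t} ∩ {ω | G.idx (window M U') ω = range t'} ∩ (Ev ∩ Ev') =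
      ⋃ q ∈ (pairs n).powerset ×ˢ (pairs n').powerset,
        ({ω | G.idx (window M U) ω = range t} ∩ {ω | G.idx (window M U') ω = range t'} ∩
          {ω | Q n (G.points t ω) q.1 ∧ Q' n' (G.points t' ω) q.2}) ∩
        {ω | G.edgePattern t ω = q.1 ∧ G.edgePattern t' ω = q.2} := by
  classical
  ext ω
  simp only [mem_inter_iff, mem_ofPred_eq, mem_iUnion, Finset.mem_product, Finset.mem_powerset,
    exists_prop, Prod.exists]
  constructor
  · rintro ⟨⟨h1, h2⟩, h3, h4⟩
    exact ⟨G.edgePattern t ω, G.edgePattern t' ω,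
      ⟨Finset.filter_subset _ _, Finset.filter_subset _ _⟩,
      ⟨⟨h1, h2⟩, (hEv ω n t h1).1 h3, (hEv' ω n' t' h2).1 h4⟩, rfl, rfl⟩
  · rintro ⟨T, T', -, ⟨⟨h1, h2⟩, h3, h4⟩, rfl, rfl⟩
    exact ⟨⟨h1, h2⟩, (hEv ω n t h1).2 h3, (hEv' ω n' t' h2).2 h4⟩

namespace IndependentSetting

variable {kind : VertexKind} {Ω : Type*} [MeasurableSpace Ω] {d : ℕ}
    {M : Type*} [MeasurableSpace M] {l : ℝ} {ν : Measure M}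
    {p : Pos d × M → Pos d × M → ℝ} {P : Measure Ω} {G : RandomGraph Ω d M}

/-- Labels in the two windows are different, so all pairs inside either window form one family of
distinct pairs. Their edges are conditionally independent, and the product splits into the two
windows. -/
theorem measure_labelled_pattern (h : IndependentSetting kind l ν p P G)
    (hp : IsConnectionFunction kind p) {n n' : ℕ} (t : Fin n ↪ ℕ) (t' : Fin n' ↪ ℕ)
    (hd : ∀ i j, t i ≠ t' j) {A : Set Ω} (hA : MeasurableSet[G.vertexSigma] A)
    (ht : ∀ ω ∈ A, ∀ i, t i ∈ G.occ ω) (ht' : ∀ ω ∈ A, ∀ i, t' i ∈ G.occ ω)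
    {T : Finset (Fin n × Fin n)} {T' : Finset (Fin n' × Fin n')} (hT : T ⊆ pairs n)
    (hT' : T' ⊆ pairs n') :
    P (A ∩ {ω | G.edgePattern t ω = T ∧ G.edgePattern t' ω = T'}) =
      ∫⁻ ω in A, ENNReal.ofReal (patternWeight p (G.points t ω) T) *
        ENNReal.ofReal (patternWeight p (G.points t' ω) T') ∂P := by
  classical
  set u : (Fin n × Fin n) ⊕ (Fin n' × Fin n') → ℕ := Sum.elim (fun e => t e.1) fun e => t' e.1
    with hu
  set v : (Fin n × Fin n) ⊕ (Fin n' × Fin n') → ℕ := Sum.elim (fun e => t e.2) fun e => t' e.2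
    with hv
  have hsub : T.disjSum T' ⊆ (pairs n).disjSum (pairs n') := Finset.disjSum_mono hT hT'
  have key := h.measure_adj_iff hp hA hsub u v ?_ ?_
  · have hset : {ω | ∀ k ∈ (pairs n).disjSum (pairs n'),
        (G.graph ω).Adj (u k) (v k) ↔ k ∈ T.disjSum T'} =
        {ω | G.edgePattern t ω = T ∧ G.edgePattern t' ω = T'} := by
      have haux : ∀ {m : ℕ} (s : Fin m ↪ ℕ) (R : Finset (Fin m × Fin m)) (_ : R ⊆ pairs m) (ω : Ω),
          G.edgePattern s ω = R ↔
            ∀ e ∈ pairs m, (G.graph ω).Adj (s e.1) (s e.2) ↔ e ∈ R := by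
        intro m s R hR ω
        rw [Finset.ext_iff]
        simp only [edgePattern, Finset.mem_filter]
        exact ⟨fun H e he => ⟨fun ha => (H e).1 ⟨he, ha⟩, fun hr => ((H e).2 hr).2⟩,
          fun H e => ⟨fun ha => (H e ha.1).1 ha.2, fun hr => ⟨hR hr, (H e (hR hr)).2 hr⟩⟩⟩
      ext ω
      simp only [mem_ofPred_eq, haux t T hT, haux t' T' hT', Sum.forall, Finset.inl_mem_disjSum,
        Finset.inr_mem_disjSum, hu, hv, Sum.elim_inl, Sum.elim_inr]
    rw [← hset, key]
    have hAm : MeasurableSet A := vertexSigma_le h.measurableVertices _ hA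
    refine setLIntegral_congr_fun hAm fun ω hω => ?_
    rw [← ENNReal.ofReal_mul (patternWeight_nonneg hp.mem_unit _ _), Finset.prod_disjSum]
    have e1 : ∀ i j, G.edgeProb p (t i) (t j) ω = p (G.points t ω i) (G.points t ω j) :=
      fun i j => if_pos ⟨ht ω hω i, ht ω hω j⟩
    have e2 : ∀ i j, G.edgeProb p (t' i) (t' j) ω = p (G.points t' ω i) (G.points t' ω j) :=
      fun i j => if_pos ⟨ht' ω hω i, ht' ω hω j⟩
    simp only [Finset.inl_mem_disjSum, Finset.inr_mem_disjSum, hu, hv, Sum.elim_inl, Sum.elim_inr,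
      e1, e2, patternWeight]
  · rintro (e | e) he hne
    · exact (mem_pairs.1 (Finset.inl_mem_disjSum.1 he)).ne (t.injective hne)
    · exact (mem_pairs.1 (Finset.inr_mem_disjSum.1 he)).ne (t'.injective hne)
  · have haux : ∀ {m : ℕ} (s : Fin m ↪ ℕ) (e e' : Fin m × Fin m), e ∈ pairs m → e' ∈ pairs m →
        s(s e.1, s e.2) = s(s e'.1, s e'.2) → e = e' := by
      intro m s e e' he he' hee
      rw [Sym2.eq_iff, s.apply_eq_iff_eq, s.apply_eq_iff_eq, s.apply_eq_iff_eq,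
        s.apply_eq_iff_eq] at hee
      rcases hee with ⟨h1, h2⟩ | ⟨h1, h2⟩
      · exact Prod.ext h1 h2
      · rw [mem_pairs] at he he'
        rw [h1, h2] at he
        exact absurd he he'.asymm
    rintro (e | e) he (e' | e') he' hee
    · rw [haux t e e' (Finset.inl_mem_disjSum.1 he) (Finset.inl_mem_disjSum.1 he') hee]
    · rw [Sym2.eq_iff] at hee
      rcases hee with ⟨h1, -⟩ | ⟨h1, -⟩
      exacts [absurd h1 (hd _ _), absurd h1 (hd _ _)]
    · rw [Sym2.eq_iff] at hee
      rcases hee with ⟨h1, -⟩ | ⟨h1, -⟩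
      exacts [absurd h1.symm (hd _ _), absurd h1.symm (hd _ _)]
    · rw [haux t' e e' (Finset.inr_mem_disjSum.1 he) (Finset.inr_mem_disjSum.1 he') hee]

theorem measurableSet_edgePattern_eq (h : IndependentSetting kind l ν p P G) {n : ℕ}
    (t : Fin n → ℕ) (T : Finset (Fin n × Fin n)) :
    MeasurableSet {ω | G.edgePattern t ω = T} := by
  classical
  have : {ω | G.edgePattern t ω = T} =
      ⋂ e : Fin n × Fin n, {ω | (e ∈ pairs n ∧ (G.graph ω).Adj (t e.1) (t e.2)) ↔ e ∈ T} := by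
    ext ω
    simp [edgePattern, Finset.ext_iff]
  rw [this]
  refine MeasurableSet.iInter fun e => ?_
  by_cases he : e ∈ pairs n
  · by_cases heT : e ∈ T
    · simpa [he, heT] using h.measurable_adj (t e.1) (t e.2)
    · simp only [he, heT, true_and, iff_false]
      exact (h.measurable_adj (t e.1) (t e.2)).compl
  · by_cases heT : e ∈ T <;> simp [he, heT]

theorem measurableSet_labelled_inter_events (h : IndependentSetting kind l ν p P G)
    {U U' : Set (Pos d)} (hU : MeasurableSet U) (hU' : MeasurableSet U') {Ev Ev' : Set Ω}
    {Q Q' : ∀ n, (Fin n → Pos d × M) → Finset (Fin n × Fin n) → Prop}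
    (hQ : ∀ n T, MeasurableSet {x | Q n x T}) (hQ' : ∀ n T, MeasurableSet {x | Q' n x T})
    (hEv : G.Encodes U Ev Q) (hEv' : G.Encodes U' Ev' Q') {n n' : ℕ}
    (t : Fin n ↪ ℕ) (t' : Fin n' ↪ ℕ) :
    MeasurableSet ({ω | G.idx (window M U) ω = range t} ∩
      {ω | G.idx (window M U') ω = range t'} ∩ (Ev ∩ Ev')) := by
  have hG := h.measurableVertices
  rw [labelled_inter_events_eq hEv hEv']
  refine Finset.measurableSet_biUnion _ fun q _ => ?_
  refine MeasurableSet.inter (((measurableSet_idx_eq hG (measurableSet_window M hU) _).inter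
    (measurableSet_idx_eq hG (measurableSet_window M hU') _)).inter ?_) ?_
  · exact (measurable_points hG t (hQ n q.1)).inter (measurable_points hG t' (hQ' n' q.2))
  · exact (h.measurableSet_edgePattern_eq t q.1).inter (h.measurableSet_edgePattern_eq t' q.2)

/-- For fixed labels only finitely many edge patterns are possible. Summing the conditional pattern
probabilities over those that realise the properties yields the two conditional probabilities. -/
theorem measure_labelled_inter_events (h : IndependentSetting kind l ν p P G)
    (hp : IsConnectionFunction kind p)
    {U U' : Set (Pos d)} (hU : MeasurableSet U) (hU' : MeasurableSet U') (hd : Disjoint U U')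
    {Ev Ev' : Set Ω}
    {Q Q' : ∀ n, (Fin n → Pos d × M) → Finset (Fin n × Fin n) → Prop}
    (hQ : ∀ n T, MeasurableSet {x | Q n x T}) (hQ' : ∀ n T, MeasurableSet {x | Q' n x T})
    (hEv : G.Encodes U Ev Q) (hEv' : G.Encodes U' Ev' Q') {n n' : ℕ}
    (t : Fin n ↪ ℕ) (t' : Fin n' ↪ ℕ) :
    P ({ω | G.idx (window M U) ω = range t} ∩
      {ω | G.idx (window M U') ω = range t'} ∩ (Ev ∩ Ev')) =
    ∫⁻ ω in {ω | G.idx (window M U) ω = range t} ∩ {ω | G.idx (window M U') ω = range t'},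
      configProb p Q n (G.points t ω) * configProb p Q' n' (G.points t' ω) ∂P := by
  classical
  have hG := h.measurableVertices
  have hGσ := G.measurableVertices_vertexSigma
  set A := {ω | G.idx (window M U) ω = range t} ∩ {ω | G.idx (window M U') ω = range t'} with hA
  -- A single ω in `A` suffices to see that the two labellings share no index, since the windows are
  -- disjoint. Without such an ω both sides vanish.
  rcases A.eq_empty_or_nonempty with h0 | ⟨ω₀, h1, h2⟩
  · rw [h0]; simp
  have hdt : ∀ i j, t i ≠ t' j := by
    intro i j hij
    have m1 : t i ∈ G.idx (window M U) ω₀ := by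
      rw [show G.idx (window M U) ω₀ = range t from h1]; exact mem_range_self i
    have m2 : t i ∈ G.idx (window M U') ω₀ := by
      rw [show G.idx (window M U') ω₀ = range t' from h2, hij]; exact mem_range_self j
    exact disjoint_left.1 hd m1.2 m2.2
  have hocc : ∀ ω ∈ A, ∀ i, t i ∈ G.occ ω := fun ω hω i =>
    (show t i ∈ G.idx (window M U) ω by
      rw [show G.idx (window M U) ω = range t from hω.1]; exact mem_range_self i).1
  have hocc' : ∀ ω ∈ A, ∀ i, t' i ∈ G.occ ω := fun ω hω i =>
    (show t' i ∈ G.idx (window M U') ω by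
      rw [show G.idx (window M U') ω = range t' from hω.2]; exact mem_range_self i).1
  have hAσ : MeasurableSet[G.vertexSigma] A :=
    @MeasurableSet.inter _ G.vertexSigma _ _
      (@measurableSet_idx_eq Ω d M G G.vertexSigma _ hGσ _ (measurableSet_window M hU) _)
      (@measurableSet_idx_eq Ω d M G G.vertexSigma _ hGσ _ (measurableSet_window M hU') _)
  have hQσ : ∀ (q : Finset (Fin n × Fin n) × Finset (Fin n' × Fin n')),
      MeasurableSet[G.vertexSigma]
        {ω | Q n (G.points t ω) q.1 ∧ Q' n' (G.points t' ω) q.2} := fun q =>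
    @MeasurableSet.inter _ G.vertexSigma _ _
      (@measurable_points Ω d M G G.vertexSigma _ hGσ _ t _ (hQ n q.1))
      (@measurable_points Ω d M G G.vertexSigma _ hGσ _ t' _ (hQ' n' q.2))
  have hle := vertexSigma_le hG
  rw [hA, labelled_inter_events_eq hEv hEv', ← hA, measure_biUnion_finset]
  · have e1 : ∀ q ∈ (pairs n).powerset ×ˢ (pairs n').powerset,
        P (A ∩ {ω | Q n (G.points t ω) q.1 ∧ Q' n' (G.points t' ω) q.2} ∩
          {ω | G.edgePattern t ω = q.1 ∧ G.edgePattern t' ω = q.2}) =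
        ∫⁻ ω in A, {y | Q n y q.1}.indicator (fun y => ENNReal.ofReal (patternWeight p y q.1))
            (G.points t ω) *
          {y | Q' n' y q.2}.indicator (fun y => ENNReal.ofReal (patternWeight p y q.2))
            (G.points t' ω) ∂P := by
      intro q hq
      rw [Finset.mem_product, Finset.mem_powerset, Finset.mem_powerset] at hq
      rw [h.measure_labelled_pattern hp t t' hdt
        (@MeasurableSet.inter _ G.vertexSigma _ _ hAσ (hQσ q))
        (fun ω hω => hocc ω hω.1) (fun ω hω => hocc' ω hω.1) hq.1 hq.2, inter_comm,
        ← Measure.restrict_restrict (hle _ (hQσ q)), ← lintegral_indicator (hle _ (hQσ q))]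
      congr 1 with ω
      by_cases hq1 : Q n (G.points t ω) q.1 <;> by_cases hq2 : Q' n' (G.points t' ω) q.2 <;>
        simp [indicator, hq1, hq2]
    rw [Finset.sum_congr rfl e1, ← lintegral_finsetSum]
    · congr 1 with ω
      rw [configProb, configProb, Finset.sum_mul_sum, Finset.sum_product]
    · intro q _
      refine Measurable.mul ?_ ?_
      · exact (((measurable_patternWeight hp.measurable q.1).ennreal_ofReal).indicator
          (hQ n q.1)).comp (measurable_points hG t)
      · exact (((measurable_patternWeight hp.measurable q.2).ennreal_ofReal).indicator
          (hQ' n' q.2)).comp (measurable_points hG t')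
  · intro q _ q' _ hqq
    refine disjoint_left.2 ?_
    rintro ω ⟨-, h3⟩ ⟨-, h4⟩
    exact hqq (Prod.ext (h3.1.symm.trans h4.1) (h3.2.symm.trans h4.2))
  · intro q _
    exact ((hle _ hAσ).inter (hle _ (hQσ q))).inter
      ((h.measurableSet_edgePattern_eq t q.1).inter (h.measurableSet_edgePattern_eq t' q.2))

variable [IsProbabilityMeasure ν]

/-- Events that depend on the graph in disjoint windows are independent. -/
theorem measure_inter_events (h : IndependentSetting kind l ν p P G)
    (hp : IsConnectionFunction kind p) (hl : l ∈ kind.intensities)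
    {U U' : Set (Pos d)} (hU : MeasurableSet U) (hb : Bornology.IsBounded U)
    (hU' : MeasurableSet U') (hb' : Bornology.IsBounded U') (hd : Disjoint U U')
    {Ev Ev' : Set Ω}
    {Q Q' : ∀ n, (Fin n → Pos d × M) → Finset (Fin n × Fin n) → Prop}
    (hQ : ∀ n T, MeasurableSet {x | Q n x T}) (hQ' : ∀ n T, MeasurableSet {x | Q' n x T})
    (hEv : G.Encodes U Ev Q) (hEv' : G.Encodes U' Ev' Q') :
    P (Ev ∩ Ev') = eventProb kind l ν p U Q * eventProb kind l ν p U' Q' := by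
  have hG := h.measurableVertices
  have hce : ∀ n, Countable (Fin n ↪ ℕ) := fun n => countable_embedding_nat (Fin n)
  set A : ∀ n, (Fin n ↪ ℕ) → Set Ω := fun n t => {ω | G.idx (window M U) ω = range t} with hA
  set A' : ∀ n, (Fin n ↪ ℕ) → Set Ω := fun n t => {ω | G.idx (window M U') ω = range t} with hA'
  have hAm : ∀ n t, MeasurableSet (A n t) := fun n t =>
    measurableSet_idx_eq hG (measurableSet_window M hU) _
  have hAm' : ∀ n t, MeasurableSet (A' n t) := fun n t =>
    measurableSet_idx_eq hG (measurableSet_window M hU') _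
  -- `Encodes` says nothing when a window contains infinitely many vertices. The event is replaced
  -- by a measurable set that equals it almost surely.
  set H : Set Ω := ⋃ n : ℕ, ⋃ n' : ℕ, ⋃ t : Fin n ↪ ℕ, ⋃ t' : Fin n' ↪ ℕ,
    A n t ∩ A' n' t' ∩ (Ev ∩ Ev') with hH
  have hHm : MeasurableSet H :=
    MeasurableSet.iUnion fun n => MeasurableSet.iUnion fun n' => MeasurableSet.iUnion fun t =>
      MeasurableSet.iUnion fun t' =>
        h.measurableSet_labelled_inter_events hU hU' hQ hQ' hEv hEv' t t'
  have hlab : ∀ s : Set ℕ, s.Finite → ∃ (n : ℕ) (t : Fin n ↪ ℕ), s = range t := by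
    intro s hs
    refine ⟨hs.toFinset.card, (hs.toFinset.orderEmbOfFin rfl).toEmbedding, ?_⟩
    have := Finset.range_orderEmbOfFin hs.toFinset rfl
    rw [Finite.coe_toFinset] at this
    exact this.symm
  have hEH : (Ev ∩ Ev' : Set Ω) =ᵐ[P] H := by
    filter_upwards [h.ae_finite hl hU hb, h.ae_finite hl hU' hb'] with ω h1 h2
    refine propext ⟨fun hω => ?_, fun hω => ?_⟩
    · obtain ⟨n, t, ht⟩ := hlab _ h1
      obtain ⟨n', t', ht'⟩ := hlab _ h2
      exact mem_iUnion.2 ⟨n, mem_iUnion.2 ⟨n', mem_iUnion.2 ⟨t, mem_iUnion.2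
        ⟨t', ⟨ht, ht'⟩, hω⟩⟩⟩⟩
    · obtain ⟨n, hω⟩ := mem_iUnion.1 hω
      obtain ⟨n', hω⟩ := mem_iUnion.1 hω
      obtain ⟨t, hω⟩ := mem_iUnion.1 hω
      obtain ⟨t', hω⟩ := mem_iUnion.1 hω
      exact hω.2
  have hAH : ∀ n t n' t', A n t ∩ A' n' t' ∩ H = A n t ∩ A' n' t' ∩ (Ev ∩ Ev') := by
    intro n t n' t'
    ext ω
    refine ⟨fun hω => ⟨hω.1, ?_⟩, fun hω => ⟨hω.1, mem_iUnion.2 ⟨n, mem_iUnion.2 ⟨n',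
      mem_iUnion.2 ⟨t, mem_iUnion.2 ⟨t', hω⟩⟩⟩⟩⟩⟩
    obtain ⟨m, h2⟩ := mem_iUnion.1 hω.2
    obtain ⟨m', h2⟩ := mem_iUnion.1 h2
    obtain ⟨s, h2⟩ := mem_iUnion.1 h2
    obtain ⟨s', h2⟩ := mem_iUnion.1 h2
    exact h2.2
  -- The labelling identity is inserted for both windows, which decomposes the event into pieces
  -- with fixed labels.
  have hone : ∀ᵐ ω ∂P, (1 : ℝ≥0∞) =
      ∑' n : ℕ, (n.factorial : ℝ≥0∞)⁻¹ * ∑' t : Fin n ↪ ℕ,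
      ∑' n' : ℕ, (n'.factorial : ℝ≥0∞)⁻¹ * ∑' t' : Fin n' ↪ ℕ,
        (A n t ∩ A' n' t').indicator (fun _ => (1 : ℝ≥0∞)) ω := by
    filter_upwards [h.ae_finite hl hU hb, h.ae_finite hl hU' hb'] with ω h1 h2
    have e : ∀ n t n' t', (A n t ∩ A' n' t').indicator (fun _ => (1 : ℝ≥0∞)) ω =
        {t : Fin n ↪ ℕ | G.idx (window M U) ω = range t}.indicator (fun _ => 1) t *
        {t : Fin n' ↪ ℕ | G.idx (window M U') ω = range t}.indicator (fun _ => 1) t' := by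
      intro n t n' t'
      by_cases q1 : G.idx (window M U) ω = range t <;>
        by_cases q2 : G.idx (window M U') ω = range t' <;> simp [indicator, hA, hA', q1, q2]
    simp only [e, ENNReal.tsum_mul_left, mul_left_comm _
      ({t : Fin _ ↪ ℕ | G.idx (window M U) ω = range t}.indicator (fun _ => (1 : ℝ≥0∞)) _),
      tsum_labelling_eq_one h2, mul_one]
    exact (tsum_labelling_eq_one h1).symm
  rw [measure_congr hEH]
  have hmi : ∀ n t n' t', Measurable ((A n t ∩ A' n' t').indicator fun _ => (1 : ℝ≥0∞)) :=
    fun n t n' t' => measurable_const.indicator ((hAm n t).inter (hAm' n' t'))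
  calc P H = ∫⁻ ω in H, 1 ∂P := by rw [setLIntegral_one]
    _ = ∫⁻ ω in H, ∑' n : ℕ, (n.factorial : ℝ≥0∞)⁻¹ * ∑' t : Fin n ↪ ℕ,
          ∑' n' : ℕ, (n'.factorial : ℝ≥0∞)⁻¹ * ∑' t' : Fin n' ↪ ℕ,
          (A n t ∩ A' n' t').indicator (fun _ => (1 : ℝ≥0∞)) ω ∂P :=
        lintegral_congr_ae (ae_restrict_of_ae hone)
    _ = ∑' n : ℕ, (n.factorial : ℝ≥0∞)⁻¹ * ∑' t : Fin n ↪ ℕ,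
          ∑' n' : ℕ, (n'.factorial : ℝ≥0∞)⁻¹ * ∑' t' : Fin n' ↪ ℕ,
          P (A n t ∩ A' n' t' ∩ (Ev ∩ Ev')) := by
        have m1 : ∀ n t n', Measurable fun ω => ∑' t' : Fin n' ↪ ℕ,
            (A n t ∩ A' n' t').indicator (fun _ => (1 : ℝ≥0∞)) ω :=
          fun n t n' => Measurable.tsum fun t' => hmi n t n' t'
        have m2 : ∀ n t, Measurable fun ω => ∑' n' : ℕ, (n'.factorial : ℝ≥0∞)⁻¹ *
            ∑' t' : Fin n' ↪ ℕ, (A n t ∩ A' n' t').indicator (fun _ => (1 : ℝ≥0∞)) ω :=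
          fun n t => Measurable.tsum fun n' => (m1 n t n').const_mul _
        have m3 : ∀ n : ℕ, Measurable fun ω => ∑' t : Fin n ↪ ℕ, ∑' n' : ℕ,
            (n'.factorial : ℝ≥0∞)⁻¹ *
            ∑' t' : Fin n' ↪ ℕ, (A n t ∩ A' n' t').indicator (fun _ => (1 : ℝ≥0∞)) ω :=
          fun n => Measurable.tsum fun t => m2 n t
        rw [lintegral_tsum fun n => ((m3 n).const_mul _).aemeasurable]
        congr 1 with n
        rw [lintegral_const_mul _ (m3 n), lintegral_tsum fun t => (m2 n t).aemeasurable]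
        congr 2 with t
        rw [lintegral_tsum fun n' => ((m1 n t n').const_mul _).aemeasurable]
        congr 1 with n'
        rw [lintegral_const_mul _ (m1 n t n'),
          lintegral_tsum fun t' => (hmi n t n' t').aemeasurable]
        congr 2 with t'
        rw [lintegral_indicator_const ((hAm n t).inter (hAm' n' t')), one_mul,
          Measure.restrict_apply ((hAm n t).inter (hAm' n' t')), hAH]
    _ = ∑' n : ℕ, (n.factorial : ℝ≥0∞)⁻¹ * ∑' n' : ℕ, (n'.factorial : ℝ≥0∞)⁻¹ *
          (janossyIntegral kind l ν U n (configProb p Q n) *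
            janossyIntegral kind l ν U' n' (configProb p Q' n')) := by
        congr 1 with n
        congr 1
        rw [ENNReal.tsum_comm]
        congr 1 with n'
        rw [ENNReal.tsum_mul_left]
        congr 1
        rw [← h.tsum_lintegral_labelled_mul hl hU hb hU' hb' hd n n'
          (measurable_configProb hp.measurable hQ n) (measurable_configProb hp.measurable hQ' n')
          (configProb_le_one hp.mem_unit Q n)]
        congr 1 with t
        congr 1 with t'
        exact h.measure_labelled_inter_events hp hU hU' hd hQ hQ' hEv hEv' t t'
    _ = eventProb kind l ν p U Q * eventProb kind l ν p U' Q' := by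
        rw [eventProb, eventProb, ← ENNReal.tsum_mul_right]
        congr 1 with n
        rw [← ENNReal.tsum_mul_left, ← ENNReal.tsum_mul_left]
        congr 1 with n'
        ring

/-- The probability of an event that depends on the graph in a window. -/
theorem measure_event (h : IndependentSetting kind l ν p P G)
    (hp : IsConnectionFunction kind p) (hl : l ∈ kind.intensities)
    {U : Set (Pos d)} (hU : MeasurableSet U) (hb : Bornology.IsBounded U) {Ev : Set Ω}
    {Q : ∀ n, (Fin n → Pos d × M) → Finset (Fin n × Fin n) → Prop}
    (hQ : ∀ n T, MeasurableSet {x | Q n x T}) (hEv : G.Encodes U Ev Q) :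
    P Ev = eventProb kind l ν p U Q := by
  have := h.prob
  -- The empty window serves as second window. The trivial event there has probability series equal
  -- to one, because its square is the probability of the whole space.
  have htriv : G.Encodes ∅ univ fun _ _ _ => True := fun _ _ _ _ => by simp
  have h1 := h.measure_inter_events hp hl MeasurableSet.empty Bornology.isBounded_empty
    MeasurableSet.empty Bornology.isBounded_empty (disjoint_empty _)
    (fun _ _ => MeasurableSet.const _) (fun _ _ => MeasurableSet.const _) htriv htriv
  have h2 := h.measure_inter_events hp hl hU hb
    MeasurableSet.empty Bornology.isBounded_empty (disjoint_empty _)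
    hQ (fun _ _ => MeasurableSet.const _) hEv htriv
  rw [inter_univ, measure_univ, ← sq] at h1
  rw [inter_univ] at h2
  have h3 : eventProb kind l ν p (∅ : Set (Pos d)) (fun _ _ _ => True) = 1 :=
    (ENNReal.pow_right_strictMono two_ne_zero).injective (by simpa using h1.symm)
  rw [h2, h3, mul_one]

end IndependentSetting

/-! ### Translation invariance -/

section Shift

variable {d : ℕ} {M : Type*}

/-- The shift of the locations of marked points. -/
def shiftLoc (M : Type*) (s : Pos d) (x : Pos d × M) : Pos d × M := (x.1 + s, x.2)

theorem latticePoint_add (z w : Fin d → ℤ) :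
    latticePoint (z + w) = latticePoint z + latticePoint w := by
  ext k; simp [latticePoint]

theorem latticePoint_mem_shifts (kind : VertexKind) (z : Fin d → ℤ) :
    latticePoint z ∈ kind.shifts d := by
  cases kind
  · trivial
  · exact ⟨z, rfl⟩

theorem measurePreserving_locMeasure (kind : VertexKind) (z : Fin d → ℤ) :
    MeasurePreserving (fun x : Pos d => x + latticePoint z) (kind.locMeasure d)
      (kind.locMeasure d) := by
  cases kind with
  | poisson => exact measurePreserving_add_right (volume : Measure (Pos d)) _
  | bernoulli =>
    have hm : Measurable fun x : Pos d => x + latticePoint z := measurable_add_const _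
    refine ⟨hm, ?_⟩
    ext S hS
    rw [Measure.map_apply hm hS, VertexKind.locMeasure, Measure.sum_apply _ hS,
      Measure.sum_apply _ (hm hS), ← (Equiv.addRight z).tsum_eq fun w =>
        Measure.dirac (latticePoint w) S]
    congr 1 with w
    rw [Measure.dirac_apply' _ hS, Measure.dirac_apply' _ (hm hS), Equiv.coe_addRight,
      latticePoint_add]
    rfl

instance sFinite_locMeasure (kind : VertexKind) : SFinite (kind.locMeasure d) := by
  cases kind
  · exact inferInstanceAs (SFinite (volume : Measure (Pos d)))
  · exact inferInstanceAs (SFinite (Measure.sum fun z : Fin d → ℤ =>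
      Measure.dirac (latticePoint z)))

theorem measurePreserving_shiftLoc [MeasurableSpace M] (kind : VertexKind) (ν : Measure M)
    [IsProbabilityMeasure ν] (z : Fin d → ℤ) {W : Set (Pos d)} (hW : MeasurableSet W) :
    MeasurePreserving (shiftLoc M (latticePoint z))
      (windowMeasure kind ν ((fun x => x + latticePoint z) ⁻¹' W)) (windowMeasure kind ν W) :=
  ((measurePreserving_locMeasure kind z).restrict_preimage hW).prod (MeasurePreserving.id ν)

/-- Shifting the window and the property by a lattice vector does not change probabilities. -/
theorem eventProb_shift [MeasurableSpace M] {kind : VertexKind} (l : ℝ) (ν : Measure M)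
    [IsProbabilityMeasure ν] {p : Pos d × M → Pos d × M → ℝ} (hp : IsConnectionFunction kind p)
    (z : Fin d → ℤ) {W W' : Set (Pos d)} (hW : MeasurableSet W) (hb : Bornology.IsBounded W)
    (hW' : MeasurableSet W') (hb' : Bornology.IsBounded W')
    (hWW : W = (fun x => x + latticePoint z) ⁻¹' W')
    {Q Q' : ∀ n, (Fin n → Pos d × M) → Finset (Fin n × Fin n) → Prop}
    (hQ' : ∀ n T, MeasurableSet {x | Q' n x T})
    (hQQ : ∀ n x T, Q' n (fun i => shiftLoc M (latticePoint z) (x i)) T ↔ Q n x T) :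
    eventProb kind l ν p W' Q' = eventProb kind l ν p W Q := by
  have := isFiniteMeasure_windowMeasure kind ν hW hb
  have := isFiniteMeasure_windowMeasure kind ν hW' hb'
  have hv : kind.locMeasure d W = kind.locMeasure d W' := by
    rw [hWW, (measurePreserving_locMeasure kind z).measure_preimage hW'.nullMeasurableSet]
  have hpres : MeasurePreserving (shiftLoc M (latticePoint z)) (windowMeasure kind ν W)
      (windowMeasure kind ν W') := by
    have := measurePreserving_shiftLoc kind ν z hW'
    rwa [← hWW] at this
  unfold eventProb janossyIntegral
  congr 1 with n
  rw [hv]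
  congr 2
  have hpi := measurePreserving_pi (fun _ : Fin n => windowMeasure kind ν W)
    (fun _ : Fin n => windowMeasure kind ν W') fun _ => hpres
  have hcp : ∀ x : Fin n → Pos d × M,
      configProb p Q' n (fun i => shiftLoc M (latticePoint z) (x i)) = configProb p Q n x := by
    intro x
    unfold configProb
    refine Finset.sum_congr rfl fun T _ => ?_
    have hw : patternWeight p (fun i => shiftLoc M (latticePoint z) (x i)) T =
        patternWeight p x T := by
      unfold patternWeight
      have : ∀ i j, p (shiftLoc M (latticePoint z) (x i)) (shiftLoc M (latticePoint z) (x j)) =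
          p (x i) (x j) := fun i j => hp.shift _ (latticePoint_mem_shifts kind z) (x i) (x j)
      simp only [this]
    by_cases hq : Q n x T
    · rw [indicator_of_mem (show x ∈ {y | Q n y T} from hq),
        indicator_of_mem (s := {y | Q' n y T}) (show _ ∈ {y | Q' n y T} from (hQQ n x T).2 hq), hw]
    · rw [indicator_of_notMem (show x ∉ {y | Q n y T} from hq),
        indicator_of_notMem (s := {y | Q' n y T})
          (show _ ∉ {y | Q' n y T} from fun h => hq ((hQQ n x T).1 h))]
  have hoff : (fun (x : Fin n → Pos d × M) i => shiftLoc M (latticePoint z) (x i)) ⁻¹'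
      distinctLoc (Fin n) d M = distinctLoc (Fin n) d M := by
    ext x
    change Function.Injective (fun i => (x i).1 + latticePoint z) ↔
      Function.Injective fun i => (x i).1
    exact (add_left_injective (latticePoint z)).of_comp_iff fun i => (x i).1
  rw [← hpi.setLIntegral_comp_preimage (measurableSet_distinctLoc (Fin n) d M)
    (measurable_configProb hp.measurable hQ' n), hoff]
  simp only [hcp]

theorem insertNth_mem_distinctLoc {n : ℕ} (j : Fin (n + 1)) (y : Pos d × M)
    (x : Fin n → Pos d × M) :
    (j.insertNth y x : Fin (n + 1) → Pos d × M) ∈ distinctLoc (Fin (n + 1)) d M ↔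
      x ∈ distinctLoc (Fin n) d M ∧ ∀ i, y.1 ≠ (x i).1 := by
  constructor
  · intro h
    refine ⟨fun a b hab => ?_, fun i hi => ?_⟩
    · refine Fin.succAbove_right_injective (p := j) (h ?_)
      simpa using hab
    · have : j = j.succAbove i := h (by simpa using hi)
      exact Fin.succAbove_ne j i this.symm
  · rintro ⟨h1, h2⟩ a b hab
    rcases Fin.eq_self_or_eq_succAbove j a with ha | ⟨i, rfl⟩ <;>
      rcases Fin.eq_self_or_eq_succAbove j b with hb | ⟨i', rfl⟩
    · rw [ha, hb]
    · exact absurd (by simpa [ha] using hab) (h2 i')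
    · exact absurd (by simpa [hb] using hab.symm) (h2 i)
    · rw [h1 (show (x i).1 = (x i').1 by simpa using hab)]

end Shift

/-! ### Integrating out one point -/

section Marginal

variable {d : ℕ} {M : Type*} [MeasurableSpace M]

/-- Positive dimension enters here: points of ℝ^d have volume zero only if d > 0. -/
theorem ae_locMeasure_singleton (kind : VertexKind) (hd : 0 < d) {W : Set (Pos d)}
    (hW : MeasurableSet W) :
    ∀ᵐ y ∂(kind.locMeasure d).restrict W,
      (kind.locMeasure d).restrict W {y} = kind.atomMass := by
  rw [ae_restrict_iff' hW]
  have : Nonempty (Fin d) := ⟨⟨0, hd⟩⟩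
  cases kind with
  | poisson =>
    refine ae_of_all _ fun y hy => ?_
    rw [VertexKind.atomMass, ← nonpos_iff_eq_zero]
    refine (Measure.restrict_apply_le _ _).trans ?_
    rw [VertexKind.locMeasure, measure_singleton]
  | bernoulli =>
    rw [VertexKind.locMeasure, Measure.ae_sum_iff]
    intro z
    rw [ae_dirac_eq]
    intro hz
    rw [Measure.restrict_apply (measurableSet_singleton _),
      inter_eq_left.2 (singleton_subset_iff.2 hz),
      Measure.sum_apply _ (measurableSet_singleton _), tsum_eq_single z]
    · simp [VertexKind.atomMass]
    · intro w hw
      rw [Measure.dirac_apply' _ (measurableSet_singleton _)]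
      simp [latticePoint_injective.eq_iff, hw]

/-- The mass of the part of the window that is available to a further point. -/
def freeMass (kind : VertexKind) (W : Set (Pos d)) (n : ℕ) : ℝ≥0∞ :=
  kind.locMeasure d W - n * kind.atomMass

theorem windowMeasure_avoid (kind : VertexKind) (ν : Measure M) [IsProbabilityMeasure ν]
    {W : Set (Pos d)} (hW : MeasurableSet W) (hb : Bornology.IsBounded W) {n : ℕ}
    {x : Fin n → Pos d × M} (hx : x ∈ distinctLoc (Fin n) d M)
    (hx' : ∀ i, (kind.locMeasure d).restrict W {(x i).1} = kind.atomMass) :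
    windowMeasure kind ν W {y | ∀ i, y.1 ≠ (x i).1} = freeMass kind W n := by
  have hfin : IsFiniteMeasure ((kind.locMeasure d).restrict W) :=
    ⟨by rw [Measure.restrict_apply_univ]; exact locMeasure_lt_top kind hW hb⟩
  have hset : {y : Pos d × M | ∀ i, y.1 ≠ (x i).1} =
      (⋃ i, {(x i).1})ᶜ ×ˢ (univ : Set M) := by
    ext y
    simp [eq_comm]
  have hm : MeasurableSet (⋃ i, {(x i).1} : Set (Pos d)) :=
    MeasurableSet.iUnion fun i => measurableSet_singleton _
  rw [hset, windowMeasure, Measure.prod_prod, measure_univ (μ := ν), mul_one,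
    measure_compl hm (measure_ne_top _ _), Measure.restrict_apply_univ, freeMass,
    measure_iUnion _ fun i => measurableSet_singleton _, tsum_fintype]
  · simp [hx']
  · intro i j hij
    simp only [Function.onFun, disjoint_singleton]
    exact fun h => hij (hx h)

/-- Once the other points are fixed, the remaining point may lie anywhere except at their locations.
The mass left for it depends only on their number, for almost every choice. -/
theorem lintegral_distinctLoc_succ (kind : VertexKind) (hd : 0 < d) (ν : Measure M)
    [IsProbabilityMeasure ν] {W : Set (Pos d)} (hW : MeasurableSet W)
    (hb : Bornology.IsBounded W) {n : ℕ} (j : Fin (n + 1)) {g : (Fin n → Pos d × M) → ℝ≥0∞}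
    (hg : Measurable g) :
    ∫⁻ x in distinctLoc (Fin (n + 1)) d M, g (fun i => x (j.succAbove i))
        ∂(Measure.pi fun _ => windowMeasure kind ν W) =
      freeMass kind W n *
        ∫⁻ x in distinctLoc (Fin n) d M, g x ∂(Measure.pi fun _ => windowMeasure kind ν W) := by
  have := isFiniteMeasure_windowMeasure kind ν hW hb
  set m := windowMeasure kind ν W with hm
  have ho := measurableSet_distinctLoc (Fin n) d M
  have ho' := measurableSet_distinctLoc (Fin (n + 1)) d M
  have hpres := (measurePreserving_piFinSuccAbove (fun _ : Fin (n + 1) => m) j).symm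
  have hgm : Measurable fun x : Fin (n + 1) → Pos d × M => g fun i => x (j.succAbove i) :=
    hg.comp (measurable_pi_lambda _ fun i => measurable_pi_apply _)
  have hF : Measurable ((distinctLoc (Fin (n + 1)) d M).indicator
      fun x => g fun i => x (j.succAbove i)) := hgm.indicator ho'
  rw [← lintegral_indicator ho', ← hpres.lintegral_comp hF, ← lintegral_indicator ho,
    ← lintegral_const_mul _ (hg.indicator ho)]
  -- The deleted point is integrated first, with the other points fixed.
  refine (lintegral_prod_symm _ (hF.comp hpres.measurable).aemeasurable).trans ?_
  have hae : ∀ᵐ x ∂(Measure.pi fun _ : Fin n => m),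
      ∀ i, (kind.locMeasure d).restrict W {(x i).1} = kind.atomMass := by
    rw [ae_all_iff]
    intro i
    have h1 : ∀ᵐ y ∂m, (kind.locMeasure d).restrict W {y.1} = kind.atomMass :=
      Measure.quasiMeasurePreserving_fst.ae (ae_locMeasure_singleton kind hd hW)
    exact (Measure.tendsto_eval_ae_ae (μ := fun _ : Fin n => m) (i := i)).eventually h1
  refine lintegral_congr_ae ?_
  filter_upwards [hae] with x hx
  have hval : ∀ y : Pos d × M, (distinctLoc (Fin (n + 1)) d M).indicator
      (fun x => g fun i => x (j.succAbove i)) (j.insertNth y x : Fin (n + 1) → Pos d × M) =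
      {y : Pos d × M | ∀ i, y.1 ≠ (x i).1}.indicator
        (fun _ => (distinctLoc (Fin n) d M).indicator g x) y := by
    intro y
    by_cases h1 : x ∈ distinctLoc (Fin n) d M <;> by_cases h2 : ∀ i, y.1 ≠ (x i).1
    · rw [indicator_of_mem ((insertNth_mem_distinctLoc j y x).2 ⟨h1, h2⟩),
        indicator_of_mem (show y ∈ {y : Pos d × M | ∀ i, y.1 ≠ (x i).1} from h2),
        indicator_of_mem h1]
      simp
    · rw [indicator_of_notMem fun h => h2 ((insertNth_mem_distinctLoc j y x).1 h).2,
        indicator_of_notMem (show y ∉ {y : Pos d × M | ∀ i, y.1 ≠ (x i).1} from h2)]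
    · rw [indicator_of_notMem fun h => h1 ((insertNth_mem_distinctLoc j y x).1 h).1,
        indicator_of_mem (show y ∈ {y : Pos d × M | ∀ i, y.1 ≠ (x i).1} from h2),
        indicator_of_notMem h1]
    · rw [indicator_of_notMem fun h => h2 ((insertNth_mem_distinctLoc j y x).1 h).2,
        indicator_of_notMem (show y ∉ {y : Pos d × M | ∀ i, y.1 ≠ (x i).1} from h2)]
  have hms : MeasurableSet {y : Pos d × M | ∀ i, y.1 ≠ (x i).1} := by
    have : {y : Pos d × M | ∀ i, y.1 ≠ (x i).1} = ⋂ i, (Prod.fst ⁻¹' {(x i).1})ᶜ := by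
      ext; simp
    rw [this]
    exact MeasurableSet.iInter fun i => (measurable_fst (measurableSet_singleton _)).compl
  calc ∫⁻ y, ((distinctLoc (Fin (n + 1)) d M).indicator
        fun x => g fun i => x (j.succAbove i))
          ((MeasurableEquiv.piFinSuccAbove (fun _ => Pos d × M) j).symm (y, x)) ∂m
      = ∫⁻ y, {y : Pos d × M | ∀ i, y.1 ≠ (x i).1}.indicator
        (fun _ => (distinctLoc (Fin n) d M).indicator g x) y ∂m :=
        lintegral_congr fun y => hval y
    _ = freeMass kind W n * (distinctLoc (Fin n) d M).indicator g x := by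
        rw [lintegral_indicator_const hms, mul_comm]
        by_cases h1 : x ∈ distinctLoc (Fin n) d M
        · rw [hm, windowMeasure_avoid kind ν hW hb h1 hx]
        · rw [indicator_of_notMem h1, mul_zero, mul_zero]

end Marginal

/-! ### Binomial thinning of the configuration series -/

section Binomial

/-- The probability that a binomial random variable with `k + j` trials equals `k`. -/
def binomialWeight (q : ℝ) (k j : ℕ) : ℝ := (k + j).choose k * q ^ k * (1 - q) ^ j

theorem binomialWeight_nonneg {q : ℝ} (hq : q ∈ Icc (0 : ℝ) 1) (k j : ℕ) :
    0 ≤ binomialWeight q k j :=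
  mul_nonneg (mul_nonneg (Nat.cast_nonneg _) (pow_nonneg hq.1 _))
    (pow_nonneg (sub_nonneg.2 hq.2) _)

theorem sum_binomialWeight (q : ℝ) (n : ℕ) :
    ∑ e ∈ Finset.HasAntidiagonal.antidiagonal n, binomialWeight q e.1 e.2 = 1 := by
  have h := add_pow q (1 - q) n
  rw [add_sub_cancel, one_pow] at h
  rw [Finset.Nat.sum_antidiagonal_eq_sum_range_succ fun k j => binomialWeight q k j, h]
  refine Finset.sum_congr rfl fun k hk => ?_
  rw [binomialWeight, Nat.add_sub_cancel' (Finset.mem_range_succ_iff.1 hk)]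
  ring

/-- The second factorial moment of the binomial law, the number of ordered pairs of surviving
points. It is the source of the factor q² in the comparison of intensities. -/
theorem sum_mul_binomialWeight (q : ℝ) (n : ℕ) :
    ∑ e ∈ Finset.HasAntidiagonal.antidiagonal n, ((e.1 * (e.1 - 1) : ℕ) : ℝ) * binomialWeight q e.1 e.2 =
      ((n * (n - 1) : ℕ) : ℝ) * q ^ 2 := by
  have h := congrArg (Polynomial.eval q) (bernsteinPolynomial.sum_mul_smul ℝ n)
  rw [Polynomial.eval_finsetSum] at h
  simp only [nsmul_eq_mul, Polynomial.eval_mul, Polynomial.eval_natCast, Polynomial.eval_pow,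
    Polynomial.eval_X] at h
  rw [Finset.Nat.sum_antidiagonal_eq_sum_range_succ
    fun k j => ((k * (k - 1) : ℕ) : ℝ) * binomialWeight q k j, ← h]
  refine Finset.sum_congr rfl fun k hk => ?_
  rw [binomialWeight, Nat.add_sub_cancel' (Finset.mem_range_succ_iff.1 hk), bernsteinPolynomial]
  simp

end Binomial

section Thinning

variable {I κ w w' : ℕ → ℝ≥0∞}

theorem prod_mul_le_of_succ (h1 : ∀ n, κ n * I n ≤ I (n + 1)) (k j : ℕ) :
    (∏ i ∈ Finset.range j, κ (k + i)) * I k ≤ I (k + j) := by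
  induction j with
  | zero => simp
  | succ j ih =>
    rw [Finset.prod_range_succ, mul_comm (∏ i ∈ Finset.range j, κ (k + i)), mul_assoc]
    exact (mul_le_mul_right ih _).trans (h1 (k + j))

/-- Divided by (n + 1) n (n - 1), the hypothesis says that I(n) / (n (n - 1)) grows at most by the
factor κ(n) in one step. For k ≤ 1 the left side vanishes. -/
theorem mul_le_prod_mul_of_succ
    (h2 : ∀ n, ((n - 1 : ℕ) : ℝ≥0∞) * I (n + 1) ≤ (n + 1 : ℕ) * (κ n * I n)) (k j : ℕ) :
    ((k * (k - 1) : ℕ) : ℝ≥0∞) * I (k + j) ≤ (((k + j) * (k + j - 1) : ℕ) : ℝ≥0∞) *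
      ((∏ i ∈ Finset.range j, κ (k + i)) * I k) := by
  by_cases hk : k ≤ 1
  · have : k * (k - 1) = 0 := by rcases Nat.le_one_iff_eq_zero_or_eq_one.1 hk with h | h <;> simp [h]
    rw [this]; simp
  induction j with
  | zero => simp
  | succ j ih =>
    set N := k + j with hN
    have hN1 : ((N - 1 : ℕ) : ℝ≥0∞) ≠ 0 := by
      have : N - 1 ≠ 0 := by omega
      exact_mod_cast this
    refine (ENNReal.mul_le_mul_iff_right hN1 (ENNReal.natCast_ne_top _)).1 ?_
    rw [Finset.prod_range_succ, ← add_assoc, ← hN]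
    calc ((N - 1 : ℕ) : ℝ≥0∞) * (((k * (k - 1) : ℕ) : ℝ≥0∞) * I (N + 1))
        = ((k * (k - 1) : ℕ) : ℝ≥0∞) * (((N - 1 : ℕ) : ℝ≥0∞) * I (N + 1)) := by ring
      _ ≤ ((k * (k - 1) : ℕ) : ℝ≥0∞) * ((N + 1 : ℕ) * (κ N * I N)) := mul_le_mul_right (h2 N) _
      _ = (N + 1 : ℕ) * κ N * (((k * (k - 1) : ℕ) : ℝ≥0∞) * I N) := by ring
      _ ≤ (N + 1 : ℕ) * κ N * (((N * (N - 1) : ℕ) : ℝ≥0∞) *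
          ((∏ i ∈ Finset.range j, κ (k + i)) * I k)) := by gcongr
      _ = _ := by
        rw [Nat.add_sub_cancel]
        push_cast
        ring

/-- The k surviving and j deleted points are regrouped by their total n = k + j, the number of
points before thinning. -/
theorem tsum_thinned
    (h3 : ∀ k, (k.factorial : ℝ≥0∞)⁻¹ * (w' k * I k) = ∑' j, ((k + j).factorial : ℝ≥0∞)⁻¹ *
      w (k + j) * (ENNReal.ofReal (binomialWeight q k j) *
        ((∏ i ∈ Finset.range j, κ (k + i)) * I k))) :
    ∑' k, (k.factorial : ℝ≥0∞)⁻¹ * (w' k * I k) =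
      ∑' n, (n.factorial : ℝ≥0∞)⁻¹ * w n * ∑ e ∈ Finset.HasAntidiagonal.antidiagonal n,
        ENNReal.ofReal (binomialWeight q e.1 e.2) *
          ((∏ i ∈ Finset.range e.2, κ (e.1 + i)) * I e.1) := by
  simp only [h3]
  rw [← ENNReal.tsum_prod (f := fun k j => ((k + j).factorial : ℝ≥0∞)⁻¹ *
      w (k + j) * (ENNReal.ofReal (binomialWeight q k j) *
        ((∏ i ∈ Finset.range j, κ (k + i)) * I k))),
    ← Finset.HasAntidiagonal.sigmaAntidiagonalEquivProd.tsum_eq, ENNReal.tsum_sigma']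
  congr 1 with n
  rw [tsum_fintype, Finset.mul_sum, ← Finset.sum_coe_sort (Finset.HasAntidiagonal.antidiagonal n)]
  refine Finset.sum_congr rfl fun e _ => ?_
  have := Finset.HasAntidiagonal.mem_antidiagonal.1 e.2
  simp only [Finset.HasAntidiagonal.sigmaAntidiagonalEquivProd_apply]
  rw [this]

/-- Each inner binomial average is at most I(n), since adding points only increases I. -/
theorem tsum_thinned_le {q : ℝ} (hq : q ∈ Icc (0 : ℝ) 1) (h1 : ∀ n, κ n * I n ≤ I (n + 1))
    (h3 : ∀ k, (k.factorial : ℝ≥0∞)⁻¹ * (w' k * I k) = ∑' j, ((k + j).factorial : ℝ≥0∞)⁻¹ *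
      w (k + j) * (ENNReal.ofReal (binomialWeight q k j) *
        ((∏ i ∈ Finset.range j, κ (k + i)) * I k))) :
    ∑' k, (k.factorial : ℝ≥0∞)⁻¹ * (w' k * I k) ≤ ∑' n, (n.factorial : ℝ≥0∞)⁻¹ * (w n * I n) := by
  rw [tsum_thinned h3]
  refine ENNReal.tsum_le_tsum fun n => ?_
  rw [mul_assoc]
  gcongr
  calc ∑ e ∈ Finset.HasAntidiagonal.antidiagonal n, ENNReal.ofReal (binomialWeight q e.1 e.2) *
          ((∏ i ∈ Finset.range e.2, κ (e.1 + i)) * I e.1)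
      ≤ ∑ e ∈ Finset.HasAntidiagonal.antidiagonal n, ENNReal.ofReal (binomialWeight q e.1 e.2) * I n := by
        refine Finset.sum_le_sum fun e he => ?_
        rw [← Finset.HasAntidiagonal.mem_antidiagonal.1 he]
        gcongr
        exact prod_mul_le_of_succ h1 e.1 e.2
    _ = I n := by
        rw [← Finset.sum_mul, ← ENNReal.ofReal_sum_of_nonneg fun e _ =>
          binomialWeight_nonneg hq e.1 e.2, sum_binomialWeight, ENNReal.ofReal_one, one_mul]

/-- At least the fraction k (k - 1) / (n (n - 1)) of I(n) is kept when k of n points survive, and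
the binomial mean of that fraction is q². -/
theorem le_tsum_thinned {q : ℝ} (hq : q ∈ Icc (0 : ℝ) 1) (h0 : I 0 = 0) (h0' : I 1 = 0)
    (h2 : ∀ n, ((n - 1 : ℕ) : ℝ≥0∞) * I (n + 1) ≤ (n + 1 : ℕ) * (κ n * I n))
    (h3 : ∀ k, (k.factorial : ℝ≥0∞)⁻¹ * (w' k * I k) = ∑' j, ((k + j).factorial : ℝ≥0∞)⁻¹ *
      w (k + j) * (ENNReal.ofReal (binomialWeight q k j) *
        ((∏ i ∈ Finset.range j, κ (k + i)) * I k))) :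
    ENNReal.ofReal (q ^ 2) * ∑' n, (n.factorial : ℝ≥0∞)⁻¹ * (w n * I n) ≤
      ∑' k, (k.factorial : ℝ≥0∞)⁻¹ * (w' k * I k) := by
  rw [tsum_thinned h3, ← ENNReal.tsum_mul_left]
  refine ENNReal.tsum_le_tsum fun n => ?_
  rw [← mul_assoc ((n.factorial : ℝ≥0∞)⁻¹), mul_left_comm]
  refine mul_le_mul_right ?_ _
  -- With fewer than two points there is no edge, and n (n - 1) could not be cancelled.
  rcases Nat.lt_or_ge n 2 with hn | hn
  · have : I n = 0 := by interval_cases n <;> assumption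
    rw [this, mul_zero]
    exact zero_le
  have hN : ((n * (n - 1) : ℕ) : ℝ≥0∞) ≠ 0 := by
    have : n * (n - 1) ≠ 0 := Nat.mul_ne_zero (by omega) (by omega)
    exact_mod_cast this
  refine (ENNReal.mul_le_mul_iff_right hN (ENNReal.natCast_ne_top _)).1 ?_
  calc ((n * (n - 1) : ℕ) : ℝ≥0∞) * (ENNReal.ofReal (q ^ 2) * I n)
      = ENNReal.ofReal (((n * (n - 1) : ℕ) : ℝ) * q ^ 2) * I n := by
        rw [ENNReal.ofReal_mul (Nat.cast_nonneg _), ENNReal.ofReal_natCast, mul_assoc]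
    _ = ∑ e ∈ Finset.HasAntidiagonal.antidiagonal n, ENNReal.ofReal (binomialWeight q e.1 e.2) *
          (((e.1 * (e.1 - 1) : ℕ) : ℝ≥0∞) * I n) := by
        rw [← sum_mul_binomialWeight, ENNReal.ofReal_sum_of_nonneg fun e _ =>
          mul_nonneg (Nat.cast_nonneg _) (binomialWeight_nonneg hq e.1 e.2), Finset.sum_mul]
        refine Finset.sum_congr rfl fun e _ => ?_
        rw [ENNReal.ofReal_mul (Nat.cast_nonneg _), ENNReal.ofReal_natCast]
        ring
    _ ≤ ∑ e ∈ Finset.HasAntidiagonal.antidiagonal n, ENNReal.ofReal (binomialWeight q e.1 e.2) *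
          (((n * (n - 1) : ℕ) : ℝ≥0∞) *
            ((∏ i ∈ Finset.range e.2, κ (e.1 + i)) * I e.1)) := by
        refine Finset.sum_le_sum fun e he => ?_
        rw [← Finset.HasAntidiagonal.mem_antidiagonal.1 he]
        exact mul_le_mul_right (mul_le_prod_mul_of_succ h2 e.1 e.2) _
    _ = _ := by
        rw [Finset.mul_sum]
        exact Finset.sum_congr rfl fun e _ => by ring

end Thinning

section Weights

variable {d : ℕ}

/-- The sum over the deleted points is the exponential series in l (1 - q) v, which turns exp(-l v)
into exp(-q l v). -/
theorem janossyWeight_thinned_poisson {l q : ℝ} (hl : 0 < l) (hq : q ∈ Icc (0 : ℝ) 1)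
    {v : ℝ≥0∞} (hv : v ≠ ∞) (k : ℕ) :
    (k.factorial : ℝ≥0∞)⁻¹ * janossyWeight .poisson (q * l) v k =
      ∑' j, ((k + j).factorial : ℝ≥0∞)⁻¹ * janossyWeight .poisson l v (k + j) *
        (ENNReal.ofReal (binomialWeight q k j) * v ^ j) := by
  set r := v.toReal with hr
  have hvr : v = ENNReal.ofReal r := (ENNReal.ofReal_toReal hv).symm
  have hr0 : 0 ≤ r := ENNReal.toReal_nonneg
  have hq1 : 0 ≤ 1 - q := sub_nonneg.2 hq.2
  have hfac : ∀ n : ℕ, (n.factorial : ℝ≥0∞)⁻¹ = ENNReal.ofReal ((n.factorial : ℝ)⁻¹) := by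
    intro n
    rw [ENNReal.ofReal_inv_of_pos (by positivity), ENNReal.ofReal_natCast]
  have hterm : ∀ j, ((k + j).factorial : ℝ≥0∞)⁻¹ * janossyWeight .poisson l v (k + j) *
        (ENNReal.ofReal (binomialWeight q k j) * v ^ j) =
      ENNReal.ofReal (((k.factorial : ℝ)⁻¹ * (Real.exp (-(l * r)) * (q * l) ^ k)) *
        ((l * (1 - q) * r) ^ j / j.factorial)) := by
    intro j
    rw [janossyWeight, hfac, ← hr, hvr, ← ENNReal.ofReal_pow hr0,
      ← ENNReal.ofReal_mul (by positivity), ← ENNReal.ofReal_mul (binomialWeight_nonneg hq k j),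
      ← ENNReal.ofReal_mul (by positivity)]
    congr 1
    have hc : ((k + j).choose k : ℝ) = (k + j).factorial * (k.factorial : ℝ)⁻¹ *
        (j.factorial : ℝ)⁻¹ := by
      rw [Nat.choose_symm_add, Nat.add_choose, Nat.cast_div (Nat.factorial_mul_factorial_dvd_factorial_add k j)
        (by positivity)]
      push_cast
      field_simp
    rw [binomialWeight, hc]
    have : ((k + j).factorial : ℝ) ≠ 0 := by positivity
    simp only [mul_pow]
    field_simp
    ring
  simp only [hterm]
  have hsum := NormedSpace.expSeries_div_hasSum_exp (l * (1 - q) * r)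
  rw [← Real.exp_eq_exp_ℝ] at hsum
  have hsum' := hsum.mul_left ((k.factorial : ℝ)⁻¹ * (Real.exp (-(l * r)) * (q * l) ^ k))
  have hq0 := hq.1
  rw [← ENNReal.ofReal_tsum_of_nonneg (fun j => by positivity) hsum'.summable, hsum'.tsum_eq,
    hfac, janossyWeight, ← hr, ← ENNReal.ofReal_mul (by positivity)]
  congr 1
  have : Real.exp (-(q * l * r)) = Real.exp (-(l * r)) * Real.exp (l * (1 - q) * r) := by
    rw [← Real.exp_add]; congr 1; ring
  rw [this]
  ring

/-- The free masses multiply to the descending factorial of K - k, so the sum is the binomial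
expansion of (l (1 - q) + (1 - l)) ^ (K - k), whose base is 1 - q l. Terms with j > K - k vanish. -/
theorem janossyWeight_thinned_bernoulli {l q : ℝ} (hl : l ∈ Ioc (0 : ℝ) 1)
    (hq : q ∈ Icc (0 : ℝ) 1) (K k : ℕ) :
    (k.factorial : ℝ≥0∞)⁻¹ * janossyWeight .bernoulli (q * l) K k =
      ∑' j, ((k + j).factorial : ℝ≥0∞)⁻¹ * janossyWeight .bernoulli l K (k + j) *
        (ENNReal.ofReal (binomialWeight q k j) *
          ∏ i ∈ Finset.range j, ((K : ℝ≥0∞) - (k + i : ℕ))) := by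
  have hq1 : 0 ≤ 1 - q := sub_nonneg.2 hq.2
  have hl0 := hl.1
  have hl1 : 0 ≤ 1 - l := sub_nonneg.2 hl.2
  have hq0 := hq.1
  have hlq : 0 ≤ 1 - q * l := by nlinarith [hl.2, hq.2]
  have hfac : ∀ n : ℕ, (n.factorial : ℝ≥0∞)⁻¹ = ENNReal.ofReal ((n.factorial : ℝ)⁻¹) := by
    intro n
    rw [ENNReal.ofReal_inv_of_pos (by positivity), ENNReal.ofReal_natCast]
  have hprod : ∀ j, ∏ i ∈ Finset.range j, ((K : ℝ≥0∞) - (k + i : ℕ)) =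
      (((K - k).descFactorial j : ℕ) : ℝ≥0∞) := by
    intro j
    rw [Nat.descFactorial_eq_prod_range, Nat.cast_prod]
    refine Finset.prod_congr rfl fun i _ => ?_
    rw [Nat.sub_sub, ENNReal.natCast_sub]
  have hterm : ∀ j ∈ Finset.range (K - k + 1),
      ((k + j).factorial : ℝ≥0∞)⁻¹ * janossyWeight .bernoulli l K (k + j) *
        (ENNReal.ofReal (binomialWeight q k j) *
          ∏ i ∈ Finset.range j, ((K : ℝ≥0∞) - (k + i : ℕ))) =
      ENNReal.ofReal (((k.factorial : ℝ)⁻¹ * (q * l) ^ k) *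
        ((l * (1 - q)) ^ j * (1 - l) ^ (K - k - j) * ((K - k).choose j))) := by
    intro j _
    rw [hprod, janossyWeight, hfac, ENNReal.toReal_natCast, Nat.floor_natCast,
      ← ENNReal.ofReal_natCast ((K - k).descFactorial j),
      ← ENNReal.ofReal_mul (by positivity), ← ENNReal.ofReal_mul (binomialWeight_nonneg hq k j),
      ← ENNReal.ofReal_mul (by positivity)]
    congr 1
    have hc : ((k + j).choose k : ℝ) = (k + j).factorial * (k.factorial : ℝ)⁻¹ *
        (j.factorial : ℝ)⁻¹ := by
      rw [Nat.choose_symm_add, Nat.add_choose, Nat.cast_div (Nat.factorial_mul_factorial_dvd_factorial_add k j)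
        (by positivity)]
      push_cast
      field_simp
    rw [binomialWeight, hc, Nat.descFactorial_eq_factorial_mul_choose, Nat.cast_mul, Nat.sub_sub]
    have h1 : ((k + j).factorial : ℝ) ≠ 0 := by positivity
    have h2 : (j.factorial : ℝ) ≠ 0 := by positivity
    simp only [mul_pow]
    field_simp
    ring
  rw [tsum_eq_sum (s := Finset.range (K - k + 1)) fun j hj => ?_]
  · rw [Finset.sum_congr rfl hterm, ← ENNReal.ofReal_sum_of_nonneg fun j _ => by positivity,
      ← Finset.mul_sum, ← add_pow, hfac, janossyWeight, ENNReal.toReal_natCast, Nat.floor_natCast,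
      ← ENNReal.ofReal_mul (by positivity)]
    congr 1
    have : l * (1 - q) + (1 - l) = 1 - q * l := by ring
    rw [this]
    ring
  · rw [hprod, Nat.descFactorial_of_lt (by simpa using hj)]
    simp

end Weights

theorem janossyWeight_thinned {kind : VertexKind} {d : ℕ} {l q : ℝ} (hl : l ∈ kind.intensities)
    (hq : q ∈ Icc (0 : ℝ) 1) {W : Set (Pos d)} (hW : MeasurableSet W)
    (hb : Bornology.IsBounded W) (k : ℕ) :
    (k.factorial : ℝ≥0∞)⁻¹ * janossyWeight kind (q * l) (kind.locMeasure d W) k =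
      ∑' j, ((k + j).factorial : ℝ≥0∞)⁻¹ * janossyWeight kind l (kind.locMeasure d W) (k + j) *
        (ENNReal.ofReal (binomialWeight q k j) *
          ∏ i ∈ Finset.range j, freeMass kind W (k + i)) := by
  cases kind with
  | poisson =>
    rw [janossyWeight_thinned_poisson hl hq (locMeasure_lt_top .poisson hW hb).ne]
    simp [freeMass, VertexKind.atomMass]
  | bernoulli =>
    simp only [freeMass, locMeasure_bernoulli_apply hW hb, VertexKind.atomMass, mul_one]
    exact janossyWeight_thinned_bernoulli hl hq _ _

/-! ### Deleting a point from a configuration -/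

section Deletion

variable {N : ℕ}

/-- Deleting one of `N` vertices, an edge survives in `N - 2` of the `N` cases. -/
theorem mul_one_sub_prod_le_sum (a : Fin N × Fin N → ℝ) (ha : ∀ e, a e ∈ Icc (0 : ℝ) 1)
    (S : Finset (Fin N × Fin N)) (hS : ∀ e ∈ S, e.1 ≠ e.2) :
    ((N : ℝ) - 2) * (1 - ∏ e ∈ S, a e) ≤
      ∑ j : Fin N, (1 - ∏ e ∈ S with e.1 ≠ j ∧ e.2 ≠ j, a e) := by
  induction S using Finset.induction with
  | empty => simp
  | insert e S he ih =>
    have hS' : ∀ e ∈ S, e.1 ≠ e.2 := fun e' h => hS e' (Finset.mem_insert_of_mem h)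
    have ih := ih hS'
    set A : ℝ := ∏ e ∈ S, a e with hA
    set A' : Fin N → ℝ := fun j => ∏ e ∈ S with e.1 ≠ j ∧ e.2 ≠ j, a e with hA'
    have hprod : ∀ j, ∏ e' ∈ insert e S with e'.1 ≠ j ∧ e'.2 ≠ j, a e' =
        if e.1 ≠ j ∧ e.2 ≠ j then a e * A' j else A' j := by
      intro j
      rw [Finset.filter_insert]
      split_ifs with h
      · rw [Finset.prod_insert fun h' => he (Finset.mem_filter.1 h').1]
      · rfl
    have hAA' : ∀ j, A ≤ A' j := fun j => by
      rw [hA, ← Finset.prod_filter_mul_prod_filter_not S fun e => e.1 ≠ j ∧ e.2 ≠ j]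
      exact mul_le_of_le_one_right (Finset.prod_nonneg fun e _ => (ha e).1)
        (Finset.prod_le_one (fun e _ => (ha e).1) fun e _ => (ha e).2)
    -- If the new edge avoids j, then 1 - a(e) A'(j) = (1 - A'(j)) + (1 - a(e)) A'(j), and A'(j) ≥ A
    -- because it has fewer factors from [0, 1].
    have hstep : ∀ j, (1 - A' j) + (if e.1 ≠ j ∧ e.2 ≠ j then (1 - a e) * A else 0) ≤
        1 - if e.1 ≠ j ∧ e.2 ≠ j then a e * A' j else A' j := by
      intro j
      split_ifs with h
      · nlinarith [hAA' j, (ha e).2]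
      · linarith
    have hcard : (∑ j : Fin N, if e.1 ≠ j ∧ e.2 ≠ j then (1 - a e) * A else 0) =
        ((N : ℝ) - 2) * ((1 - a e) * A) := by
      rw [← Finset.sum_filter, Finset.sum_const, nsmul_eq_mul]
      congr 1
      have hf : (Finset.univ.filter fun j : Fin N => e.1 ≠ j ∧ e.2 ≠ j) =
          Finset.univ \ {e.1, e.2} := by
        ext j
        simp [eq_comm]
      have hc : ({e.1, e.2} : Finset (Fin N)).card = 2 :=
        Finset.card_pair (hS e (Finset.mem_insert_self e S))
      have h2 : 2 ≤ N := by
        have := Finset.card_le_univ ({e.1, e.2} : Finset (Fin N))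
        rwa [hc, Fintype.card_fin] at this
      rw [hf, Finset.card_sdiff_of_subset (Finset.subset_univ _), hc, Finset.card_univ,
        Fintype.card_fin, Nat.cast_sub h2]
      simp
    simp only [hprod]
    rw [Finset.prod_insert he]
    calc ((N : ℝ) - 2) * (1 - a e * A)
        = ((N : ℝ) - 2) * (1 - A) + ((N : ℝ) - 2) * ((1 - a e) * A) := by ring
      _ ≤ ∑ j : Fin N, (1 - A' j) +
          ∑ j : Fin N, (if e.1 ≠ j ∧ e.2 ≠ j then (1 - a e) * A else 0) := by
          rw [hcard]
          gcongr
      _ ≤ _ := by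
          rw [← Finset.sum_add_distrib]
          exact Finset.sum_le_sum fun j _ => hstep j

theorem prod_pairs_succAbove {n : ℕ} (j : Fin (n + 1)) (a : Fin (n + 1) × Fin (n + 1) → ℝ) :
    ∏ e ∈ pairs n, a (j.succAbove e.1, j.succAbove e.2) =
      ∏ e ∈ pairs (n + 1) with e.1 ≠ j ∧ e.2 ≠ j, a e := by
  refine Finset.prod_bij (fun e _ => (j.succAbove e.1, j.succAbove e.2)) ?_ ?_ ?_ ?_
  · intro e he
    rw [Finset.mem_filter, mem_pairs]
    exact ⟨(Fin.strictMono_succAbove j) (mem_pairs.1 he), Fin.succAbove_ne j _,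
      Fin.succAbove_ne j _⟩
  · intro e _ e' _ h
    have h1 := Fin.succAbove_right_injective (congrArg Prod.fst h)
    have h2 := Fin.succAbove_right_injective (congrArg Prod.snd h)
    exact Prod.ext h1 h2
  · rintro ⟨x, y⟩ h
    rw [Finset.mem_filter, mem_pairs] at h
    obtain ⟨h1, h2, h3⟩ := h
    obtain ⟨x, rfl⟩ := Fin.exists_succAbove_eq h2
    obtain ⟨y, rfl⟩ := Fin.exists_succAbove_eq h3
    exact ⟨(x, y), mem_pairs.2 ((Fin.strictMono_succAbove j).lt_iff_lt.1 h1), rfl⟩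
  · intro e _
    rfl

end Deletion

/-! ### The existence of an edge with a given property at two intensities -/

section EdgeProperty

variable {d : ℕ} {M : Type*}

/-- The property that some edge satisfies `R`. -/
def someEdge (R : Pos d × M → Pos d × M → Prop) :
    ∀ n, (Fin n → Pos d × M) → Finset (Fin n × Fin n) → Prop :=
  fun _ x T => ∃ e ∈ T, R (x e.1) (x e.2)

theorem measurableSet_someEdge [MeasurableSpace M] {R : Pos d × M → Pos d × M → Prop}
    (hR : MeasurableSet {q : (Pos d × M) × (Pos d × M) | R q.1 q.2}) (n : ℕ)
    (T : Finset (Fin n × Fin n)) : MeasurableSet {x | someEdge R n x T} := by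
  have : {x | someEdge R n x T} =
      ⋃ e ∈ T, (fun x : Fin n → Pos d × M => (x e.1, x e.2)) ⁻¹'
        {q : (Pos d × M) × (Pos d × M) | R q.1 q.2} := by
    ext x
    simp [someEdge]
  rw [this]
  exact Finset.measurableSet_biUnion _ fun e _ =>
    ((measurable_pi_apply e.1).prodMk (measurable_pi_apply e.2)) hR

open Classical in
/-- The conditional probability that the pair `x, y` is not an edge satisfying `R`. -/
def noEdgeProb (p : Pos d × M → Pos d × M → ℝ) (R : Pos d × M → Pos d × M → Prop)
    (x y : Pos d × M) : ℝ := 1 - if R x y then p x y else 0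

variable {p : Pos d × M → Pos d × M → ℝ} {R : Pos d × M → Pos d × M → Prop}

theorem noEdgeProb_mem (hp : ∀ x y, p x y ∈ Icc (0 : ℝ) 1) (x y : Pos d × M) :
    noEdgeProb p R x y ∈ Icc (0 : ℝ) 1 := by
  unfold noEdgeProb
  have := hp x y
  split_ifs
  · exact ⟨sub_nonneg.2 this.2, by linarith [this.1]⟩
  · simp

/-- The complementary event asks that every pair avoids being an edge with property R. Summing the
weights of all such patterns factorises over pairs. -/
theorem configProb_someEdge (hp : ∀ x y, p x y ∈ Icc (0 : ℝ) 1) (n : ℕ) (x : Fin n → Pos d × M) :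
    configProb p (someEdge R) n x =
      ENNReal.ofReal (1 - ∏ e ∈ pairs n, noEdgeProb p R (x e.1) (x e.2)) := by
  classical
  have h1 : ∏ e ∈ pairs n, noEdgeProb p R (x e.1) (x e.2) =
      ∑ T ∈ (pairs n).powerset, if someEdge R n x T then 0 else patternWeight p x T := by
    have : ∀ e : Fin n × Fin n, noEdgeProb p R (x e.1) (x e.2) =
        (if R (x e.1) (x e.2) then 0 else p (x e.1) (x e.2)) + (1 - p (x e.1) (x e.2)) := by
      intro e
      unfold noEdgeProb
      split_ifs <;> ring
    simp only [this]
    rw [← Finset.sum_powerset_prod_ite (pairs n)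
      (fun e => if R (x e.1) (x e.2) then 0 else p (x e.1) (x e.2))
      fun e => 1 - p (x e.1) (x e.2)]
    refine Finset.sum_congr rfl fun T hT => ?_
    split_ifs with h
    · obtain ⟨e, he, hR⟩ := h
      refine Finset.prod_eq_zero (Finset.mem_powerset.1 hT he) ?_
      rw [if_pos he, if_pos hR]
    · refine Finset.prod_congr rfl fun e _ => ?_
      by_cases heT : e ∈ T
      · rw [if_pos heT, if_pos heT, if_neg fun hR => h ⟨e, heT, hR⟩]
      · rw [if_neg heT, if_neg heT]
  rw [h1, ← sum_patternWeight p x, ← Finset.sum_sub_distrib, ENNReal.ofReal_sum_of_nonneg]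
  · refine Finset.sum_congr rfl fun T _ => ?_
    by_cases h : someEdge R n x T
    · rw [indicator_of_mem (show x ∈ {y | someEdge R n y T} from h), if_pos h, sub_zero]
    · rw [indicator_of_notMem (show x ∉ {y | someEdge R n y T} from h), if_neg h, sub_self,
        ENNReal.ofReal_zero]
  · intro T _
    split_ifs
    · rw [sub_zero]; exact patternWeight_nonneg hp x T
    · rw [sub_self]

theorem configProb_someEdge_succAbove_le (hp : ∀ x y, p x y ∈ Icc (0 : ℝ) 1) {n : ℕ}
    (j : Fin (n + 1)) (x : Fin (n + 1) → Pos d × M) :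
    configProb p (someEdge R) n (fun i => x (j.succAbove i)) ≤
      configProb p (someEdge R) (n + 1) x := by
  rw [configProb_someEdge hp, configProb_someEdge hp,
    prod_pairs_succAbove j fun e => noEdgeProb p R (x e.1) (x e.2)]
  refine ENNReal.ofReal_le_ofReal (sub_le_sub_left ?_ 1)
  rw [← Finset.prod_filter_mul_prod_filter_not (pairs (n + 1)) fun e => e.1 ≠ j ∧ e.2 ≠ j]
  exact mul_le_of_le_one_right (Finset.prod_nonneg fun e _ => (noEdgeProb_mem hp _ _).1)
    (Finset.prod_le_one (fun e _ => (noEdgeProb_mem hp _ _).1) fun e _ => (noEdgeProb_mem hp _ _).2)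

/-- Averaged form of the fact that an edge among n + 1 points survives the deletion of any of the n
- 1 points that are not its ends. For n = 0 the truncated factor is zero. -/
theorem mul_configProb_someEdge_le (hp : ∀ x y, p x y ∈ Icc (0 : ℝ) 1) {n : ℕ}
    (x : Fin (n + 1) → Pos d × M) :
    ((n - 1 : ℕ) : ℝ≥0∞) * configProb p (someEdge R) (n + 1) x ≤
      ∑ j : Fin (n + 1), configProb p (someEdge R) n fun i => x (j.succAbove i) := by
  rcases Nat.eq_zero_or_pos n with rfl | hn
  · simp
  simp only [configProb_someEdge hp]
  have h := mul_one_sub_prod_le_sum (fun e => noEdgeProb p R (x e.1) (x e.2))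
    (fun e => noEdgeProb_mem hp _ _) (pairs (n + 1)) fun e he => (mem_pairs.1 he).ne
  have hle : ∀ j : Fin (n + 1),
      0 ≤ 1 - ∏ e ∈ pairs n, noEdgeProb p R (x (j.succAbove e.1)) (x (j.succAbove e.2)) :=
    fun j => sub_nonneg.2 (Finset.prod_le_one (fun e _ => (noEdgeProb_mem hp _ _).1)
      fun e _ => (noEdgeProb_mem hp _ _).2)
  rw [← ENNReal.ofReal_sum_of_nonneg fun j _ => hle j, ← ENNReal.ofReal_natCast,
    ← ENNReal.ofReal_mul (Nat.cast_nonneg _)]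
  refine ENNReal.ofReal_le_ofReal ?_
  have e1 : ((n - 1 : ℕ) : ℝ) = ((n + 1 : ℕ) : ℝ) - 2 := by
    rw [Nat.cast_sub hn]; push_cast; ring
  rw [e1]
  refine h.trans (le_of_eq (Finset.sum_congr rfl fun j _ => ?_))
  rw [← prod_pairs_succAbove j fun e => noEdgeProb p R (x e.1) (x e.2)]

/-- The analytic substitute for a coupling of the two intensities. It rests on the two one-point
deletion bounds, integrated over the window, and on the binomial decomposition of the weights. -/
theorem eventProb_someEdge_thinned [MeasurableSpace M] {kind : VertexKind} (hd : 0 < d)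
    {l q : ℝ} (hl : l ∈ kind.intensities) (hq : q ∈ Icc (0 : ℝ) 1) (ν : Measure M)
    [IsProbabilityMeasure ν] (hp : IsConnectionFunction kind p)
    (hR : MeasurableSet {q : (Pos d × M) × (Pos d × M) | R q.1 q.2})
    {W : Set (Pos d)} (hW : MeasurableSet W) (hb : Bornology.IsBounded W) :
    eventProb kind (q * l) ν p W (someEdge R) ≤ eventProb kind l ν p W (someEdge R) ∧
    ENNReal.ofReal (q ^ 2) * eventProb kind l ν p W (someEdge R) ≤
      eventProb kind (q * l) ν p W (someEdge R) := by
  set I : ℕ → ℝ≥0∞ := fun n => ∫⁻ x in distinctLoc (Fin n) d M, configProb p (someEdge R) n x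
    ∂(Measure.pi fun _ => windowMeasure kind ν W) with hI
  have hcm := fun n => measurable_configProb hp.measurable (measurableSet_someEdge hR) n
  have h1 : ∀ n, freeMass kind W n * I n ≤ I (n + 1) := by
    intro n
    rw [hI, ← lintegral_distinctLoc_succ kind hd ν hW hb 0 (hcm n)]
    exact lintegral_mono fun x => configProb_someEdge_succAbove_le hp.mem_unit 0 x
  have h2 : ∀ n, ((n - 1 : ℕ) : ℝ≥0∞) * I (n + 1) ≤ (n + 1 : ℕ) * (freeMass kind W n * I n) := by
    intro n
    have hm : ∀ j : Fin (n + 1), Measurable fun x : Fin (n + 1) → Pos d × M =>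
        configProb p (someEdge R) n fun i => x (j.succAbove i) := fun j =>
      (hcm n).comp (measurable_pi_lambda _ fun i => measurable_pi_apply _)
    calc ((n - 1 : ℕ) : ℝ≥0∞) * I (n + 1)
        ≤ ∫⁻ x in distinctLoc (Fin (n + 1)) d M,
          ∑ j : Fin (n + 1), configProb p (someEdge R) n (fun i => x (j.succAbove i))
            ∂(Measure.pi fun _ => windowMeasure kind ν W) := by
          rw [hI, ← lintegral_const_mul _ (hcm (n + 1))]
          exact lintegral_mono fun x => mul_configProb_someEdge_le hp.mem_unit x
      _ = (n + 1 : ℕ) * (freeMass kind W n * I n) := by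
          rw [lintegral_finsetSum _ fun j _ => hm j]
          simp only [fun j => lintegral_distinctLoc_succ kind hd ν hW hb j (hcm n)]
          rw [Finset.sum_const, Finset.card_univ, Fintype.card_fin, nsmul_eq_mul]
  have h0 : ∀ n, n ≤ 1 → I n = 0 := by
    intro n hn
    have : ∀ x, configProb p (someEdge R) n x = 0 := by
      intro x
      rw [configProb_someEdge hp.mem_unit]
      have hemp : pairs n = ∅ := by
        rw [Finset.eq_empty_iff_forall_notMem]
        intro e he
        have h1 := mem_pairs.1 he
        have := e.1.2
        have := e.2.2
        rw [Fin.lt_def] at h1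
        omega
      rw [hemp]
      simp
    simp [hI, this]
  have h3 : ∀ k, (k.factorial : ℝ≥0∞)⁻¹ *
      (janossyWeight kind (q * l) (kind.locMeasure d W) k * I k) =
      ∑' j, ((k + j).factorial : ℝ≥0∞)⁻¹ * janossyWeight kind l (kind.locMeasure d W) (k + j) *
      (ENNReal.ofReal (binomialWeight q k j) *
        ((∏ i ∈ Finset.range j, freeMass kind W (k + i)) * I k)) := by
    intro k
    rw [← mul_assoc, janossyWeight_thinned hl hq hW hb k, ← ENNReal.tsum_mul_right]
    congr 1 with j
    ring
  exact ⟨tsum_thinned_le (w := janossyWeight kind l (kind.locMeasure d W)) hq h1 h3,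
    le_tsum_thinned (w := janossyWeight kind l (kind.locMeasure d W)) hq (h0 0 zero_le_one)
      (h0 1 le_rfl) h2 h3⟩

end EdgeProperty

/-! ### Norms and lattice covers -/

/-- A measurable norm on `ℝ^d` that dominates the maximum norm and is comparable to it. -/
structure IsComparableNorm {d : ℕ} (nrm : Pos d → ℝ) : Prop where
  measurable : Measurable nrm
  neg : ∀ x, nrm (-x) = nrm x
  add_le : ∀ x y, nrm (x + y) ≤ nrm x + nrm y
  norm_le : ∀ x, ‖x‖ ≤ nrm x
  le_mul_norm : ∃ K : ℝ, 0 < K ∧ ∀ x, nrm x ≤ K * ‖x‖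

theorem isComparableNorm_maxNorm (d : ℕ) : IsComparableNorm (maxNorm d) :=
  ⟨measurable_norm, norm_neg, norm_add_le, fun _ => le_rfl, 1, one_pos, fun x => by
    rw [one_mul]; rfl⟩

theorem euclideanNorm_eq (d : ℕ) (x : Pos d) : euclideanNorm d x = ‖WithLp.toLp 2 x‖ := by
  rw [EuclideanSpace.norm_eq, euclideanNorm]
  simp

theorem isComparableNorm_euclideanNorm (d : ℕ) : IsComparableNorm (euclideanNorm d) where
  measurable := by unfold euclideanNorm; fun_prop
  neg x := by simp [euclideanNorm]
  add_le x y := by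
    rw [euclideanNorm_eq, euclideanNorm_eq, euclideanNorm_eq, WithLp.toLp_add]
    exact norm_add_le _ _
  norm_le x := by
    unfold euclideanNorm
    rw [pi_norm_le_iff_of_nonneg (Real.sqrt_nonneg _)]
    intro i
    rw [Real.norm_eq_abs, ← Real.sqrt_sq_eq_abs]
    exact Real.sqrt_le_sqrt (Finset.single_le_sum (f := fun k => x k ^ 2)
      (fun k _ => sq_nonneg _) (Finset.mem_univ i))
  le_mul_norm := by
    refine ⟨Real.sqrt (d + 1), by positivity, fun x => ?_⟩
    rw [euclideanNorm, ← Real.sqrt_sq (norm_nonneg x), ← Real.sqrt_mul (by positivity)]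
    refine Real.sqrt_le_sqrt ?_
    calc ∑ k, x k ^ 2 ≤ ∑ _k : Fin d, ‖x‖ ^ 2 := by
          refine Finset.sum_le_sum fun k _ => ?_
          rw [← sq_abs]
          exact pow_le_pow_left₀ (abs_nonneg _) (norm_le_pi_norm x k) 2
      _ = d * ‖x‖ ^ 2 := by simp
      _ ≤ (d + 1) * ‖x‖ ^ 2 := by nlinarith [sq_nonneg ‖x‖]

/-- The open ball of a norm. -/
def normBall {d : ℕ} (nrm : Pos d → ℝ) (a : Pos d) (r : ℝ) : Set (Pos d) := {x | nrm (x - a) < r}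

theorem preimage_normBall {d : ℕ} {nrm : Pos d → ℝ} (z : Fin d → ℤ) (r : ℝ) :
    normBall nrm 0 r = (fun x => x + latticePoint z) ⁻¹' normBall nrm (latticePoint z) r := by
  ext x
  simp [normBall]

namespace IsComparableNorm

variable {d : ℕ} {nrm : Pos d → ℝ}

theorem sub_comm (h : IsComparableNorm nrm) (x y : Pos d) : nrm (x - y) = nrm (y - x) := by
  rw [← h.neg, neg_sub]

theorem sub_le (h : IsComparableNorm nrm) (x y z : Pos d) :
    nrm (x - z) ≤ nrm (x - y) + nrm (y - z) := by
  have := h.add_le (x - y) (y - z)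
  rwa [sub_add_sub_cancel] at this

theorem measurableSet_normBall (h : IsComparableNorm nrm) (a : Pos d) (r : ℝ) :
    MeasurableSet (normBall nrm a r) :=
  measurableSet_lt (h.measurable.comp (measurable_id.sub_const a)) measurable_const

theorem isBounded_normBall (h : IsComparableNorm nrm) (a : Pos d) (r : ℝ) :
    Bornology.IsBounded (normBall nrm a r) := by
  refine (Metric.isBounded_ball (x := a) (r := r)).subset fun x hx => ?_
  rw [Metric.mem_ball, dist_eq_norm]
  exact (h.norm_le _).trans_lt hx

/-- The centres must be lattice points, because Bernoulli models are invariant only under lattice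
shifts. They are an integer multiple, of order r, of a fixed finite set, so that their number is
uniform in r. -/
theorem exists_lattice_cover (h : IsComparableNorm nrm) (D : ℝ) :
    ∃ C : Finset (Fin d → ℤ), ∀ᶠ r : ℝ in atTop, ∃ s : ℤ, ∀ x, nrm x < D * r →
      ∃ m ∈ C, nrm (x - latticePoint (s • m)) < r := by
  obtain ⟨K, hK, hle⟩ := h.le_mul_norm
  -- Below, the spacing s is at least r / (4K), so coordinates of x / s are at most 4K|D| in
  -- absolute value. Taking floors costs one more.
  set N : ℤ := ⌈4 * K * |D| + 1⌉ with hN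
  -- For r ≥ 4K one has r / (2K) ≥ 2, so its floor is at least half of it. Rounding to spacing s ≤ r
  -- / (2K) costs at most r / 2 in the chosen norm.
  refine ⟨Fintype.piFinset fun _ => Finset.Icc (-N) N, ?_⟩
  filter_upwards [eventually_ge_atTop (4 * K), eventually_gt_atTop 0] with r hr hr0
  set s : ℤ := ⌊r / (2 * K)⌋ with hs
  have hs1 : (s : ℝ) ≤ r / (2 * K) := Int.floor_le _
  have hs2 : r / (2 * K) < s + 1 := Int.lt_floor_add_one _
  have hrK : r / (2 * K) = 2 * (r / (4 * K)) := by field_simp; norm_num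
  have hr4 : 1 ≤ r / (4 * K) := by rwa [le_div_iff₀ (by positivity), one_mul]
  have hs3 : r / (4 * K) ≤ s := by linarith
  have hs0 : (0 : ℝ) < s := by linarith
  refine ⟨s, fun x hx => ⟨fun k => ⌊x k / s⌋, ?_, ?_⟩⟩
  · rw [Fintype.mem_piFinset]
    intro k
    have hxk : |x k| < |D| * r := by
      calc |x k| ≤ ‖x‖ := norm_le_pi_norm x k
        _ ≤ nrm x := h.norm_le x
        _ < D * r := hx
        _ ≤ |D| * r := by gcongr; exact le_abs_self D
    have hb : |x k / s| ≤ 4 * K * |D| := by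
      rw [abs_div, abs_of_pos hs0, div_le_iff₀ hs0]
      calc |x k| ≤ |D| * r := hxk.le
        _ = 4 * K * |D| * (r / (4 * K)) := by field_simp
        _ ≤ 4 * K * |D| * s := by gcongr
    have hb' := abs_le.1 hb
    have hNle : 4 * K * |D| + 1 ≤ N := Int.le_ceil _
    rw [Finset.mem_Icc]
    constructor
    · rw [Int.le_floor]; push_cast; linarith
    · have h1 : ((⌊x k / s⌋ : ℤ) : ℝ) ≤ N := (Int.floor_le _).trans (by linarith)
      exact_mod_cast h1
  · have hnorm : ‖x - latticePoint (s • fun k => ⌊x k / s⌋)‖ ≤ s := by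
      rw [pi_norm_le_iff_of_nonneg hs0.le]
      intro k
      have e : (x - latticePoint (s • fun k => ⌊x k / s⌋)) k = s * (x k / s - ⌊x k / s⌋) := by
        simp only [Pi.sub_apply, latticePoint, Pi.smul_apply, smul_eq_mul, Int.cast_mul]
        field_simp
      rw [e, Real.norm_eq_abs, abs_mul, abs_of_pos hs0, Int.self_sub_floor,
        abs_of_nonneg (Int.fract_nonneg _)]
      exact mul_le_of_le_one_right hs0.le (Int.fract_lt_one _).le
    calc nrm (x - latticePoint (s • fun k => ⌊x k / s⌋))
        ≤ K * ‖x - latticePoint (s • fun k => ⌊x k / s⌋)‖ := hle _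
      _ ≤ K * (r / (2 * K)) := by gcongr; linarith
      _ = r / 2 := by field_simp
      _ < r := by linarith

end IsComparableNorm

/-! ### Localised events and their encodings -/

namespace RandomGraph

variable {Ω : Type*} {d : ℕ} {M : Type*} (G : RandomGraph Ω d M)

/-- There is an edge longer than `b` with an end vertex in the ball of radius `r` around `a`. -/
def longEdgeAt (nrm : Pos d → ℝ) (a : Pos d) (r b : ℝ) : Set Ω :=
  {ω | ∃ i j, (G.graph ω).Adj i j ∧ nrm (G.loc i ω - a) < r ∧ b < nrm (G.loc i ω - G.loc j ω)}

/-- There is such an edge with both end vertices in `W`. -/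
def longEdgeIn (nrm : Pos d → ℝ) (a : Pos d) (r b : ℝ) (W : Set (Pos d)) : Set Ω :=
  {ω | ∃ i j, (G.graph ω).Adj i j ∧ nrm (G.loc i ω - a) < r ∧
    b < nrm (G.loc i ω - G.loc j ω) ∧ G.loc i ω ∈ W ∧ G.loc j ω ∈ W}

/-- The graph induced by the vertices with location in `W`. -/
def graphIn (W : Set (Pos d)) (ω : Ω) : SimpleGraph ℕ where
  Adj i j := (G.graph ω).Adj i j ∧ G.loc i ω ∈ W ∧ G.loc j ω ∈ W
  symm := ⟨fun _ _ h => ⟨h.1.symm, h.2.2, h.2.1⟩⟩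
  loopless := ⟨fun _ h => h.1.ne rfl⟩

/-- Some vertex in the ball of radius `r` around `a` is connected to some vertex outside of the
ball of radius `2 * r`, by a path in the ball of radius `3 * r`. -/
def localCrossing (nrm : Pos d → ℝ) (a : Pos d) (r : ℝ) : Set Ω :=
  {ω | ∃ i ∈ G.occ ω, ∃ j ∈ G.occ ω, nrm (G.loc i ω - a) < r ∧ 2 * r ≤ nrm (G.loc j ω - a) ∧
    G.loc j ω ∈ normBall nrm a (3 * r) ∧
    (G.graphIn (normBall nrm a (3 * r)) ω).Reachable i j}

end RandomGraph

section Properties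

variable {d : ℕ} {M : Type*}

/-- The relation of being at distance more than `b`, one of the points being in a ball. -/
def longRel (M : Type*) (nrm : Pos d → ℝ) (a : Pos d) (r b : ℝ) (x y : Pos d × M) : Prop :=
  (nrm (x.1 - a) < r ∨ nrm (y.1 - a) < r) ∧ b < nrm (x.1 - y.1)

theorem measurableSet_longRel [MeasurableSpace M] {nrm : Pos d → ℝ} (h : IsComparableNorm nrm)
    (a : Pos d) (r b : ℝ) :
    MeasurableSet {q : (Pos d × M) × (Pos d × M) | longRel M nrm a r b q.1 q.2} := by
  have m1 : Measurable fun q : (Pos d × M) × (Pos d × M) => nrm (q.1.1 - a) :=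
    h.measurable.comp (by fun_prop)
  have m2 : Measurable fun q : (Pos d × M) × (Pos d × M) => nrm (q.2.1 - a) :=
    h.measurable.comp (by fun_prop)
  have m3 : Measurable fun q : (Pos d × M) × (Pos d × M) => nrm (q.1.1 - q.2.1) :=
    h.measurable.comp (by fun_prop)
  exact ((measurableSet_lt m1 measurable_const).union
    (measurableSet_lt m2 measurable_const)).inter (measurableSet_lt measurable_const m3)

/-- The graph with the given set of pairs as edges. -/
def patternGraph {n : ℕ} (T : Finset (Fin n × Fin n)) : SimpleGraph (Fin n) :=
  SimpleGraph.fromRel fun i j => (i, j) ∈ T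

/-- The property that some point in the ball of radius `r` around `a` is connected to some point
outside of the ball of radius `2 * r`. -/
def crossingProperty (M : Type*) (nrm : Pos d → ℝ) (a : Pos d) (r : ℝ) :
    ∀ n, (Fin n → Pos d × M) → Finset (Fin n × Fin n) → Prop :=
  fun _ x T => ∃ i j, nrm ((x i).1 - a) < r ∧ 2 * r ≤ nrm ((x j).1 - a) ∧
    (patternGraph T).Reachable i j

theorem measurableSet_crossingProperty [MeasurableSpace M] {nrm : Pos d → ℝ}
    (h : IsComparableNorm nrm) (a : Pos d) (r : ℝ) (n : ℕ) (T : Finset (Fin n × Fin n)) :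
    MeasurableSet {x | crossingProperty M nrm a r n x T} := by
  have m : ∀ i, Measurable fun x : Fin n → Pos d × M => nrm ((x i).1 - a) :=
    fun i => h.measurable.comp (by fun_prop)
  have : {x | crossingProperty M nrm a r n x T} =
      ⋃ i : Fin n, ⋃ j : Fin n, ({x | nrm ((x i).1 - a) < r} ∩ {x | 2 * r ≤ nrm ((x j).1 - a)}) ∩
        {_x | (patternGraph T).Reachable i j} := by
    ext x
    simp [crossingProperty, and_assoc]
  rw [this]
  exact MeasurableSet.iUnion fun i => MeasurableSet.iUnion fun j =>
    ((measurableSet_lt (m i) measurable_const).inter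
      (measurableSet_le measurable_const (m j))).inter (MeasurableSet.const _)

end Properties

namespace RandomGraph

variable {Ω : Type*} {d : ℕ} {M : Type*} {G : RandomGraph Ω d M} {nrm : Pos d → ℝ}

theorem patternGraph_edgePattern_adj {n : ℕ} (t : Fin n ↪ ℕ) (ω : Ω) (i j : Fin n) :
    (patternGraph (G.edgePattern t ω)).Adj i j ↔ (G.graph ω).Adj (t i) (t j) := by
  classical
  simp only [patternGraph, SimpleGraph.fromRel_adj, edgePattern, Finset.mem_filter, mem_pairs]
  constructor
  · rintro ⟨-, h | h⟩
    exacts [h.2, h.2.symm]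
  · intro h
    have hne : i ≠ j := fun he => h.ne (by rw [he])
    rcases lt_or_gt_of_ne hne with hlt | hlt
    exacts [⟨hne, Or.inl ⟨hlt, h⟩⟩, ⟨hne, Or.inr ⟨hlt, h.symm⟩⟩]

/-- Edge patterns record a pair in increasing order of labels, so the end in the ball may come first
or second. The symmetry of `longRel` absorbs this. -/
theorem encodes_longEdgeIn (hn : IsComparableNorm nrm) (a : Pos d) (r b : ℝ) (W : Set (Pos d)) :
    G.Encodes W (G.longEdgeIn nrm a r b W) (someEdge (longRel M nrm a r b)) := by
  classical
  intro ω n t ht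
  constructor
  · rintro ⟨i, j, hadj, hi, hij, hiW, hjW⟩
    have hi' : i ∈ range t := ht ▸ ⟨G.occ_of_adj ω i j hadj, hiW⟩
    have hj' : j ∈ range t := ht ▸ ⟨G.occ_of_adj ω j i hadj.symm, hjW⟩
    obtain ⟨i, rfl⟩ := hi'
    obtain ⟨j, rfl⟩ := hj'
    have hne : i ≠ j := fun he => hadj.ne (by rw [he])
    rcases lt_or_gt_of_ne hne with hlt | hlt
    · exact ⟨(i, j), Finset.mem_filter.2 ⟨mem_pairs.2 hlt, hadj⟩, Or.inl hi, hij⟩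
    · exact ⟨(j, i), Finset.mem_filter.2 ⟨mem_pairs.2 hlt, hadj.symm⟩, Or.inr hi,
        by rw [hn.sub_comm]; exact hij⟩
  · rintro ⟨⟨i, j⟩, he, hor, hij⟩
    have hadj := (Finset.mem_filter.1 he).2
    have hW : ∀ k, G.loc (t k) ω ∈ W := fun k =>
      (show t k ∈ G.idx (window M W) ω from ht ▸ mem_range_self k).2
    rcases hor with hi | hj
    · exact ⟨t i, t j, hadj, hi, hij, hW i, hW j⟩
    · exact ⟨t j, t i, hadj.symm, hj, by rw [hn.sub_comm]; exact hij, hW j, hW i⟩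

/-- A walk that stays in the window visits only labelled vertices, and can be rewritten step by step
as a walk between labels. -/
theorem reachable_graphIn_iff {W : Set (Pos d)} {n : ℕ} {t : Fin n ↪ ℕ} {ω : Ω}
    (ht : G.idx (window M W) ω = range t) (i j : Fin n) :
    (G.graphIn W ω).Reachable (t i) (t j) ↔
      (patternGraph (G.edgePattern t ω)).Reachable i j := by
  have hW : ∀ k, G.loc (t k) ω ∈ W := fun k =>
    (show t k ∈ G.idx (window M W) ω from ht ▸ mem_range_self k).2
  constructor
  · rintro ⟨w⟩
    have key : ∀ {u v : ℕ} (w : (G.graphIn W ω).Walk u v) (i j : Fin n), u = t i → v = t j →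
        (patternGraph (G.edgePattern t ω)).Reachable i j := by
      intro u v w
      induction w with
      | nil =>
        intro i j hi hj
        rw [t.injective (hi.symm.trans hj)]
      | @cons u k v hadj w ih =>
        intro i j hi hj
        have hk : k ∈ range t := ht ▸ ⟨G.occ_of_adj ω k u hadj.1.symm, hadj.2.2⟩
        obtain ⟨k, rfl⟩ := hk
        subst hi
        exact ((patternGraph_edgePattern_adj t ω i k).2 hadj.1).reachable.trans (ih k j rfl hj)
    exact key w i j rfl rfl
  · intro h
    exact h.map (G' := G.graphIn W ω)
      ⟨t, fun {a b} hab => ⟨(patternGraph_edgePattern_adj t ω a b).1 hab, hW a, hW b⟩⟩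

theorem encodes_localCrossing (a : Pos d) {r : ℝ} (hr : 0 < r) :
    G.Encodes (normBall nrm a (3 * r)) (G.localCrossing nrm a r) (crossingProperty M nrm a r) := by
  intro ω n t ht
  have hocc : ∀ k, t k ∈ G.occ ω := fun k =>
    (show t k ∈ G.idx (window M (normBall nrm a (3 * r))) ω from ht ▸ mem_range_self k).1
  have hW : ∀ k, G.loc (t k) ω ∈ normBall nrm a (3 * r) := fun k =>
    (show t k ∈ G.idx (window M (normBall nrm a (3 * r))) ω from ht ▸ mem_range_self k).2
  constructor
  · rintro ⟨i, hi, j, hj, hir, hjr, hjW, hreach⟩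
    have hi' : i ∈ range t := ht ▸ ⟨hi, show nrm (G.loc i ω - a) < 3 * r by linarith⟩
    have hj' : j ∈ range t := ht ▸ ⟨hj, hjW⟩
    obtain ⟨i, rfl⟩ := hi'
    obtain ⟨j, rfl⟩ := hj'
    exact ⟨i, j, hir, hjr, (reachable_graphIn_iff ht i j).1 hreach⟩
  · rintro ⟨i, j, hir, hjr, hreach⟩
    exact ⟨t i, hocc i, t j, hocc j, hir, hjr, hW j, (reachable_graphIn_iff ht i j).2 hreach⟩

theorem longEdge_eq_longEdgeAt (r c : ℝ) :
    G.longEdge nrm r c = G.longEdgeAt nrm 0 r (c * r) := by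
  simp [longEdge, longEdgeAt]

/-- A long edge can leave every prescribed bounded window, whereas the series describe bounded
windows only. The space is therefore exhausted by balls. -/
theorem longEdgeAt_eq_iUnion (a : Pos d) (r b : ℝ) :
    G.longEdgeAt nrm a r b = ⋃ n : ℕ, G.longEdgeIn nrm a r b (normBall nrm a n) := by
  ext ω
  simp only [mem_iUnion]
  constructor
  · rintro ⟨i, j, hadj, hi, hij⟩
    obtain ⟨n, hn⟩ := exists_nat_gt (max (nrm (G.loc i ω - a)) (nrm (G.loc j ω - a)))
    exact ⟨n, i, j, hadj, hi, hij, (le_max_left _ _).trans_lt hn, (le_max_right _ _).trans_lt hn⟩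
  · rintro ⟨n, i, j, hadj, hi, hij, -⟩
    exact ⟨i, j, hadj, hi, hij⟩

theorem measure_longEdgeAt_eq_iSup [MeasurableSpace Ω] (P : Measure Ω) (a : Pos d) (r b : ℝ) :
    P (G.longEdgeAt nrm a r b) = ⨆ n : ℕ, P (G.longEdgeIn nrm a r b (normBall nrm a n)) := by
  rw [longEdgeAt_eq_iUnion]
  refine Monotone.measure_iUnion fun m n hmn => ?_
  rintro ω ⟨i, j, hadj, hi, hij, h1, h2⟩
  have : (m : ℝ) ≤ n := by exact_mod_cast hmn
  exact ⟨i, j, hadj, hi, hij, lt_of_lt_of_le h1 this, lt_of_lt_of_le h2 this⟩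

end RandomGraph

/-! ### Probabilities of long edges and local crossings -/

namespace IndependentSetting

variable {kind : VertexKind} {Ω : Type*} [MeasurableSpace Ω] {d : ℕ}
    {M : Type*} [MeasurableSpace M] {l : ℝ} {ν : Measure M} [IsProbabilityMeasure ν]
    {p : Pos d × M → Pos d × M → ℝ} {P : Measure Ω} {G : RandomGraph Ω d M} {nrm : Pos d → ℝ}

theorem measure_longEdgeIn (h : IndependentSetting kind l ν p P G)
    (hp : IsConnectionFunction kind p) (hl : l ∈ kind.intensities) (hn : IsComparableNorm nrm)
    (a : Pos d) (r b : ℝ) (n : ℕ) :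
    P (G.longEdgeIn nrm a r b (normBall nrm a n)) =
      eventProb kind l ν p (normBall nrm a n) (someEdge (longRel M nrm a r b)) :=
  h.measure_event hp hl (hn.measurableSet_normBall a n) (hn.isBounded_normBall a n)
    (measurableSet_someEdge (measurableSet_longRel hn a r b)) (encodes_longEdgeIn hn a r b _)

/-- Comparison of the probabilities of long edges at different intensities. -/
theorem measure_longEdgeAt_thinned {q : ℝ} {Ω' : Type*} [MeasurableSpace Ω'] {P' : Measure Ω'}
    {G' : RandomGraph Ω' d M} (hd : 0 < d) (hq : q ∈ Icc (0 : ℝ) 1)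
    (h : IndependentSetting kind l ν p P G) (h' : IndependentSetting kind (q * l) ν p P' G')
    (hp : IsConnectionFunction kind p) (hl : l ∈ kind.intensities)
    (hl' : q * l ∈ kind.intensities) (hn : IsComparableNorm nrm) (a : Pos d) (r b : ℝ) :
    P' (G'.longEdgeAt nrm a r b) ≤ P (G.longEdgeAt nrm a r b) ∧
    ENNReal.ofReal (q ^ 2) * P (G.longEdgeAt nrm a r b) ≤ P' (G'.longEdgeAt nrm a r b) := by
  have key := fun n : ℕ => eventProb_someEdge_thinned hd hl hq ν hp
    (measurableSet_longRel (M := M) hn a r b) (hn.measurableSet_normBall a n)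
    (hn.isBounded_normBall a n)
  rw [measure_longEdgeAt_eq_iSup, measure_longEdgeAt_eq_iSup, ENNReal.mul_iSup]
  simp only [h.measure_longEdgeIn hp hl hn, h'.measure_longEdgeIn hp hl' hn]
  exact ⟨iSup_mono fun n => (key n).1, iSup_mono fun n => (key n).2⟩

theorem measure_longEdgeAt_shift (h : IndependentSetting kind l ν p P G)
    (hp : IsConnectionFunction kind p) (hl : l ∈ kind.intensities) (hn : IsComparableNorm nrm)
    (z : Fin d → ℤ) (r b : ℝ) :
    P (G.longEdgeAt nrm (latticePoint z) r b) = P (G.longEdgeAt nrm 0 r b) := by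
  rw [measure_longEdgeAt_eq_iSup, measure_longEdgeAt_eq_iSup]
  congr 1 with n
  rw [h.measure_longEdgeIn hp hl hn, h.measure_longEdgeIn hp hl hn]
  refine eventProb_shift l ν hp z (hn.measurableSet_normBall _ _) (hn.isBounded_normBall _ _)
    (hn.measurableSet_normBall _ _) (hn.isBounded_normBall _ _) (preimage_normBall z n)
    (measurableSet_someEdge (measurableSet_longRel hn _ r b)) fun n x T => ?_
  simp [someEdge, longRel, shiftLoc]

theorem measure_localCrossing (h : IndependentSetting kind l ν p P G)
    (hp : IsConnectionFunction kind p) (hl : l ∈ kind.intensities) (hn : IsComparableNorm nrm)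
    (a : Pos d) {r : ℝ} (hr : 0 < r) :
    P (G.localCrossing nrm a r) =
      eventProb kind l ν p (normBall nrm a (3 * r)) (crossingProperty M nrm a r) :=
  h.measure_event hp hl (hn.measurableSet_normBall a _) (hn.isBounded_normBall a _)
    (measurableSet_crossingProperty hn a r) (encodes_localCrossing a hr)

theorem measure_localCrossing_shift (h : IndependentSetting kind l ν p P G)
    (hp : IsConnectionFunction kind p) (hl : l ∈ kind.intensities) (hn : IsComparableNorm nrm)
    (z : Fin d → ℤ) {r : ℝ} (hr : 0 < r) :
    P (G.localCrossing nrm (latticePoint z) r) = P (G.localCrossing nrm 0 r) := by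
  rw [h.measure_localCrossing hp hl hn _ hr, h.measure_localCrossing hp hl hn _ hr]
  refine eventProb_shift l ν hp z (hn.measurableSet_normBall _ _) (hn.isBounded_normBall _ _)
    (hn.measurableSet_normBall _ _) (hn.isBounded_normBall _ _) (preimage_normBall z (3 * r))
    (measurableSet_crossingProperty hn _ r) fun n x T => ?_
  simp [crossingProperty, shiftLoc]

/-- Each local crossing is visible in a ball of radius 3r, and the assumed distance of the centres
makes these balls disjoint. -/
theorem measure_localCrossing_inter (h : IndependentSetting kind l ν p P G)
    (hp : IsConnectionFunction kind p) (hl : l ∈ kind.intensities) (hn : IsComparableNorm nrm)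
    (z w : Fin d → ℤ) {r : ℝ} (hr : 0 < r)
    (hzw : 6 * r ≤ nrm (latticePoint z - latticePoint w)) :
    P (G.localCrossing nrm (latticePoint z) r ∩ G.localCrossing nrm (latticePoint w) r) =
      P (G.localCrossing nrm 0 r) ^ 2 := by
  have hdisj : Disjoint (normBall nrm (latticePoint z) (3 * r))
      (normBall nrm (latticePoint w) (3 * r)) := by
    rw [disjoint_left]
    intro x h1 h2
    have h3 := hn.sub_le (latticePoint z) x (latticePoint w)
    rw [hn.sub_comm (latticePoint z) x] at h3
    have h1' : nrm (x - latticePoint z) < 3 * r := h1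
    have h2' : nrm (x - latticePoint w) < 3 * r := h2
    linarith
  rw [h.measure_inter_events hp hl (hn.measurableSet_normBall _ _) (hn.isBounded_normBall _ _)
    (hn.measurableSet_normBall _ _) (hn.isBounded_normBall _ _) hdisj
    (measurableSet_crossingProperty hn _ r) (measurableSet_crossingProperty hn _ r)
    (encodes_localCrossing _ hr) (encodes_localCrossing _ hr),
    ← h.measure_localCrossing hp hl hn _ hr, ← h.measure_localCrossing hp hl hn _ hr,
    h.measure_localCrossing_shift hp hl hn z hr, h.measure_localCrossing_shift hp hl hn w hr, sq]

end IndependentSetting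

/-! ### Geometry of crossings -/

/-- A walk that leaves a set does so along an edge; it stays in the set before the first such
edge. -/
theorem SimpleGraph.Walk.exists_exit {V : Type*} {H H' : SimpleGraph V} {S : Set V}
    (hH' : ∀ x y, H.Adj x y → x ∈ S → y ∈ S → H'.Adj x y) {u v : V} (w : H.Walk u v)
    (hu : u ∈ S) (hv : v ∉ S) :
    ∃ a b, a ∈ S ∧ b ∉ S ∧ H.Adj a b ∧ H'.Reachable u a ∧ H.Reachable b v := by
  induction w with
  | nil => exact absurd hu hv
  | @cons u k v hadj w ih =>
    by_cases hk : k ∈ S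
    · obtain ⟨a, b, ha, hb, hab, hua, hbv⟩ := ih hk hv
      exact ⟨a, b, ha, hb, hab, (hH' u k hadj hu hk).reachable.trans hua, hbv⟩
    · exact ⟨u, k, hu, hk, hadj, SimpleGraph.Reachable.refl u, ⟨w⟩⟩

namespace RandomGraph

variable {Ω : Type*} {d : ℕ} {M : Type*} {G : RandomGraph Ω d M} {nrm : Pos d → ℝ}

theorem graphIn_le (W : Set (Pos d)) (ω : Ω) : G.graphIn W ω ≤ G.graph ω := fun _ _ h => h.1

theorem localCrossing_subset_annulusCrossing (r : ℝ) :
    G.localCrossing nrm 0 r ⊆ G.annulusCrossing nrm r := by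
  rintro ω ⟨i, hi, j, hj, hir, hjr, -, hreach⟩
  rw [sub_zero] at hir hjr
  exact ⟨i, hi, j, hj, hir, hjr, hreach.mono (graphIn_le _ ω)⟩

/-- A path from a small ball to the outside of a larger one crosses locally if it makes no
long jump. -/
theorem mem_localCrossing (hn : IsComparableNorm nrm) {a : Pos d} {r : ℝ} (hr : 0 < r) {ω : Ω}
    {i j : ℕ} (hi : i ∈ G.occ ω) (hij : (G.graph ω).Reachable i j)
    (hir : nrm (G.loc i ω - a) < r) (hjr : 2 * r ≤ nrm (G.loc j ω - a))
    (hshort : ∀ u v, (G.graph ω).Adj u v → nrm (G.loc u ω - a) < 2 * r →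
      nrm (G.loc u ω - G.loc v ω) ≤ r) :
    ω ∈ G.localCrossing nrm a r := by
  obtain ⟨w⟩ := hij
  obtain ⟨u, v, hu, hv, huv, hiu, -⟩ := w.exists_exit
    (H' := G.graphIn (normBall nrm a (3 * r)) ω) (S := {k | nrm (G.loc k ω - a) < 2 * r})
    (fun x y h hx hy => ⟨h, lt_trans (b := 2 * r) hx (show 2 * r < 3 * r by linarith),
      lt_trans (b := 2 * r) hy (show 2 * r < 3 * r by linarith)⟩)
    (show nrm (G.loc i ω - a) < 2 * r by linarith) (not_lt.2 hjr)
  have hu' : nrm (G.loc u ω - a) < 2 * r := hu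
  have hvr : nrm (G.loc v ω - a) < 3 * r := by
    have h1 := hn.sub_le (G.loc v ω) (G.loc u ω) a
    rw [hn.sub_comm (G.loc v ω) (G.loc u ω)] at h1
    linarith [hshort u v huv hu]
  have hadj : (G.graphIn (normBall nrm a (3 * r)) ω).Adj u v :=
    ⟨huv, show nrm (G.loc u ω - a) < 3 * r by linarith, hvr⟩
  exact ⟨i, hi, v, G.occ_of_adj ω v u huv.symm, hir, not_lt.1 hv, hvr, hiu.trans hadj.reachable⟩

/-- An annulus crossing without long edges forces two local crossings, far apart, at a smaller
scale. -/
theorem annulusCrossing_subset (hn : IsComparableNorm nrm) {r : ℝ} (hr : 0 < r)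
    {C : Finset (Fin d → ℤ)} {s : ℤ}
    (hC : ∀ x, nrm x < 22 * r → ∃ m ∈ C, nrm (x - latticePoint (s • m)) < r) :
    G.annulusCrossing nrm (10 * r) ⊆ G.longEdgeAt nrm 0 (30 * r) r ∪
      ⋃ m ∈ C, ⋃ m' ∈ C, ⋃ _ : 6 * r ≤ nrm (latticePoint (s • m) - latticePoint (s • m')),
        (G.localCrossing nrm (latticePoint (s • m)) r ∩
          G.localCrossing nrm (latticePoint (s • m')) r) := by
  rintro ω ⟨i, hi, j, hj, hir, hjr, hij⟩
  by_cases hlong : ω ∈ G.longEdgeAt nrm 0 (30 * r) r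
  · exact Or.inl hlong
  right
  have hshort : ∀ u v, (G.graph ω).Adj u v → nrm (G.loc u ω) < 30 * r →
      nrm (G.loc u ω - G.loc v ω) ≤ r := by
    intro u v huv hu
    by_contra! h
    exact hlong ⟨u, v, huv, by rwa [sub_zero], h⟩
  have tri : ∀ x y, nrm x ≤ nrm (x - y) + nrm y := fun x y => by
    simpa using hn.sub_le x y 0
  obtain ⟨w⟩ := hij
  -- The first exit from the ball of radius 10r gives x with norm between 10r and 11r. The same
  -- path, traversed backwards from j, gives y with norm between 20r and 21r, connected to x through
  -- j.
  obtain ⟨u, x, hu, hx, hux, -, hxj⟩ := w.exists_exit (H' := G.graph ω)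
    (S := {k | nrm (G.loc k ω) < 10 * r}) (fun _ _ h _ _ => h) hir
    (show ¬ nrm (G.loc j ω) < 10 * r by linarith)
  obtain ⟨y, v, hy, hv, hyv, hjy, hvi⟩ := w.reverse.exists_exit (H' := G.graph ω)
    (S := {k | 20 * r ≤ nrm (G.loc k ω)}) (fun _ _ h _ _ => h)
    (show 20 * r ≤ nrm (G.loc j ω) by linarith)
    (show ¬ 20 * r ≤ nrm (G.loc i ω) by linarith)
  simp only [mem_ofPred_eq, not_lt, not_le] at hu hx hy hv
  have hxy : (G.graph ω).Reachable x y := hxj.trans hjy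
  have hxr : nrm (G.loc x ω) ≤ 11 * r := by
    have h1 := tri (G.loc x ω) (G.loc u ω)
    rw [hn.sub_comm] at h1
    linarith [hshort u x hux (by linarith)]
  have hyr : nrm (G.loc y ω) ≤ 21 * r := by
    have h1 := tri (G.loc y ω) (G.loc v ω)
    rw [hn.sub_comm] at h1
    linarith [hshort v y hyv.symm (by linarith)]
  obtain ⟨m, hm, hxm⟩ := hC (G.loc x ω) (by linarith)
  obtain ⟨m', hm', hym⟩ := hC (G.loc y ω) (by linarith)
  have hz : nrm (latticePoint (s • m)) ≤ 12 * r := by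
    have h1 := tri (latticePoint (s • m)) (G.loc x ω)
    rw [hn.sub_comm] at h1
    linarith
  have hz' : nrm (latticePoint (s • m')) ≤ 22 * r := by
    have h1 := tri (latticePoint (s • m')) (G.loc y ω)
    rw [hn.sub_comm] at h1
    linarith
  have hyz := tri (G.loc y ω) (latticePoint (s • m))
  have hyz' := tri (G.loc y ω) (latticePoint (s • m'))
  have hxz' : nrm (latticePoint (s • m')) ≤
      nrm (G.loc x ω - latticePoint (s • m')) + nrm (G.loc x ω) := by
    have h1 := tri (latticePoint (s • m')) (G.loc x ω)
    rwa [hn.sub_comm] at h1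
  have hzz : nrm (latticePoint (s • m')) ≤
      nrm (latticePoint (s • m) - latticePoint (s • m')) + nrm (latticePoint (s • m)) := by
    have h1 := tri (latticePoint (s • m')) (latticePoint (s • m))
    rwa [hn.sub_comm] at h1
  simp only [mem_iUnion]
  -- The centre near x has norm at most 12r and the centre near y at least 19r, so they are at least
  -- 7r apart. The point y is at least 8r from the first centre and x at least 8r from the second.
  -- Balls of radius 2r around either centre stay within 24r, where no edge is long.
  refine ⟨m, hm, m', hm', by linarith, ?_, ?_⟩
  · refine mem_localCrossing hn hr (G.occ_of_adj ω x u hux.symm) hxy hxm (by linarith) ?_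
    intro a b hab ha
    exact hshort a b hab (by linarith [tri (G.loc a ω) (latticePoint (s • m))])
  · refine mem_localCrossing hn hr (G.occ_of_adj ω y v hyv) hxy.symm hym (by linarith) ?_
    intro a b hab ha
    exact hshort a b hab (by linarith [tri (G.loc a ω) (latticePoint (s • m'))])

/-- If |x| < r and |x - y| > 3r, then |y| > 2r, so the edge alone is a crossing. -/
theorem longEdgeAt_subset_annulusCrossing (hn : IsComparableNorm nrm) (r : ℝ) :
    G.longEdgeAt nrm 0 r (3 * r) ⊆ G.annulusCrossing nrm r := by
  rintro ω ⟨i, j, hadj, hi, hij⟩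
  rw [sub_zero] at hi
  have h1 := hn.sub_le (G.loc i ω) 0 (G.loc j ω)
  rw [sub_zero, zero_sub, hn.neg] at h1
  exact ⟨i, G.occ_of_adj ω i j hadj, j, G.occ_of_adj ω j i hadj.symm, hi, by linarith,
    hadj.reachable⟩

/-- The covering radius c r / 3 is chosen so that an edge longer than c r exceeds three times the
radius of the small ball in which it starts. -/
theorem longEdge_subset_iUnion {r c : ℝ} {C : Finset (Fin d → ℤ)} {s : ℤ}
    (hC : ∀ x, nrm x < r → ∃ m ∈ C, nrm (x - latticePoint (s • m)) < c * r / 3) :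
    G.longEdge nrm r c ⊆
      ⋃ m ∈ C, G.longEdgeAt nrm (latticePoint (s • m)) (c * r / 3) (3 * (c * r / 3)) := by
  rintro ω ⟨i, j, hadj, hi, hij⟩
  obtain ⟨m, hm, him⟩ := hC _ hi
  exact mem_biUnion hm ⟨i, j, hadj, him, by linarith⟩

end RandomGraph

/-! ### The quadratic recursion and limits at small intensity -/

/-- A bounded function whose values at the next decade are controlled by their squares and by an
error that vanishes at infinity tends to zero. -/
theorem tendsto_zero_of_sq_recursion {f e : ℝ → ℝ} {K r₀ : ℝ} (hK : 0 < K) (hr₀ : 0 < r₀)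
    (hf : ∀ r, 0 ≤ f r) (hrec : ∀ r, r₀ ≤ r → f (10 * r) ≤ K * f r ^ 2 + e r)
    (hstart : ∀ r, r ≤ 10 * r₀ → f r ≤ 1 / (4 * K))
    (hsmall : ∀ r, r₀ ≤ r → e r ≤ 1 / (8 * K)) (he : Tendsto e atTop (𝓝 0)) :
    Tendsto f atTop (𝓝 0) := by
  -- Below δ the quadratic term satisfies K f² ≤ f / 4, and the recursion becomes a linear
  -- contraction with error e.
  set δ := 1 / (4 * K) with hδ
  have hKδ : K * δ = 1 / 4 := by rw [hδ]; field_simp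
  have hδ0 : 0 < δ := by positivity
  have hsmall' : 1 / (8 * K) = δ / 2 := by rw [hδ]; field_simp; norm_num
  have hlin : ∀ r, r₀ ≤ r → f r ≤ δ → f (10 * r) ≤ f r / 4 + e r := by
    intro r hr hfr
    have h1 : K * f r ^ 2 ≤ f r / 4 := by
      calc K * f r ^ 2 = K * f r * f r := by ring
        _ ≤ K * δ * f r := by gcongr; exact hf r
        _ = f r / 4 := by rw [hKδ]; ring
    linarith [hrec r hr]
  -- The bound by δ passes from one decade to the next: δ / 4 from the contraction and δ / 2 from
  -- the error.
  have hbound : ∀ n : ℕ, ∀ r, r ≤ 10 ^ n * r₀ → f r ≤ δ := by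
    intro n
    induction n with
    | zero => exact fun r hr => hstart r (by linarith)
    | succ n ih =>
      intro r hr
      by_cases hr' : r ≤ 10 * r₀
      · exact hstart r hr'
      have h1 : r₀ ≤ r / 10 := by linarith
      have h2 := ih (r / 10) (by rw [pow_succ] at hr; linarith)
      have h3 := hlin (r / 10) h1 h2
      rw [mul_div_cancel₀ r (by norm_num)] at h3
      linarith [hsmall (r / 10) h1]
  have hall : ∀ r, f r ≤ δ := by
    intro r
    obtain ⟨n, hn⟩ := pow_unbounded_of_one_lt (r / r₀) (by norm_num : (1 : ℝ) < 10)
    exact hbound n r (by rw [div_lt_iff₀ hr₀] at hn; exact hn.le)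
  rw [Metric.tendsto_atTop]
  intro ε hε
  obtain ⟨r₁, hr₁⟩ := eventually_atTop.1 (he.eventually (gt_mem_nhds (by positivity : 0 < ε / 4)))
  set r₂ := max r₀ r₁ with hr₂
  -- Beyond `r₂` the error is below ε / 4, and ε / 2 is preserved: a quarter of it plus ε / 4 is
  -- less than ε / 2. The remaining part shrinks by the factor 4 at each decade.
  have hdec : ∀ n : ℕ, ∀ r, 10 ^ n * r₂ ≤ r → f r ≤ δ / 4 ^ n + ε / 2 := by
    intro n
    induction n with
    | zero => exact fun r _ => by linarith [hall r]
    | succ n ih =>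
      intro r hr
      have hpos : 0 < r₂ := hr₀.trans_le (le_max_left _ _)
      have h1 : 10 ^ n * r₂ ≤ r / 10 := by rw [pow_succ] at hr; linarith
      have h2 : r₂ ≤ r / 10 :=
        (le_mul_of_one_le_left hpos.le (one_le_pow₀ (by norm_num))).trans h1
      have h3 := hlin (r / 10) ((le_max_left _ _).trans h2) (hall _)
      rw [mul_div_cancel₀ r (by norm_num)] at h3
      have h4 := hr₁ (r / 10) ((le_max_right _ _).trans h2)
      have h5 := ih (r / 10) h1
      rw [pow_succ, ← div_div]
      linarith
  obtain ⟨n, hn⟩ := pow_unbounded_of_one_lt (4 * δ / ε) (by norm_num : (1 : ℝ) < 4)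
  refine ⟨10 ^ n * r₂, fun r hr => ?_⟩
  have h1 : δ / 4 ^ n < ε / 2 := by
    rw [div_lt_iff₀ hε] at hn
    rw [div_lt_iff₀ (by positivity)]
    linarith
  rw [Real.dist_eq, sub_zero, abs_of_nonneg (hf r)]
  linarith [hdec n r hr]

theorem limsup_eq_zero_iff_tendsto {α : Type*} {F : Filter α} {f : α → ℝ≥0∞} :
    limsup f F = 0 ↔ Tendsto f F (𝓝 0) := by
  rcases F.eq_or_neBot with rfl | hF
  · simp
  · exact ⟨fun h => tendsto_of_le_liminf_of_limsup_le bot_le h.le, fun h => h.limsup_eq⟩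

theorem limsup_measure_eq_zero_iff {Ω : Type*} [MeasurableSpace Ω] {P : Measure Ω}
    [IsFiniteMeasure P] {A : ℝ → Set Ω} :
    limsup (fun r => P (A r)) atTop = 0 ↔ Tendsto (fun r => P.real (A r)) atTop (𝓝 0) := by
  rw [limsup_eq_zero_iff_tendsto]
  exact (ENNReal.tendsto_toReal_zero_iff fun r => measure_ne_top P _).symm

theorem tendsto_janossyWeight_zero (kind : VertexKind) (v : ℝ≥0∞) :
    Tendsto (fun l => janossyWeight kind l v 0) (𝓝 0) (𝓝 1) := by
  rw [← ENNReal.ofReal_one]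
  cases kind with
  | poisson =>
    refine ENNReal.tendsto_ofReal (Continuous.tendsto' (by fun_prop) _ _ (by simp))
  | bernoulli =>
    refine ENNReal.tendsto_ofReal (Continuous.tendsto' (by fun_prop) _ _ (by simp))

theorem VertexKind.one_mem_intensities (kind : VertexKind) : (1 : ℝ) ∈ kind.intensities := by
  cases kind <;> simp [VertexKind.intensities]

theorem VertexKind.pos_of_mem_intensities {kind : VertexKind} {l : ℝ}
    (hl : l ∈ kind.intensities) : 0 < l := by
  cases kind with
  | poisson => exact hl
  | bernoulli => exact hl.1

theorem VertexKind.mem_intensities_of_le {kind : VertexKind} {l : ℝ} (hl : 0 < l) (h1 : l ≤ 1) :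
    l ∈ kind.intensities := by
  cases kind with
  | poisson => exact hl
  | bernoulli => exact ⟨hl, h1⟩

/-! ### Crossing estimates at a fixed intensity -/

namespace IndependentSetting

variable {kind : VertexKind} {Ω : Type*} [MeasurableSpace Ω] {d : ℕ}
    {M : Type*} [MeasurableSpace M] {l : ℝ} {ν : Measure M} [IsProbabilityMeasure ν]
    {p : Pos d × M → Pos d × M → ℝ} {P : Measure Ω} {G : RandomGraph Ω d M} {nrm : Pos d → ℝ}

/-- A crossing needs a vertex in the inner ball, and the weight of zero points is the probability
that the ball of radius R is empty. -/
theorem measure_annulusCrossing_le (h : IndependentSetting kind l ν p P G)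
    (hl : l ∈ kind.intensities) (hn : IsComparableNorm nrm) {r R : ℝ} (hr : r ≤ R) :
    P (G.annulusCrossing nrm r) ≤
      1 - janossyWeight kind l (kind.locMeasure d (normBall nrm 0 R)) 0 := by
  have := h.prob
  have hW := hn.measurableSet_normBall 0 R
  -- The empty family of sets turns the occupation law into the void probability.
  have hlaw := h.atom_law hl hW (hn.isBounded_normBall 0 R) (ι := Empty)
    (B := fun _ => ∅) (fun i => i.elim) ⟨fun i => i.elim, fun i => i.elim⟩ (fun i => i.elim)
  simp only [iUnion_of_empty, sdiff_empty, IsEmpty.forall_iff, and_true, Fintype.card_eq_zero,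
    Finset.univ_eq_empty, Finset.prod_empty, mul_one] at hlaw
  rw [← hlaw, ← prob_compl_eq_one_sub
    (measurableSet_count_zero h.measurableVertices (measurableSet_window M hW))]
  refine measure_mono ?_
  rintro ω ⟨i, hi, -, -, hir, -⟩ h0
  rw [mem_ofPred_eq, count_eq_encard, encard_eq_zero] at h0
  have : i ∈ G.idx (window M (normBall nrm 0 R)) ω :=
    ⟨hi, show nrm (G.loc i ω - 0) < R by rw [sub_zero]; linarith⟩
  rw [h0] at this
  exact this

/-- A union bound over at most |C|² pairs of centres. For each distant pair the two local crossings
are independent, and by shift invariance each is at most as likely as a crossing at the origin. -/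
theorem measureReal_annulusCrossing_le (h : IndependentSetting kind l ν p P G)
    (hp : IsConnectionFunction kind p) (hl : l ∈ kind.intensities) (hn : IsComparableNorm nrm)
    {r : ℝ} (hr : 0 < r) {C : Finset (Fin d → ℤ)} {s : ℤ}
    (hC : ∀ x, nrm x < 22 * r → ∃ m ∈ C, nrm (x - latticePoint (s • m)) < r) :
    P.real (G.annulusCrossing nrm (10 * r)) ≤
      (C.card : ℝ) ^ 2 * P.real (G.annulusCrossing nrm r) ^ 2 +
        P.real (G.longEdgeAt nrm 0 (30 * r) r) := by
  have := h.prob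
  rw [add_comm]
  refine (measureReal_mono (annulusCrossing_subset hn hr hC)).trans
    ((measureReal_union_le _ _).trans ?_)
  gcongr
  calc _ ≤ ∑ _m ∈ C, ∑ _m' ∈ C, P.real (G.annulusCrossing nrm r) ^ 2 := by
        refine (measureReal_biUnion_finset_le _ _).trans (Finset.sum_le_sum fun m _ => ?_)
        refine (measureReal_biUnion_finset_le _ _).trans (Finset.sum_le_sum fun m' _ => ?_)
        by_cases hfar : 6 * r ≤ nrm (latticePoint (s • m) - latticePoint (s • m'))
        · simp only [hfar, iUnion_true]
          rw [measureReal_def, h.measure_localCrossing_inter hp hl hn _ _ hr hfar,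
            ENNReal.toReal_pow]
          exact pow_le_pow_left₀ ENNReal.toReal_nonneg
            (measureReal_mono (localCrossing_subset_annulusCrossing r)) 2
        · simp only [hfar, iUnion_of_empty, measureReal_empty]
          positivity
    _ = (C.card : ℝ) ^ 2 * P.real (G.annulusCrossing nrm r) ^ 2 := by
        simp only [Finset.sum_const, nsmul_eq_mul]
        ring

/-- Without annulus crossings there are no long edges. -/
theorem noLongEdges_of_annulusCrossing (h : IndependentSetting kind l ν p P G)
    (hp : IsConnectionFunction kind p) (hl : l ∈ kind.intensities) (hn : IsComparableNorm nrm)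
    (hlim : limsup (fun r : ℝ => P (G.annulusCrossing nrm r)) atTop = 0) :
    G.NoLongEdges nrm P := by
  intro c hc
  rw [limsup_eq_zero_iff_tendsto] at hlim ⊢
  -- The cover is used at scale c r / 3, where a ball of radius r has relative size 3 / c.
  obtain ⟨C, hC⟩ := hn.exists_lattice_cover (3 / c)
  have hscale : Tendsto (fun r : ℝ => c * r / 3) atTop atTop :=
    (tendsto_id.const_mul_atTop hc).atTop_div_const (by norm_num)
  have hlim' : Tendsto (fun r : ℝ => (C.card : ℝ≥0∞) * P (G.annulusCrossing nrm (c * r / 3)))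
      atTop (𝓝 0) := by
    have := ENNReal.Tendsto.const_mul (hlim.comp hscale)
      (Or.inr (ENNReal.natCast_ne_top C.card))
    rwa [mul_zero] at this
  refine tendsto_of_tendsto_of_tendsto_of_le_of_le' tendsto_const_nhds hlim'
    (Eventually.of_forall fun _ => bot_le) ?_
  filter_upwards [hscale.eventually hC] with r hr
  obtain ⟨s, hs⟩ := hr
  have hs' : ∀ x, nrm x < r → ∃ m ∈ C, nrm (x - latticePoint (s • m)) < c * r / 3 := by
    intro x hx
    refine hs x ?_
    have : 3 / c * (c * r / 3) = r := by field_simp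
    rwa [this]
  calc P (G.longEdge nrm r c)
      ≤ ∑ m ∈ C, P (G.longEdgeAt nrm (latticePoint (s • m)) (c * r / 3) (3 * (c * r / 3))) :=
        (measure_mono (longEdge_subset_iUnion hs')).trans (measure_biUnion_finset_le _ _)
    _ ≤ ∑ _m ∈ C, P (G.annulusCrossing nrm (c * r / 3)) := by
        refine Finset.sum_le_sum fun m _ => ?_
        rw [h.measure_longEdgeAt_shift hp hl hn]
        exact measure_mono (longEdgeAt_subset_annulusCrossing hn _)
    _ = C.card * P (G.annulusCrossing nrm (c * r / 3)) := by
        rw [Finset.sum_const, nsmul_eq_mul]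

end IndependentSetting

/-! ### Comparison across intensities and the critical value -/

section Family

variable {kind : VertexKind} {d : ℕ} {nrm : Pos d → ℝ} {M : Type*} [MeasurableSpace M]
    {ν : Measure M} [IsProbabilityMeasure ν] {p : Pos d × M → Pos d × M → ℝ}
    {Ω : ℝ → Type*} [∀ l, MeasurableSpace (Ω l)]
    {P : ∀ l, Measure (Ω l)} {G : ∀ l, RandomGraph (Ω l) d M}

/-- The thinning comparison from intensity one with q = l. The upper bound has constant one, so it
is uniform in l. -/
theorem measure_longEdgeAt_le_of_le_one (hd : 0 < d) (hn : IsComparableNorm nrm)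
    (hp : IsConnectionFunction kind p)
    (hG : ∀ l ∈ kind.intensities, IndependentSetting kind l ν p (P l) (G l))
    {l : ℝ} (hl : l ∈ kind.intensities) (h1 : l ≤ 1) (a : Pos d) (r b : ℝ) :
    (P l).real ((G l).longEdgeAt nrm a r b) ≤ (P 1).real ((G 1).longEdgeAt nrm a r b) ∧
    l ^ 2 * (P 1).real ((G 1).longEdgeAt nrm a r b) ≤
      (P l).real ((G l).longEdgeAt nrm a r b) := by
  have hone := kind.one_mem_intensities
  have i1 := (hG 1 hone).prob
  have i2 := (hG l hl).prob
  have h' : IndependentSetting kind (l * 1) ν p (P l) (G l) := by rw [mul_one]; exact hG l hl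
  obtain ⟨hle, hge⟩ := (hG 1 hone).measure_longEdgeAt_thinned hd
    ⟨(VertexKind.pos_of_mem_intensities hl).le, h1⟩ h' hp hone (by rwa [mul_one]) hn a r b
  refine ⟨ENNReal.toReal_mono (measure_ne_top _ _) hle, ?_⟩
  have := ENNReal.toReal_mono (measure_ne_top _ _) hge
  rwa [ENNReal.toReal_mul, ENNReal.toReal_ofReal (sq_nonneg l)] at this

/-- Probabilities of long edges at different intensities are comparable. -/
theorem exists_measure_longEdgeAt_comparable (hd : 0 < d) (hn : IsComparableNorm nrm)
    (hp : IsConnectionFunction kind p)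
    (hG : ∀ l ∈ kind.intensities, IndependentSetting kind l ν p (P l) (G l))
    {l : ℝ} (hl : l ∈ kind.intensities) :
    ∃ K : ℝ, ∀ a r b,
      (P l).real ((G l).longEdgeAt nrm a r b) ≤ K * (P 1).real ((G 1).longEdgeAt nrm a r b) ∧
      (P 1).real ((G 1).longEdgeAt nrm a r b) ≤ K * (P l).real ((G l).longEdgeAt nrm a r b) := by
  have hone := kind.one_mem_intensities
  have hpos := VertexKind.pos_of_mem_intensities hl
  rcases le_or_gt l 1 with h1 | h1
  · refine ⟨(l ^ 2)⁻¹, fun a r b => ?_⟩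
    obtain ⟨hle, hge⟩ := measure_longEdgeAt_le_of_le_one hd hn hp hG hl h1 a r b
    refine ⟨hle.trans ?_, ?_⟩
    · exact le_mul_of_one_le_left measureReal_nonneg
        ((one_le_inv₀ (by positivity)).2 (pow_le_one₀ hpos.le h1))
    · rwa [le_inv_mul_iff₀ (by positivity)]
  -- For l > 1 the roles are exchanged: intensity one arises from l by thinning with q = 1 / l.
  · refine ⟨l ^ 2, fun a r b => ?_⟩
    have i1 := (hG 1 hone).prob
    have i2 := (hG l hl).prob
    have e : l⁻¹ * l = 1 := inv_mul_cancel₀ hpos.ne'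
    have h' : IndependentSetting kind (l⁻¹ * l) ν p (P 1) (G 1) := by rw [e]; exact hG 1 hone
    obtain ⟨hle, hge⟩ := (hG l hl).measure_longEdgeAt_thinned hd
      ⟨inv_nonneg.2 hpos.le, inv_le_one_of_one_le₀ h1.le⟩ h' hp hl (by rwa [e]) hn a r b
    constructor
    · have := ENNReal.toReal_mono (measure_ne_top _ _) hge
      rwa [ENNReal.toReal_mul, ENNReal.toReal_ofReal (by positivity), inv_pow,
        inv_mul_le_iff₀ (by positivity)] at this
    · exact (ENNReal.toReal_mono (measure_ne_top _ _) hle).trans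
        (le_mul_of_one_le_left ENNReal.toReal_nonneg (one_le_pow₀ h1.le))

theorem noLongEdges_iff_one (hd : 0 < d) (hn : IsComparableNorm nrm)
    (hp : IsConnectionFunction kind p)
    (hG : ∀ l ∈ kind.intensities, IndependentSetting kind l ν p (P l) (G l))
    {l : ℝ} (hl : l ∈ kind.intensities) :
    (G l).NoLongEdges nrm (P l) ↔ (G 1).NoLongEdges nrm (P 1) := by
  have i1 := (hG 1 kind.one_mem_intensities).prob
  have i2 := (hG l hl).prob
  obtain ⟨K, hK⟩ := exists_measure_longEdgeAt_comparable hd hn hp hG hl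
  refine forall₂_congr fun c _ => ?_
  simp only [limsup_measure_eq_zero_iff, longEdge_eq_longEdgeAt]
  constructor
  · intro h
    refine squeeze_zero (fun _ => measureReal_nonneg) (fun r => (hK 0 r (c * r)).2) ?_
    simpa using h.const_mul K
  · intro h
    refine squeeze_zero (fun _ => measureReal_nonneg) (fun r => (hK 0 r (c * r)).1) ?_
    simpa using h.const_mul K

/-- If there are no long edges, then there are no annulus crossings at small intensities. -/
theorem exists_annulusCrossing_limsup_eq_zero (hd : 0 < d) (hn : IsComparableNorm nrm)
    (hp : IsConnectionFunction kind p)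
    (hG : ∀ l ∈ kind.intensities, IndependentSetting kind l ν p (P l) (G l))
    (hlong : (G 1).NoLongEdges nrm (P 1)) :
    ∃ l₀ : ℝ, 0 < l₀ ∧ ∀ l ∈ kind.intensities, l < l₀ →
      limsup (fun r : ℝ => P l ((G l).annulusCrossing nrm r)) atTop = 0 := by
  have i1 := (hG 1 kind.one_mem_intensities).prob
  obtain ⟨C, hC⟩ := hn.exists_lattice_cover 22
  -- The summand 1 keeps K positive whatever the size of the cover.
  set K : ℝ := (C.card : ℝ) ^ 2 + 1 with hK
  have hKpos : 0 < K := by positivity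
  set e : ℝ → ℝ := fun r => (P 1).real ((G 1).longEdgeAt nrm 0 (30 * r) r) with he
  have he0 : Tendsto e atTop (𝓝 0) := by
    -- An edge longer than r with an end in the ball of radius 30r is a long edge at scale 30r with
    -- constant 1 / 30.
    have h1 := limsup_measure_eq_zero_iff.1 (hlong (1 / 30) (by norm_num))
    have h2 := h1.comp (tendsto_id.const_mul_atTop (by norm_num : (0 : ℝ) < 30))
    refine h2.congr fun r => ?_
    simp only [Function.comp_apply, longEdge_eq_longEdgeAt, he, id]
    congr 2
    ring
  -- The starting scale is fixed with the errors at intensity one, which dominate those at every l ≤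
  -- 1. The intensity is then lowered until the ball of radius 10 r₀ is almost surely empty up to
  -- the allowed probability 1 / (4K).
  obtain ⟨r₀, hr₀⟩ := eventually_atTop.1 (hC.and ((he0.eventually
    (gt_mem_nhds (by positivity : 0 < 1 / (8 * K)))).and (eventually_gt_atTop 0)))
  have hr₀pos := (hr₀ r₀ le_rfl).2.2
  set v := kind.locMeasure d (normBall nrm 0 (10 * r₀)) with hv
  have hstart : ∀ᶠ l in 𝓝 (0 : ℝ), 1 - janossyWeight kind l v 0 < ENNReal.ofReal (1 / (4 * K)) := by
    have h1 : Tendsto (fun l => 1 - janossyWeight kind l v 0) (𝓝 0) (𝓝 (1 - 1)) :=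
      ENNReal.Tendsto.sub tendsto_const_nhds (tendsto_janossyWeight_zero kind v)
        (Or.inl ENNReal.one_ne_top)
    rw [tsub_self] at h1
    exact h1.eventually (gt_mem_nhds (ENNReal.ofReal_pos.2 (by positivity)))
  obtain ⟨ε, hε, hball⟩ := Metric.eventually_nhds_iff.1 hstart
  refine ⟨min ε 1, lt_min hε one_pos, fun l hl hlt => ?_⟩
  have i2 := (hG l hl).prob
  have hpos := VertexKind.pos_of_mem_intensities hl
  rw [limsup_measure_eq_zero_iff]
  refine tendsto_zero_of_sq_recursion hKpos hr₀pos (fun _ => measureReal_nonneg) (e := e) ?_ ?_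
    (fun r hr => (hr₀ r hr).2.1.le) he0
  · intro r hr
    obtain ⟨⟨s, hs⟩, -, hrpos⟩ := hr₀ r hr
    refine ((hG l hl).measureReal_annulusCrossing_le hp hl hn hrpos hs).trans ?_
    have := (measure_longEdgeAt_le_of_le_one hd hn hp hG hl
      (hlt.le.trans (min_le_right _ _)) 0 (30 * r) r).1
    gcongr
    rw [hK]
    linarith
  · intro r hr
    have hdist : dist l 0 < ε := by
      rw [Real.dist_eq, sub_zero, abs_of_pos hpos]
      exact hlt.trans_le (min_le_left _ _)
    have h1 := ((hG l hl).measure_annulusCrossing_le hl hn hr).trans (hball hdist).le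
    exact ENNReal.toReal_le_of_le_ofReal (by positivity) h1

theorem noLongEdges_iff_criticalAnnulus_pos (hd : 0 < d) (hn : IsComparableNorm nrm)
    (hp : IsConnectionFunction kind p)
    (hG : ∀ l ∈ kind.intensities, IndependentSetting kind l ν p (P l) (G l)) :
    (G 1).NoLongEdges nrm (P 1) ↔ 0 < criticalAnnulus kind.intensities nrm P G := by
  constructor
  · intro h
    obtain ⟨l₀, hl₀, hzero⟩ := exists_annulusCrossing_limsup_eq_zero hd hn hp hG h
    refine (ENNReal.ofReal_pos.2 hl₀).trans_le (le_sInf ?_)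
    rintro _ ⟨l, ⟨hl, hpos⟩, rfl⟩
    refine ENNReal.ofReal_le_ofReal (not_lt.1 fun hlt => hpos.ne' (hzero l hl hlt))
  · intro h
    -- An intensity strictly below the critical value and at most one is admissible for both kinds,
    -- and has no crossings in the limit by the definition of the infimum. The comparison then
    -- carries the conclusion to intensity one.
    obtain ⟨t, ht, htc⟩ := exists_between h
    set l : ℝ := min t.toReal 1 with hl
    have htt : t ≠ ∞ := (htc.trans_le le_top).ne
    have hlpos : 0 < l := lt_min (ENNReal.toReal_pos ht.ne' htt) one_pos
    have hlI : l ∈ kind.intensities := VertexKind.mem_intensities_of_le hlpos (min_le_right _ _)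
    have hlc : ENNReal.ofReal l < criticalAnnulus kind.intensities nrm P G :=
      (ENNReal.ofReal_le_of_le_toReal (min_le_left _ _)).trans_lt htc
    refine (noLongEdges_iff_one hd hn hp hG hlI).1
      ((hG l hlI).noLongEdges_of_annulusCrossing hp hlI hn ?_)
    by_contra hne
    exact notMem_of_lt_csInf hlc (OrderBot.bddBelow _)
      ⟨l, ⟨hlI, pos_iff_ne_zero.2 hne⟩, rfl⟩

end Family

theorem theorem1p4 (kind : VertexKind) {d : ℕ} (hd : 0 < d)
    (nrm : Pos d → ℝ) (hnrm : nrm = euclideanNorm d ∨ nrm = maxNorm d)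
    {M : Type*} [MeasurableSpace M] (ν : Measure M) [IsProbabilityMeasure ν]
    (p : Pos d × M → Pos d × M → ℝ) (hp : IsConnectionFunction kind p)
    {Ω : ℝ → Type*} [∀ l, MeasurableSpace (Ω l)]
    (P : ∀ l, Measure (Ω l)) (G : ∀ l, RandomGraph (Ω l) d M)
    (hG : ∀ l ∈ kind.intensities, IndependentSetting kind l ν p (P l) (G l)) :
    (∀ l ∈ kind.intensities,
      (fun r : ℝ => (P 1).real ((G 1).longEdge nrm r 1)) =Θ[atTop]
        (fun r : ℝ => (P l).real ((G l).longEdge nrm r 1))) ∧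
    (∀ l ∈ kind.intensities, ∀ l' ∈ kind.intensities,
      (G l).NoLongEdges nrm (P l) ↔ (G l').NoLongEdges nrm (P l')) ∧
    ((G 1).NoLongEdges nrm (P 1) ↔ 0 < criticalAnnulus kind.intensities nrm P G) := by
  have hn : IsComparableNorm nrm := by
    rcases hnrm with rfl | rfl
    exacts [isComparableNorm_euclideanNorm d, isComparableNorm_maxNorm d]
  refine ⟨fun l hl => ?_, fun l hl l' hl' => ?_, noLongEdges_iff_criticalAnnulus_pos hd hn hp hG⟩
  · obtain ⟨K, hK⟩ := exists_measure_longEdgeAt_comparable hd hn hp hG hl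
    simp only [longEdge_eq_longEdgeAt]
    refine ⟨IsBigO.of_bound K (Eventually.of_forall fun r => ?_),
      IsBigO.of_bound K (Eventually.of_forall fun r => ?_)⟩
    · rw [Real.norm_of_nonneg measureReal_nonneg, Real.norm_of_nonneg measureReal_nonneg]
      exact (hK 0 r (1 * r)).2
    · rw [Real.norm_of_nonneg measureReal_nonneg, Real.norm_of_nonneg measureReal_nonneg]
      exact (hK 0 r (1 * r)).1
  · rw [noLongEdges_iff_one hd hn hp hG hl, noLongEdges_iff_one hd hn hp hG hl']

end
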